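/- Fix $\rho,\gamma>0$. **Weight function.** Let $w$ be a positive even function on $\mathbb R$ that extends to a meromorphic function on $\mathbb C$ with period $i\rho$, without poles on $\mathbb R$, and whose only singularities in the strip $0<\mathrm{Im}\,r<\rho$ are finitely many simple poles. Label these poles as $2L$ distinct points $r_1,\dots,r_{2L}$ with $r_{j+L}=i\rho-r_j$ ($1\le j\le L$), and let $w_j=\mathrm{Res}_{r=r_j}w$. **Coefficients.** Let $m^{\pm}(r,k)$ be smooth $\mathbb C$-valued functions on $\mathbb R^2$ with $\overline{m^\tau(r,k)}=m^\tau(r,-k)$ such that, for each $k\in\mathbb R$, the functions $m^{\pm}(\cdot,k)$ extend to entire functions; assume that they are all $i\rho$-periodic or all $i\rho$-antiperiodic in $r$. Let $T,R$ be smooth functions on $\mathbb R$ with $\overline{T(k)}=T(-k)$, $\overline{R(k)}=R(-k)$ and $$T(-k)T(k)+R(-k)R(k)=1,\qquad T(-k)R(k)+R(-k)T(k)=0\qquad(k\in\mathbb R).$$ Assume that for $|\mathrm{Re}\,r|$ large $w(r)^{1/2}$ (the positive root for real $r$) continues analytically, and that, uniformly for $\mathrm{Im}\,r$ and $k$ in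 compact subsets of $\mathbb R$, $$w(r)^{1/2}m^+(r,k)=\begin{cases}T(k)+O(e^{-\gamma r}),&\mathrm{Re}\,r\to\infty,\\ 1+O(e^{\gamma r}),&\mathrm{Re}\,r\to-\infty,\end{cases}\qquad w(r)^{1/2}m^-(r,k)=\begin{cases}O(e^{-\gamma r}),&\mathrm{Re}\,r\to\infty,\\-R(k)+O(e^{\gamma r}),&\mathrm{Re}\,r\to-\infty,\end{cases}$$ and $\partial_r\big(w(r)^{1/2}m^{\pm}(r,k)\big)=O(e^{-\gamma|\mathrm{Re}\,r|})$ as $\mathrm{Re}\,r\to\pm\infty$. For $\alpha,\tau\in\{+,-\}$ put $$M^\tau_\alpha(r,k,k')=m^+(-r,-k)\,m^\tau(-\alpha r,k')+m^-(r,-k)\,m^{-\tau}(\alpha r,k'),$$ and assume $M^\alpha_\alpha(r,k,k)=M^\alpha_\alpha(-r,k,k)$ for $\alpha=+,-$ and $(r,k)\in\mathbb R^2$. **Transform.** Let $\Psi(r,k)=w(r)^{1/2}\sum_{\tau=\pm}m^\tau(r,k)e^{i\tau rk}$, $F_+(r,k)=\Psi(r,k)$, $F_-(r,k)=-\Psi(-r,k)$.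 For $f=(f_+,f_-)\in\hat{\mathcal C}=C_0^\infty((0,\infty))^2$ let $$(\mathcal Ff)(r)=\frac1{\sqrt{2\pi}}\int_0^\infty\sum_{\delta=\pm}F_\delta(r,k)f_\delta(k)\,dk .$$ Let $(d,e)_1=\int_{\mathbb R}\overline{d}\,e\,dr$ and $(f,g)_2=\sum_{\delta=\pm}\int_0^\infty\overline{f_\delta}\,g_\delta\,dk$. **Theorem.** $\mathcal F$ maps $\hat{\mathcal C}$ into $L^2(\mathbb R)$, and for all $f,g\in\hat{\mathcal C}$ $$(\mathcal Ff,\mathcal Fg)_1=(f,g)_2+i\sum_{j=1}^Lw_j\sum_{\delta,\delta'=\pm}\delta\delta'\int_0^\infty dk\,\overline{f_\delta(k)}\int_0^\infty dk'\,g_{\delta'}(k')\sum_{\nu,\nu'=\pm}\frac{e^{ir_j(\nu k-\nu'k')}}{1-e^{\rho(\nu'k'-\nu k)}}\,M^{\delta\delta'\nu\nu'}_{\delta\delta'}(\nu r_j,k,k'),$$ where each of the $4L$ residue integrals (fixed $j,\delta,\delta'$, with the sum over $\nu,\nu'$ inside the integral) converges absolutely. **Corollary.** With $\mu^\tau(r,k)=e^{i\tau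 rk}m^\tau(r,k)$ and, for $k\ne k'$, $$\hat R_{\delta,\delta'}(k,k')=i\delta\delta'\sum_{j=1}^Lw_j\sum_{\nu,\nu'=\pm}\frac{\mu^{-\delta\nu}(\delta r_j,-k)\mu^{-\delta'\nu'}(\delta'r_j,k')+\mu^{\delta\nu}(-\delta r_j,-k)\mu^{\delta'\nu'}(-\delta'r_j,k')}{1-e^{\rho(\nu'k'-\nu k)}},$$ the transform $\mathcal F$ is isometric, that is, $(\mathcal Ff,\mathcal Ff)_1=(f,f)_2$ for all $f\in\hat{\mathcal C}$, if and only if $\hat R_{\delta,\delta'}(k,k')=0$ for all $\delta,\delta'\in\{+,-\}$ and all $k,k'>0$ with $k\neq k'$. -/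

import Mathlib

open MeasureTheory Filter Topology
open scoped ContDiff ComplexConjugate

/- Signs `+, -` are modelled by the two units `1, -1` of `ℤ`. The two plane wave coefficients are
one function `m : ℤˣ → ℂ → ℝ → ℂ`, `m τ r k`, with `r` complex (entire extension) and `k` real. -/

namespace PlaneWave

/-- A sign `τ = +, -`, as the complex number `1` or `-1`. -/
def sgn (τ : ℤˣ) : ℂ := ((τ : ℤ) : ℂ)

/-- The residue `lim_{r → z} (r - z) f(r)` of a function `f` with a simple pole at `z`. -/
noncomputable def simpleResidue (f : ℂ → ℂ) (z : ℂ) : ℂ :=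
  limUnder (𝓝[≠] z) fun r => (r - z) * f r

/-- `s` is the analytic continuation of the positive square root `w(r)^{1/2}`, `r ∈ ℝ`,
to the two half planes `|Re r| > R₀`. -/
structure IsSqrtBranch (w : ℂ → ℂ) (R₀ : ℝ) (s : ℂ → ℂ) : Prop where
  differentiableOn : DifferentiableOn ℂ s {r : ℂ | R₀ < |r.re|}
  sq_eq : ∀ r : ℂ, R₀ < |r.re| → s r ^ 2 = w r
  eq_sqrt : ∀ x : ℝ, R₀ < |x| → s (x : ℂ) = (Real.sqrt (w x).re : ℂ)

/-- `Ψ(r,k) = w(r)^{1/2} ∑_τ m^τ(r,k) e^{iτrk}`, for real `r` and `k`. -/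
noncomputable def Psi (w : ℂ → ℂ) (m : ℤˣ → ℂ → ℝ → ℂ) (r k : ℝ) : ℂ :=
  (Real.sqrt (w r).re : ℂ) *
    ∑ τ : ℤˣ, m τ (r : ℂ) k * Complex.exp (Complex.I * sgn τ * (r : ℂ) * (k : ℂ))

/-- The kernels `F_+(r,k) = Ψ(r,k)` and `F_-(r,k) = -Ψ(-r,k)`. -/
noncomputable def kernel (w : ℂ → ℂ) (m : ℤˣ → ℂ → ℝ → ℂ) (δ : ℤˣ) (r k : ℝ) : ℂ :=
  if δ = 1 then Psi w m r k else -Psi w m (-r) k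

/-- `(F f)(r) = (2π)^{-1/2} ∫_0^∞ ∑_δ F_δ(r,k) f_δ(k) dk`. -/
noncomputable def transform (w : ℂ → ℂ) (m : ℤˣ → ℂ → ℝ → ℂ) (f : ℤˣ → ℝ → ℂ) (r : ℝ) : ℂ :=
  (1 / Real.sqrt (2 * Real.pi) : ℝ) *
    ∫ k in Set.Ioi (0 : ℝ), ∑ δ : ℤˣ, kernel w m δ r k * f δ k

/-- Pairs `f = (f_+, f_-)` of smooth functions with compact support in `(0,∞)`
(extended by zero to `ℝ`). -/
def IsTestPair (f : ℤˣ → ℝ → ℂ) : Prop :=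
  ∀ δ : ℤˣ, ContDiff ℝ ∞ (f δ) ∧ HasCompactSupport (f δ) ∧ tsupport (f δ) ⊆ Set.Ioi 0

/-- The inner product of `L²(ℝ, dr)`. -/
noncomputable def inner₁ (d e : ℝ → ℂ) : ℂ := ∫ r : ℝ, conj (d r) * e r

/-- The inner product of `L²((0,∞), dk) ⊗ ℂ²`. -/
noncomputable def inner₂ (f g : ℤˣ → ℝ → ℂ) : ℂ :=
  ∑ δ : ℤˣ, ∫ k in Set.Ioi (0 : ℝ), conj (f δ k) * g δ k

/-- `M_α^τ(r,k,k') = m^+(-r,-k) m^τ(-αr,k') + m^-(r,-k) m^{-τ}(αr,k')`. -/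
def coeffM (m : ℤˣ → ℂ → ℝ → ℂ) (α τ : ℤˣ) (r : ℂ) (k k' : ℝ) : ℂ :=
  m 1 (-r) (-k) * m τ (-(sgn α * r)) k' + m (-1) r (-k) * m (-τ) (sgn α * r) k'

/-- The standing assumptions on the weight function `w`, the coefficients `m^±`, the transmission
and reflection coefficients `T`, `R`, and the labelling `r_1, …, r_L` of half of the poles of `w`
in the period strip. The values of `w` at its poles carry no information. -/
structure Assumptions (ρ γ : ℝ) (w : ℂ → ℂ) (m : ℤˣ → ℂ → ℝ → ℂ) (T R : ℝ → ℂ)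
    (L : ℕ) (pole : Fin L → ℂ) : Prop where
  rho_pos : 0 < ρ
  gamma_pos : 0 < γ
  -- the weight function
  w_pos : ∀ x : ℝ, ∃ y : ℝ, 0 < y ∧ w (x : ℂ) = (y : ℂ)
  w_even : ∀ x : ℝ, w (-(x : ℂ)) = w (x : ℂ)
  w_meromorphic : Meromorphic w
  w_periodic : ∀ r : ℂ, w (r + Complex.I * ρ) = w r
  -- its poles in the period strip: `r_j` and `r_{j+L} = iρ - r_j`, all distinct and simple
  pole_im : ∀ j, 0 < (pole j).im ∧ (pole j).im < ρ
  pole_injective : Function.Injective pole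
  pole_ne_reflected : ∀ i j, pole i ≠ Complex.I * ρ - pole j
  pole_simple : ∀ j, meromorphicOrderAt w (pole j) = ((-1 : ℤ) : WithTop ℤ)
  w_analytic : ∀ r : ℂ, 0 ≤ r.im → r.im < ρ →
    (∀ j, r ≠ pole j ∧ r ≠ Complex.I * ρ - pole j) → AnalyticAt ℂ w r
  -- the coefficients
  m_smooth : ∀ τ, ContDiff ℝ ∞ (fun p : ℝ × ℝ => m τ (p.1 : ℂ) p.2)
  m_conj : ∀ (τ : ℤˣ) (r k : ℝ), conj (m τ (r : ℂ) k) = m τ (r : ℂ) (-k)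
  m_entire : ∀ τ (k : ℝ), Differentiable ℂ (fun r : ℂ => m τ r k)
  m_periodic : (∀ τ (r : ℂ) (k : ℝ), m τ (r + Complex.I * ρ) k = m τ r k) ∨
    (∀ τ (r : ℂ) (k : ℝ), m τ (r + Complex.I * ρ) k = -m τ r k)
  -- the asymptotics as `Re r → ±∞`, uniformly for `Im r` and `k` in compact sets
  asymptotics : ∃ (R₀ : ℝ) (s : ℂ → ℂ), IsSqrtBranch w R₀ s ∧
    ∀ K₁ K₂ : Set ℝ, IsCompact K₁ → IsCompact K₂ → ∃ C R₁ : ℝ, R₀ < R₁ ∧ 0 < R₁ ∧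
      ∀ k ∈ K₁, ∀ r : ℂ, r.im ∈ K₂ →
        (R₁ ≤ r.re →
          ‖s r * m 1 r k - T k‖ ≤ C * Real.exp (-(γ * r.re)) ∧
          ‖s r * m (-1) r k‖ ≤ C * Real.exp (-(γ * r.re))) ∧
        (r.re ≤ -R₁ →
          ‖s r * m 1 r k - 1‖ ≤ C * Real.exp (γ * r.re) ∧
          ‖s r * m (-1) r k - -R k‖ ≤ C * Real.exp (γ * r.re)) ∧
        (R₁ ≤ |r.re| → ∀ τ : ℤˣ,
          ‖deriv (fun z : ℂ => s z * m τ z k) r‖ ≤ C * Real.exp (-(γ * |r.re|)))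
  -- the transmission and reflection coefficients
  T_smooth : ContDiff ℝ ∞ T
  R_smooth : ContDiff ℝ ∞ R
  T_conj : ∀ k : ℝ, conj (T k) = T (-k)
  R_conj : ∀ k : ℝ, conj (R k) = R (-k)
  unitarity₁ : ∀ k : ℝ, T (-k) * T k + R (-k) * R k = 1
  unitarity₂ : ∀ k : ℝ, T (-k) * R k + R (-k) * T k = 0
  -- the evenness assumption
  M_even : ∀ (α : ℤˣ) (r k : ℝ), coeffM m α α (r : ℂ) k k = coeffM m α α (-(r : ℂ)) k k

/-- The sum over `ν, ν'` in the `j`-th residue integral, where `p = r_j`. On the diagonal `k = k'`,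
a null set, two of the denominators vanish, and the value there is immaterial. -/
noncomputable def residueKernel (ρ : ℝ) (m : ℤˣ → ℂ → ℝ → ℂ) (p : ℂ) (δ δ' : ℤˣ)
    (k k' : ℝ) : ℂ :=
  ∑ ν : ℤˣ, ∑ ν' : ℤˣ,
    Complex.exp (Complex.I * p * (sgn ν * k - sgn ν' * k')) /
        (1 - Complex.exp (ρ * (sgn ν' * k' - sgn ν * k))) *
      coeffM m (δ * δ') (δ * δ' * ν * ν') (sgn ν * p) k k'

/-- `μ^τ(r,k) = e^{iτrk} m^τ(r,k)`. -/
noncomputable def mu (m : ℤˣ → ℂ → ℝ → ℂ) (τ : ℤˣ) (r : ℂ) (k : ℝ) : ℂ :=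
  Complex.exp (Complex.I * sgn τ * r * k) * m τ r k

/-- The residue sum `R̂_{δ,δ'}(k,k')`, by this formula for `k ≠ k'`. -/
noncomputable def residueSum (ρ : ℝ) (w : ℂ → ℂ) (m : ℤˣ → ℂ → ℝ → ℂ) {L : ℕ}
    (pole : Fin L → ℂ) (δ δ' : ℤˣ) (k k' : ℝ) : ℂ :=
  Complex.I * sgn δ * sgn δ' * ∑ j, simpleResidue w (pole j) *
    ∑ ν : ℤˣ, ∑ ν' : ℤˣ,
      1 / (1 - Complex.exp (ρ * (sgn ν' * k' - sgn ν * k))) *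
        (mu m (-(δ * ν)) (sgn δ * pole j) (-k) * mu m (-(δ' * ν')) (sgn δ' * pole j) k' +
          mu m (δ * ν) (-(sgn δ * pole j)) (-k) * mu m (δ' * ν') (-(sgn δ' * pole j)) k')

/-- The transform, defined on test pairs, preserves the Hilbert space norm. -/
def IsIsometric (w : ℂ → ℂ) (m : ℤˣ → ℂ → ℝ → ℂ) : Prop :=
  ∀ f : ℤˣ → ℝ → ℂ, IsTestPair f →
    MemLp (transform w m f) 2 volume ∧
      inner₁ (transform w m f) (transform w m f) = inner₂ f f

end PlaneWave

/-! The inner product of two transforms is a sum of products of plane waves. A reflection of `r`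
brings the phase in `k` of every product to `e^{irk}`. The products with a given relative sign `σ`
of the two phases then add up to `w(r) M(r,k,k') e^{ir(k-σk')}`, with `M = coeffM m α (σα)` and `α =
δδ'`, integrated against `conj f_δ(k) g_{δ'}(k')`. Everything reduces to the Fourier transform of `w
M` in `r`, tested on smooth functions of `k - σk'`.

For fixed `k, k'` the function `w M` is `iρ`-periodic, bounded near `Re r = ±∞`, and has at most
simple poles in the period strip. In the coordinate `q = e^{2πr/ρ}`, Liouville's theorem makes it a
constant plus a combination of elementary poles `pole1 ρ p` at `p = r_j` and `p = iρ - r_j`, with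
coefficients `w_j M(r_j)` and `-w_j M(-r_j)` (`Assumptions.partial_fractions`). For `σ = 1` the
limit `Re r → +∞` shows that the constant is `1` if `α = 1` and `0` if `α = -1`. By Fourier
inversion it contributes `(f,g)_2`. For `σ = -1` it contributes a mass on `k + k' = 0`, which misses
the supports.

Away from `x = 0`, the Fourier transform of `pole1 ρ p` is `2πi e^{ipx} / (1 - e^{-ρx})`: by the
residue theorem, a shift of the contour by `iρ` multiplies by `e^{-ρx}` and costs one residue
(`IsTest.integral_pole1_half`). What it does at `x = 0` never matters. On `k = k'` the evenness of
`M^α_α` makes the coefficients of `r_j` and `iρ - r_j` cancel, so the density tested vanishes at `x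
= 0` and absorbs the simple pole of `1/(1 - e^{-ρx})`. This also gives the absolute convergence
(`integral_sum_pole1`, `Assumptions.integral_pole_pair`).

The coefficients `m^τ(·,k)` lie in a finite-dimensional space and are determined by their values at
`2L + 1` real points (`Assumptions.exists_expansion`). This gives smoothness in `k` at complex `r`,
and it splits each plane wave integral into bounded functions times Fourier transforms of test
functions, whence `L²`.

For the corollary, the correction term is the sesquilinear form with kernel `R̂`. It vanishes on all
pairs iff it vanishes on the diagonal (polarization), and bump functions then detect the continuous
kernel off `k = k'`. -/

namespace PlaneWave

/-! ### Fourier transforms of test functions in horizontal strips -/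

/-- The Fourier transform `∫ u(x) e^{izx} dx` at complex `z`. -/
noncomputable def ft (u : ℝ → ℂ) (z : ℂ) : ℂ := ∫ x : ℝ, u x * Complex.exp (Complex.I * z * x)

/-- Smooth functions with compact support. -/
def IsTest (u : ℝ → ℂ) : Prop := ContDiff ℝ ∞ u ∧ HasCompactSupport u

theorem IsTest.continuous {u : ℝ → ℂ} (hu : IsTest u) : Continuous u := hu.1.continuous

theorem IsTest.mul_left {u g : ℝ → ℂ} (hu : IsTest u) (hg : ContDiff ℝ ∞ g) :
    IsTest fun x => g x * u x :=
  ⟨hg.mul hu.1, hu.2.mul_left⟩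

theorem IsTest.mul_right {u g : ℝ → ℂ} (hu : IsTest u) (hg : ContDiff ℝ ∞ g) :
    IsTest fun x => u x * g x :=
  ⟨hu.1.mul hg, hu.2.mul_right⟩

theorem IsTest.integrable_mul {u g : ℝ → ℂ} (hu : IsTest u) (hg : Continuous g) :
    Integrable fun x => u x * g x :=
  (hu.continuous.mul hg).integrable_of_hasCompactSupport hu.2.mul_right

theorem IsTest.deriv {u : ℝ → ℂ} (hu : IsTest u) : IsTest (deriv u) :=
  ⟨(contDiff_infty_iff_deriv.1 hu.1).2, hu.2.deriv⟩

theorem continuous_exp_mul (z : ℂ) : Continuous fun x : ℝ => Complex.exp (Complex.I * z * x) := by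
  fun_prop

theorem contDiff_exp_mul (z : ℂ) :
    ContDiff ℝ ∞ fun x : ℝ => Complex.exp (Complex.I * z * x) := by
  have h : ContDiff ℝ ∞ fun x : ℝ => (x : ℂ) := Complex.ofRealCLM.contDiff
  exact (contDiff_const.mul h).cexp

theorem norm_exp_mul_le (z : ℂ) (x b : ℝ) (hb : |z.im| ≤ b) :
    ‖Complex.exp (Complex.I * z * x)‖ ≤ Real.exp (b * |x|) := by
  rw [Complex.norm_exp]
  apply Real.exp_le_exp.2
  have : (Complex.I * z * x).re = -(z.im * x) := by simp
  rw [this]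
  calc -(z.im * x) ≤ |z.im * x| := neg_le_abs _
    _ = |z.im| * |x| := abs_mul _ _
    _ ≤ b * |x| := by gcongr

theorem IsTest.differentiable_ft {u : ℝ → ℂ} (hu : IsTest u) : Differentiable ℂ (ft u) := by
  intro z₀
  have hc : Continuous fun x : ℝ => ‖u x‖ * (|x| * Real.exp ((|z₀.im| + 1) * |x|)) := by
    have := hu.continuous
    fun_prop
  have key := hasDerivAt_integral_of_dominated_loc_of_deriv_le (μ := volume)
    (F := fun (z : ℂ) (x : ℝ) => u x * Complex.exp (Complex.I * z * x))
    (F' := fun (z : ℂ) (x : ℝ) => u x * (Complex.exp (Complex.I * z * x) * (Complex.I * x)))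
    (bound := fun x => ‖u x‖ * (|x| * Real.exp ((|z₀.im| + 1) * |x|)))
    (s := Metric.ball z₀ 1) (x₀ := z₀) (Metric.ball_mem_nhds _ one_pos)
    (Eventually.of_forall fun z =>
      (hu.continuous.mul (continuous_exp_mul z)).aestronglyMeasurable)
    (hu.integrable_mul (continuous_exp_mul z₀))
    (hu.continuous.mul ((continuous_exp_mul z₀).mul (by fun_prop))).aestronglyMeasurable
    (Eventually.of_forall fun x z hz => by
      have him : |z.im| ≤ |z₀.im| + 1 := by
        have h1 : |(z - z₀).im| ≤ ‖z - z₀‖ := Complex.abs_im_le_norm _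
        have h2 : ‖z - z₀‖ < 1 := by simpa [dist_eq_norm] using hz
        rw [Complex.sub_im] at h1
        have := abs_sub_abs_le_abs_sub z.im z₀.im
        linarith
      rw [norm_mul, norm_mul]
      have := norm_exp_mul_le z x _ him
      simp only [norm_mul, Complex.norm_I, one_mul, Complex.norm_real, Real.norm_eq_abs]
      rw [mul_comm |x|]
      gcongr)
    (hc.integrable_of_hasCompactSupport hu.2.norm.mul_right)
    (Eventually.of_forall fun x z _ => by
      have h1 : HasDerivAt (fun z : ℂ => Complex.I * z * x) (Complex.I * x) z := by
        simpa using ((hasDerivAt_id z).const_mul Complex.I).mul_const (x : ℂ)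
      exact h1.cexp.const_mul (u x))
  exact key.2.differentiableAt

theorem ft_add (u : ℝ → ℂ) (z a : ℂ) :
    ft u (z + a) = ft (fun x => u x * Complex.exp (Complex.I * a * x)) z := by
  unfold ft
  congr 1 with x
  rw [show Complex.I * (z + a) * x = Complex.I * a * x + Complex.I * z * x by ring,
    Complex.exp_add]
  ring

theorem IsTest.ft_deriv {u : ℝ → ℂ} (hu : IsTest u) (z : ℂ) :
    ft (_root_.deriv u) z = -(Complex.I * z) * ft u z := by
  have h := integral_mul_deriv_eq_deriv_mul_of_integrable (A := ℂ) (u := u)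
    (v := fun x : ℝ => Complex.exp (Complex.I * z * x))
    (u' := _root_.deriv u) (v' := fun x : ℝ => Complex.exp (Complex.I * z * x) * (Complex.I * z))
    (fun x _ => (hu.1.differentiable (by simp) x).hasDerivAt)
    (fun x _ => by
      have h1 : HasDerivAt (fun y : ℝ => Complex.I * z * (y : ℂ)) (Complex.I * z) x := by
        simpa using (Complex.ofRealCLM.hasDerivAt (x := x)).const_mul (Complex.I * z)
      exact h1.cexp)
    (hu.integrable_mul ((continuous_exp_mul z).mul continuous_const))
    (hu.deriv.integrable_mul (continuous_exp_mul z))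
    (hu.integrable_mul (continuous_exp_mul z))
  have h2 : ∫ x : ℝ, u x * (Complex.exp (Complex.I * z * x) * (Complex.I * z)) =
      (Complex.I * z) * ft u z := by
    unfold ft
    rw [← integral_const_mul]
    congr 1 with x
    ring
  rw [h2] at h
  unfold ft at h ⊢
  rw [neg_mul, h, neg_neg]

theorem IsTest.exists_norm_ft_le {u : ℝ → ℂ} (hu : IsTest u) (b : ℝ) :
    ∃ C, ∀ z : ℂ, |z.im| ≤ b → ‖ft u z‖ ≤ C := by
  refine ⟨∫ x : ℝ, ‖u x‖ * Real.exp (b * |x|), fun z hz => ?_⟩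
  refine norm_integral_le_of_norm_le ?_ (Eventually.of_forall fun x => ?_)
  · have hc : Continuous fun x : ℝ => ‖u x‖ * Real.exp (b * |x|) := by
      have := hu.continuous
      fun_prop
    exact hc.integrable_of_hasCompactSupport hu.2.norm.mul_right
  · rw [norm_mul]
    gcongr
    exact norm_exp_mul_le z x b hz

/-- Two integrations by parts give `ft u'' = -z² ft u`. Both sides are bounded in a strip, and `|Re
z| ≤ |z|`. Quadratic decay is all that the contour shifts and the `L²` bounds need. -/
theorem IsTest.exists_norm_ft_le_sq {u : ℝ → ℂ} (hu : IsTest u) (b : ℝ) :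
    ∃ C, 0 ≤ C ∧ ∀ z : ℂ, |z.im| ≤ b → ‖ft u z‖ ≤ C * (1 + z.re ^ 2)⁻¹ := by
  obtain ⟨C₀, h₀⟩ := hu.exists_norm_ft_le b
  obtain ⟨C₂, h₂⟩ := hu.deriv.deriv.exists_norm_ft_le b
  refine ⟨|C₀| + |C₂|, by positivity, fun z hz => ?_⟩
  have h3 : ft (_root_.deriv (_root_.deriv u)) z = -z ^ 2 * ft u z := by
    rw [hu.deriv.ft_deriv, hu.ft_deriv]
    linear_combination (z ^ 2 * ft u z) * Complex.I_sq
  have h4 := h₂ z hz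
  rw [h3, norm_mul, norm_neg, norm_pow] at h4
  have h5 : z.re ^ 2 ≤ ‖z‖ ^ 2 := by
    rw [← sq_abs z.re]
    gcongr
    exact Complex.abs_re_le_norm z
  have h6 := h₀ z hz
  have h7 : 0 ≤ ‖ft u z‖ := norm_nonneg _
  rw [← div_eq_mul_inv, le_div_iff₀ (by positivity)]
  nlinarith [le_abs_self C₀, le_abs_self C₂, mul_le_mul_of_nonneg_right h5 h7]

theorem integrable_of_norm_le_inv_one_add_sq {f : ℝ → ℂ} (hf : Continuous f) {C : ℝ}
    (h : ∀ x, ‖f x‖ ≤ C * (1 + x ^ 2)⁻¹) : Integrable f :=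
  (integrable_inv_one_add_sq.const_mul C).mono' hf.aestronglyMeasurable (Eventually.of_forall h)

theorem IsTest.integrable_mul_ft {u : ℝ → ℂ} (hu : IsTest u) (a : ℂ) {f : ℝ → ℂ}
    (hf : Continuous f) {B : ℝ} (hB : ∀ x, ‖f x‖ ≤ B) :
    Integrable fun r : ℝ => f r * ft u (r + a) := by
  obtain ⟨C, hC, h⟩ := hu.exists_norm_ft_le_sq |a.im|
  have hc : Continuous fun r : ℝ => ft u (r + a) :=
    hu.differentiable_ft.continuous.comp (by fun_prop)
  have hB0 : 0 ≤ B := (norm_nonneg _).trans (hB 0)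
  have hd : Continuous fun r : ℝ => ft u (r + a - a.re) :=
    hu.differentiable_ft.continuous.comp (by fun_prop)
  -- Translating by `Re a` centres the decay of `ft u` at the origin, and the integral over the line
  -- is unaffected.
  have : Integrable fun r : ℝ => f (r - a.re) * ft u (r + a - a.re) := by
    refine integrable_of_norm_le_inv_one_add_sq (C := B * C)
      ((hf.comp (by fun_prop)).mul hd) fun x => ?_
    rw [norm_mul, mul_assoc]
    have := h (x + a - a.re) (by simp)
    simp only [Complex.sub_re, Complex.add_re, Complex.ofReal_re, add_sub_cancel_right] at this
    have h2 := hB (x - a.re)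
    gcongr
  have h3 := this.comp_add_right a.re
  convert h3 using 2 with r
  push_cast
  ring_nf

theorem IsTest.integrable_ft {u : ℝ → ℂ} (hu : IsTest u) : Integrable fun r : ℝ => ft u r := by
  simpa using hu.integrable_mul_ft 0 (f := fun _ => 1) continuous_const (B := 1) (by simp)

/-- Fourier inversion at the origin. It turns the constant term of the partial fractions into a
delta function. -/
theorem IsTest.integral_ft {u : ℝ → ℂ} (hu : IsTest u) :
    ∫ r : ℝ, ft u r = 2 * Real.pi * u 0 := by
  have hF : FourierTransform.fourier u = fun v : ℝ => ft u ((-(2 * Real.pi) * v : ℝ) : ℂ) := by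
    ext v
    rw [Real.fourier_eq']
    unfold ft
    congr 1 with x
    rw [smul_eq_mul, mul_comm]
    congr 2
    simp
    ring
  have hpi : (-(2 * Real.pi)) ≠ 0 := by
    have := Real.pi_pos
    linarith
  have hi : Integrable (FourierTransform.fourier u) := by
    rw [hF]
    exact hu.integrable_ft.comp_mul_left' hpi
  have h1 := (hu.continuous.integrable_of_hasCompactSupport hu.2).fourierInv_fourier_eq hi
    (v := 0) hu.continuous.continuousAt
  rw [Real.fourierInv_eq', hF] at h1
  simp only [inner_zero_right, Complex.ofReal_zero, mul_zero, zero_mul, Complex.exp_zero,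
    one_smul] at h1
  rw [Measure.integral_comp_mul_left (fun r : ℝ => ft u r) (-(2 * Real.pi))] at h1
  rw [← h1, abs_inv, abs_neg, abs_of_pos (by positivity), Complex.real_smul]
  push_cast
  have := Real.pi_ne_zero
  field_simp

/-! ### Contour shift -/

/-- Shift of a horizontal line of integration for a function holomorphic in the strip. -/
theorem integral_horizontal_eq {H : ℂ → ℂ} {y₁ y₂ : ℝ} (hy : y₁ ≤ y₂)
    (hc : DifferentiableOn ℂ H {z | y₁ ≤ z.im ∧ z.im ≤ y₂})
    (hdecay : ∀ ε > 0, ∃ X : ℝ, ∀ z : ℂ, y₁ ≤ z.im → z.im ≤ y₂ → X ≤ |z.re| → ‖H z‖ ≤ ε)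
    (h₁ : Integrable fun x : ℝ => H (x + y₁ * Complex.I))
    (h₂ : Integrable fun x : ℝ => H (x + y₂ * Complex.I)) :
    ∫ x : ℝ, H (x + y₁ * Complex.I) = ∫ x : ℝ, H (x + y₂ * Complex.I) := by
  have hrect : ∀ X : ℝ, (∫ x : ℝ in (-X)..X, H (x + y₁ * Complex.I)) -
      (∫ x : ℝ in (-X)..X, H (x + y₂ * Complex.I)) =
      -(Complex.I * (∫ y : ℝ in y₁..y₂, H (X + y * Complex.I)) -
      Complex.I * (∫ y : ℝ in y₁..y₂, H ((-X : ℝ) + y * Complex.I))) := by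
    intro X
    have := Complex.integral_boundary_rect_eq_zero_of_differentiableOn H
      (⟨-X, y₁⟩ : ℂ) (⟨X, y₂⟩ : ℂ) (hc.mono fun z hz => by
        have := hz.2
        simpa [Set.uIcc_of_le hy] using this)
    simp only [smul_eq_mul] at this
    linear_combination this
  have hside : ∀ (σ : ℝ), |σ| = 1 → Tendsto (fun X : ℝ =>
      ∫ y : ℝ in y₁..y₂, H ((σ * X : ℝ) + y * Complex.I)) atTop (𝓝 0) := by
    intro σ hσ
    rw [Metric.tendsto_atTop]
    intro ε hε
    obtain ⟨X₀, hX₀⟩ := hdecay (ε / (2 * (|y₂ - y₁| + 1))) (by positivity)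
    refine ⟨max X₀ 0, fun X hX => ?_⟩
    rw [dist_zero_right]
    have := intervalIntegral.norm_integral_le_of_norm_le_const (a := y₁) (b := y₂)
      (f := fun y : ℝ => H ((σ * X : ℝ) + y * Complex.I))
      (C := ε / (2 * (|y₂ - y₁| + 1))) (fun y hy' => by
        rw [Set.uIoc_of_le hy] at hy'
        refine hX₀ _ (by simpa using hy'.1.le) (by simpa using hy'.2) ?_
        have : |σ * X| = |X| := by rw [abs_mul, hσ, one_mul]
        simp only [Complex.add_re, Complex.ofReal_re, Complex.mul_re, Complex.I_re, mul_zero,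
          Complex.ofReal_im, Complex.I_im, sub_self, add_zero, zero_mul]
        rw [this]
        exact (le_max_left _ _).trans (hX.trans (le_abs_self _)))
    refine this.trans_lt ?_
    rw [div_mul_eq_mul_div, div_lt_iff₀ (by positivity)]
    nlinarith [abs_nonneg (y₂ - y₁)]
  have hl : Tendsto (fun X : ℝ => (∫ x : ℝ in (-X)..X, H (x + y₁ * Complex.I)) -
      (∫ x : ℝ in (-X)..X, H (x + y₂ * Complex.I))) atTop (𝓝 0) := by
    simp_rw [hrect]
    have ha := hside 1 (by simp)
    have hb := hside (-1) (by simp)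
    simp only [one_mul, neg_one_mul] at ha hb
    simpa using ((ha.const_mul Complex.I).sub (hb.const_mul Complex.I)).neg
  have hr := (intervalIntegral_tendsto_integral h₁ tendsto_neg_atTop_atBot tendsto_id).sub
    (intervalIntegral_tendsto_integral h₂ tendsto_neg_atTop_atBot tendsto_id)
  exact sub_eq_zero.1 (tendsto_nhds_unique hr hl)

/-! ### Parameter integrals and division by `1 - e^{-ρx}` -/

/-- Smooth dependence on a parameter of an integral over a fixed compact set. -/
theorem contDiff_integral_mul {G : ℝ → ℝ → ℂ} (hG : ContDiff ℝ ∞ fun q : ℝ × ℝ => G q.1 q.2)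
    {K : Set ℝ} (hK : IsCompact K) (hGK : ∀ p t, t ∉ K → G p t = 0) {φ : ℝ → ℂ}
    (hφ : LocallyIntegrable φ) : ContDiff ℝ ∞ fun p => ∫ t, G p t * φ t := by
  have hφ' : LocallyIntegrable (fun t => φ (-t)) := by
    rw [MeasureTheory.locallyIntegrable_iff] at hφ ⊢
    intro k hk
    have h := hφ (-k) hk.neg
    have := h.comp_neg
    simpa using this
  -- The integral is the value at `0` of the convolution of `G p` with the reflected function `t ↦
  -- φ(-t)`, so the regularity of convolutions in a parameter applies.
  have := contDiffOn_convolution_left_with_param_comp (μ := volume) (ContinuousLinearMap.mul ℝ ℂ)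
    (s := Set.univ) (n := ⊤) (v := fun _ : ℝ => (0 : ℝ)) contDiffOn_const (g := G) isOpen_univ hK
    (fun p x _ hx => hGK p x hx) hφ' hG.contDiffOn
  rw [contDiffOn_univ] at this
  simpa [convolution_def] using this

theorem contDiff_integral_comp_mul {f : ℝ → ℂ} (hf : ContDiff ℝ ∞ f) :
    ContDiff ℝ ∞ fun x => ∫ t in Set.Icc (0 : ℝ) 1, f (t * x) := by
  -- The cutoff equals `1` on `[0,1]`, so it does not change the integral. It makes the integrand
  -- compactly supported in `t`.
  let χ : ContDiffBump (0 : ℝ) := ⟨1, 2, one_pos, one_lt_two⟩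
  have hχ : ContDiff ℝ ∞ fun t : ℝ => ((χ t : ℝ) : ℂ) := Complex.ofRealCLM.contDiff.comp χ.contDiff
  have hG : ContDiff ℝ ∞ fun q : ℝ × ℝ => f (q.2 * q.1) * ((χ q.2 : ℝ) : ℂ) :=
    (hf.comp (contDiff_snd.mul contDiff_fst)).mul (hχ.comp contDiff_snd)
  have h := contDiff_integral_mul (G := fun x t => f (t * x) * ((χ t : ℝ) : ℂ)) hG
    (K := Metric.closedBall 0 2) (isCompact_closedBall _ _)
    (fun p t ht => by
      have : χ t = 0 := χ.zero_of_le_dist (by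
        rw [Metric.mem_closedBall] at ht
        exact (not_le.1 ht).le)
      simp [this])
    (φ := Set.indicator (Set.Icc 0 1) fun _ => 1)
    ((locallyIntegrable_const 1).indicator measurableSet_Icc)
  convert h using 2 with x
  rw [← integral_indicator measurableSet_Icc]
  congr 1 with t
  by_cases ht : t ∈ Set.Icc (0 : ℝ) 1
  · have : χ t = 1 := χ.one_of_mem_closedBall (by
      rw [Metric.mem_closedBall, dist_zero_right, Real.norm_eq_abs, abs_of_nonneg ht.1]
      exact ht.2)
    simp [ht, this]
  · simp [ht]

theorem eq_mul_integral_deriv {f : ℝ → ℂ} (hf : ContDiff ℝ ∞ f) (h0 : f 0 = 0) (x : ℝ) :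
    f x = x * ∫ t in Set.Icc (0 : ℝ) 1, deriv f (t * x) := by
  have h1 : ∀ t ∈ Set.uIcc (0 : ℝ) 1,
      HasDerivAt (fun t : ℝ => f (t * x)) ((x : ℂ) * deriv f (t * x)) t := by
    intro t _
    have h2 : HasDerivAt (fun t : ℝ => t * x) x t := by simpa using (hasDerivAt_id t).mul_const x
    have h3 := ((hf.differentiable (by simp) (t * x)).hasDerivAt).scomp t h2
    simpa [Function.comp_def] using h3
  have hd : Continuous (deriv f) := hf.continuous_deriv (by simp)
  have h4 := intervalIntegral.integral_eq_sub_of_hasDerivAt h1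
    (Continuous.intervalIntegrable (by fun_prop) _ _)
  rw [intervalIntegral.integral_const_mul, intervalIntegral.integral_of_le zero_le_one,
    ← integral_Icc_eq_integral_Ioc] at h4
  simpa [h0] using h4.symm

/-- `1 / (1 - e^{-ρx})`. -/
noncomputable def bose (ρ x : ℝ) : ℂ := 1 / (1 - Complex.exp (-(ρ * x)))

theorem one_sub_exp_ne_zero {ρ : ℝ} (hρ : 0 < ρ) {x : ℝ} (hx : x ≠ 0) :
    (1 : ℂ) - Complex.exp (-(ρ * x)) ≠ 0 := by
  rw [sub_ne_zero]
  have : (1 : ℂ) - Complex.exp (-(ρ * x)) = ((1 - Real.exp (-(ρ * x)) : ℝ) : ℂ) := by push_cast; rfl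
  rw [← sub_ne_zero, this, Complex.ofReal_ne_zero, sub_ne_zero, ne_comm, Ne, Real.exp_eq_one_iff,
    neg_eq_zero, mul_eq_zero]
  simp [hρ.ne', hx]

/-- Hadamard's lemma, applied to numerator and denominator: both vanish at `0`, so each is `x` times
a smooth average of its derivative, and `v` is the quotient of the two averages. -/
theorem IsTest.exists_eq_one_sub_exp_mul {ρ : ℝ} (hρ : 0 < ρ) {u : ℝ → ℂ} (hu : IsTest u)
    (h0 : u 0 = 0) :
    ∃ v, IsTest v ∧ ∀ x : ℝ, u x = (1 - Complex.exp (-(ρ * x))) * v x := by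
  let e : ℝ → ℂ := fun x => 1 - Complex.exp (-(ρ * x))
  have he : ContDiff ℝ ∞ e := by
    have := contDiff_exp_mul (Complex.I * ρ)
    have h2 : e = fun x : ℝ => 1 - Complex.exp (Complex.I * (Complex.I * ρ) * x) := by
      ext x
      simp only [e]
      congr 2
      linear_combination (-(ρ : ℂ) * x) * Complex.I_sq
    rw [h2]
    exact contDiff_const.sub this
  have he0 : e 0 = 0 := by simp [e]
  have hed : ∀ x, _root_.deriv e x = ρ * Real.exp (-(ρ * x)) := by
    intro x
    have h1 : HasDerivAt (fun y : ℝ => -((ρ : ℂ) * (y : ℂ))) (-ρ) x := by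
      have := ((Complex.ofRealCLM.hasDerivAt (x := x)).const_mul (ρ : ℂ)).neg
      simp only [Complex.ofRealCLM_apply, Complex.ofReal_one, mul_one] at this
      exact this
    have := (h1.cexp.const_sub 1).deriv
    simp only [e]
    rw [this]
    push_cast
    ring
  let a : ℝ → ℂ := fun x => ∫ t in Set.Icc (0 : ℝ) 1, _root_.deriv u (t * x)
  let b : ℝ → ℂ := fun x => ∫ t in Set.Icc (0 : ℝ) 1, _root_.deriv e (t * x)
  have ha : ContDiff ℝ ∞ a := contDiff_integral_comp_mul (contDiff_infty_iff_deriv.1 hu.1).2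
  have hb : ContDiff ℝ ∞ b := contDiff_integral_comp_mul (contDiff_infty_iff_deriv.1 he).2
  have hub : ∀ x : ℝ, u x = x * a x := eq_mul_integral_deriv hu.1 h0
  have heb : ∀ x : ℝ, e x = x * b x := eq_mul_integral_deriv he he0
  -- At `0` the average is the derivative `ρ`. Elsewhere a zero of it would be a zero of `1 -
  -- e^{-ρx}`.
  have hbne : ∀ x, b x ≠ 0 := by
    intro x hx
    by_cases h : x = 0
    · subst h
      simp [b, hed, hρ.ne'] at hx
    · have h1 := heb x
      rw [hx, mul_zero] at h1
      exact one_sub_exp_ne_zero hρ h h1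
  have hv : ∀ x : ℝ, u x = e x * (a x / b x) := by
    intro x
    rw [hub, heb]
    field_simp [hbne x]
  refine ⟨fun x => a x / b x, ⟨by simp_rw [div_eq_mul_inv]; exact ha.mul (hb.inv hbne), ?_⟩, hv⟩
  -- The point `0` is added because the factor `1 - e^{-ρx}` can be cancelled only away from it.
  refine HasCompactSupport.intro (K := tsupport u ∪ {0}) (hu.2.isCompact.union isCompact_singleton)
    fun x hx => ?_
  simp only [Set.mem_union, Set.mem_singleton_iff, not_or] at hx
  have h1 := hv x
  rw [image_eq_zero_of_notMem_tsupport hx.1, eq_comm, mul_eq_zero] at h1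
  exact h1.resolve_left (one_sub_exp_ne_zero hρ hx.2)

/-! ### The cylinder coordinate and the elementary periodic pole -/

/-- The exponential coordinate `e^{2πr/ρ}` on the cylinder `ℂ / iρℤ`. -/
noncomputable def cyl (ρ : ℝ) (r : ℂ) : ℂ := Complex.exp (2 * Real.pi * r / ρ)

/-- The `iρ`-periodic function with a simple pole of residue `1` at `p`, vanishing as
`Re r → ∞`. -/
noncomputable def pole1 (ρ : ℝ) (p r : ℂ) : ℂ :=
  2 * Real.pi / ρ * cyl ρ p / (cyl ρ r - cyl ρ p)

theorem cyl_ne_zero (ρ : ℝ) (r : ℂ) : cyl ρ r ≠ 0 := Complex.exp_ne_zero _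

theorem norm_cyl (ρ : ℝ) (r : ℂ) : ‖cyl ρ r‖ = Real.exp (2 * Real.pi * r.re / ρ) := by
  rw [cyl, Complex.norm_exp]
  congr 1
  have : (2 * Real.pi * r / ρ : ℂ) = ((2 * Real.pi / ρ : ℝ) : ℂ) * r := by
    push_cast
    ring
  rw [this, Complex.re_ofReal_mul]
  ring

theorem cyl_add (ρ : ℝ) (r s : ℂ) : cyl ρ (r + s) = cyl ρ r * cyl ρ s := by
  rw [cyl, cyl, cyl, ← Complex.exp_add]
  ring_nf

theorem cyl_sub (ρ : ℝ) (r s : ℂ) : cyl ρ (r - s) = cyl ρ r / cyl ρ s := by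
  rw [cyl, cyl, cyl, ← Complex.exp_sub]
  ring_nf

theorem cyl_neg (ρ : ℝ) (r : ℂ) : cyl ρ (-r) = (cyl ρ r)⁻¹ := by
  rw [cyl, cyl, ← Complex.exp_neg]
  ring_nf

theorem cyl_eq_iff {ρ : ℝ} (hρ : 0 < ρ) {r p : ℂ} :
    cyl ρ r = cyl ρ p ↔ ∃ n : ℤ, r = p + n * (Complex.I * ρ) := by
  rw [cyl, cyl, Complex.exp_eq_exp_iff_exists_int]
  have h1 : (ρ : ℂ) ≠ 0 := by exact_mod_cast hρ.ne'
  have h2 : (Real.pi : ℂ) ≠ 0 := by exact_mod_cast Real.pi_ne_zero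
  refine exists_congr fun n => ⟨fun h => ?_, fun h => ?_⟩
  · field_simp at h
    linear_combination h
  · rw [h]
    field_simp

theorem cyl_I_mul {ρ : ℝ} (hρ : 0 < ρ) : cyl ρ (Complex.I * ρ) = 1 := by
  have : cyl ρ (Complex.I * ρ) = cyl ρ 0 := (cyl_eq_iff hρ).2 ⟨1, by simp⟩
  rw [this]
  simp [cyl]

theorem cyl_add_I_mul {ρ : ℝ} (hρ : 0 < ρ) (r : ℂ) : cyl ρ (r + Complex.I * ρ) = cyl ρ r := by
  rw [cyl_add, cyl_I_mul hρ, mul_one]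

theorem im_eq_of_cyl_eq {ρ : ℝ} (hρ : 0 < ρ) {r p : ℂ} (h : cyl ρ r = cyl ρ p)
    (hlt : |r.im - p.im| < ρ) : r = p := by
  obtain ⟨n, hn⟩ := (cyl_eq_iff hρ).1 h
  have him : r.im - p.im = n * ρ := by
    rw [hn]
    simp
  rw [him, abs_mul, abs_of_pos hρ] at hlt
  have h1 : |(n : ℝ)| < 1 := by
    by_contra hc
    nlinarith
  have h2 : n = 0 := by
    rw [← Int.abs_lt_one_iff]
    exact_mod_cast h1
  simpa [h2] using hn

theorem hasDerivAt_cyl (ρ : ℝ) (r : ℂ) :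
    HasDerivAt (cyl ρ) (2 * Real.pi / ρ * cyl ρ r) r := by
  have h : HasDerivAt (fun r : ℂ => 2 * Real.pi * r / ρ) (2 * Real.pi / ρ) r := by
    simpa using ((hasDerivAt_id r).const_mul (2 * Real.pi : ℂ)).div_const (ρ : ℂ)
  have h2 := h.cexp
  rw [mul_comm (Complex.exp _)] at h2
  exact h2

theorem differentiable_cyl (ρ : ℝ) : Differentiable ℂ (cyl ρ) :=
  fun r => (hasDerivAt_cyl ρ r).differentiableAt

theorem tendsto_norm_cyl_atTop {ρ : ℝ} (hρ : 0 < ρ) :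
    Tendsto (fun x : ℝ => Real.exp (2 * Real.pi * x / ρ)) atTop atTop := by
  refine Real.tendsto_exp_atTop.comp ?_
  have : (fun x : ℝ => 2 * Real.pi * x / ρ) = fun x => (2 * Real.pi / ρ) * x := by
    ext x
    ring
  rw [this]
  exact tendsto_id.const_mul_atTop (by positivity)

theorem tendsto_norm_cyl_atBot {ρ : ℝ} (hρ : 0 < ρ) :
    Tendsto (fun x : ℝ => Real.exp (2 * Real.pi * x / ρ)) atBot (𝓝 0) := by
  refine Real.tendsto_exp_atBot.comp ?_
  have : (fun x : ℝ => 2 * Real.pi * x / ρ) = fun x => (2 * Real.pi / ρ) * x := by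
    ext x
    ring
  rw [this]
  exact tendsto_id.const_mul_atBot (by positivity)

/-- Away from a vertical strip, `e^{2πr/ρ}` keeps a distance from a given nonzero number. -/
theorem exists_le_norm_cyl_sub {ρ : ℝ} (hρ : 0 < ρ) {a : ℂ} (ha : a ≠ 0) :
    ∃ c > 0, ∃ X : ℝ, ∀ r : ℂ, X ≤ |r.re| → c ≤ ‖cyl ρ r - a‖ ∧ c * ‖cyl ρ r‖ ≤ ‖cyl ρ r - a‖ := by
  have ha' : 0 < ‖a‖ := norm_pos_iff.2 ha
  obtain ⟨X₁, h₁⟩ := eventually_atTop.1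
    ((tendsto_norm_cyl_atTop hρ).eventually_ge_atTop (2 * ‖a‖ + 1))
  obtain ⟨X₂, h₂⟩ := eventually_atBot.1
    ((tendsto_norm_cyl_atBot hρ).eventually_le_const (show 0 < ‖a‖ / 2 by positivity))
  -- To the left `|q| ≤ |a|/2`, hence `|q - a| ≥ |a|/2`. To the right `|q| ≥ 2|a| + 1`, hence `|q -
  -- a| ≥ (|q| + 1)/2`. Here `q = e^{2πr/ρ}`.
  refine ⟨min (1 / 2) (‖a‖ / 2), by positivity, max (max X₁ (-X₂)) 0, fun r hr => ?_⟩
  have hm1 := min_le_left (1 / 2) (‖a‖ / 2)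
  have hm2 := min_le_right (1 / 2) (‖a‖ / 2)
  have hn := norm_cyl ρ r
  have hpos := norm_nonneg (cyl ρ r)
  rcases le_abs'.1 hr with h | h
  · have h3 := h₂ r.re (by
      have := le_max_right X₁ (-X₂)
      have := le_max_left (max X₁ (-X₂)) 0
      linarith)
    rw [← hn] at h3
    have h4 := norm_sub_norm_le a (cyl ρ r)
    rw [norm_sub_rev] at h4
    constructor <;> nlinarith
  · have h3 := h₁ r.re (by
      have := le_max_left X₁ (-X₂)
      have := le_max_left (max X₁ (-X₂)) 0
      linarith)
    rw [← hn] at h3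
    have h4 := norm_sub_norm_le (cyl ρ r) a
    constructor <;> nlinarith

theorem exists_bound_of_continuous {f : ℝ → ℂ} (hf : Continuous f) {C X : ℝ}
    (h : ∀ x, X ≤ |x| → ‖f x‖ ≤ C) : ∃ B, ∀ x, ‖f x‖ ≤ B := by
  obtain ⟨B, hB⟩ := (isCompact_Icc (a := -X) (b := X)).exists_bound_of_continuousOn hf.continuousOn
  refine ⟨max B C, fun x => ?_⟩
  rcases le_total X |x| with hx | hx
  · exact (h x hx).trans (le_max_right _ _)
  · exact (hB x (abs_le.1 hx)).trans (le_max_left _ _)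

theorem continuous_pole1_line {ρ : ℝ} {p : ℂ} {y : ℝ}
    (h : ∀ x : ℝ, cyl ρ (x + y * Complex.I) ≠ cyl ρ p) :
    Continuous fun x : ℝ => pole1 ρ p (x + y * Complex.I) := by
  unfold pole1
  refine continuous_const.div (((differentiable_cyl ρ).continuous.comp (by fun_prop)).sub
    continuous_const) fun x => sub_ne_zero.2 (h x)

theorem exists_bound_pole1 {ρ : ℝ} (hρ : 0 < ρ) (p : ℂ) :
    ∃ C X : ℝ, 0 ≤ C ∧ ∀ r : ℂ, X ≤ |r.re| → ‖pole1 ρ p r‖ ≤ C := by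
  obtain ⟨c, hc, X, hX⟩ := exists_le_norm_cyl_sub hρ (cyl_ne_zero ρ p)
  refine ⟨‖(2 * Real.pi / ρ * cyl ρ p : ℂ)‖ / c, X, by positivity, fun r hr => ?_⟩
  rw [pole1, norm_div]
  gcongr
  exact (hX r hr).1

theorem exists_bound_pole1_line {ρ : ℝ} (hρ : 0 < ρ) {p : ℂ} {y : ℝ}
    (h : ∀ x : ℝ, cyl ρ (x + y * Complex.I) ≠ cyl ρ p) :
    ∃ B : ℝ, ∀ x : ℝ, ‖pole1 ρ p (x + y * Complex.I)‖ ≤ B := by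
  obtain ⟨C, X, -, hX⟩ := exists_bound_pole1 hρ p
  exact exists_bound_of_continuous (continuous_pole1_line h) (X := X) (C := C)
    fun x hx => hX _ (by simpa using hx)

theorem cyl_line_ne {ρ : ℝ} (hρ : 0 < ρ) {p : ℂ} {y : ℝ} (h0 : y ≠ p.im) (h : |y - p.im| < ρ)
    (x : ℝ) : cyl ρ (x + y * Complex.I) ≠ cyl ρ p := by
  intro hc
  have := im_eq_of_cyl_eq hρ hc (by simpa using h)
  apply h0
  rw [← this]
  simp

theorem IsTest.integrable_pole1_mul_ft {ρ : ℝ} (hρ : 0 < ρ) {p : ℂ} {y : ℝ} (h0 : y ≠ p.im)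
    (h : |y - p.im| < ρ) {u : ℝ → ℂ} (hu : IsTest u) :
    Integrable fun x : ℝ =>
      pole1 ρ p (x + y * Complex.I) * ft u (x + y * Complex.I) := by
  obtain ⟨B, hB⟩ := exists_bound_pole1_line hρ (cyl_line_ne hρ h0 h)
  exact hu.integrable_mul_ft _ (continuous_pole1_line (cyl_line_ne hρ h0 h)) hB

theorem IsTest.integrable_pole1_mul_ft_real {ρ : ℝ} {p : ℂ} (h0 : 0 < p.im)
    (h : p.im < ρ) {u : ℝ → ℂ} (hu : IsTest u) :
    Integrable fun x : ℝ => pole1 ρ p x * ft u x := by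
  simpa using hu.integrable_pole1_mul_ft (h0.trans h) (y := 0) h0.ne
    (by rw [zero_sub, abs_neg, abs_of_pos h0]; exact h)

/-- The heights `y₁ ≤ y₂` lie strictly between those of the consecutive poles `p - iρ` and `p`, so
no pole is crossed. `pole1` is bounded far out and `ft u` decays. -/
theorem integral_pole1_shift_aux {ρ : ℝ} (hρ : 0 < ρ) {p : ℂ} (hp : 0 < p.im) (hp' : p.im < ρ)
    {y₁ y₂ : ℝ} (hy : y₁ ≤ y₂) (h₁ : p.im - ρ < y₁) (h₂ : y₂ < p.im) {u : ℝ → ℂ} (hu : IsTest u) :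
    ∫ x : ℝ, pole1 ρ p (x + y₁ * Complex.I) * ft u (x + y₁ * Complex.I) =
      ∫ x : ℝ, pole1 ρ p (x + y₂ * Complex.I) * ft u (x + y₂ * Complex.I) := by
  have hne : ∀ z : ℂ, y₁ ≤ z.im → z.im ≤ y₂ → cyl ρ z ≠ cyl ρ p := by
    intro z hz1 hz2 hc
    have := im_eq_of_cyl_eq hρ hc (by rw [abs_lt]; constructor <;> linarith)
    rw [this] at hz2
    linarith
  refine integral_horizontal_eq (H := fun z => pole1 ρ p z * ft u z) hy ?_ ?_ ?_ ?_
  · refine DifferentiableOn.mul ?_ hu.differentiable_ft.differentiableOn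
    unfold pole1
    exact (differentiableOn_const _).div
      ((differentiable_cyl ρ).differentiableOn.sub (differentiableOn_const _))
      fun z hz => sub_ne_zero.2 (hne z hz.1 hz.2)
  · intro ε hε
    obtain ⟨C, X, hC, hX⟩ := exists_bound_pole1 hρ p
    obtain ⟨D, hD, hft⟩ := hu.exists_norm_ft_le_sq (max |y₁| |y₂|)
    refine ⟨max (max X 1) (C * D / ε), fun z hz1 hz2 hz => ?_⟩
    have h3 : X ≤ |z.re| := (le_max_left _ _).trans ((le_max_left _ _).trans hz)
    have h4 : 1 ≤ |z.re| := (le_max_right _ _).trans ((le_max_left _ _).trans hz)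
    have h5 : C * D / ε ≤ |z.re| := (le_max_right _ _).trans hz
    rw [norm_mul]
    calc ‖pole1 ρ p z‖ * ‖ft u z‖ ≤ C * (D * (1 + z.re ^ 2)⁻¹) := by
          gcongr
          · exact hX z h3
          · exact hft z (abs_le_max_abs_abs hz1 hz2)
      _ = C * D * (1 + |z.re| ^ 2)⁻¹ := by rw [sq_abs, mul_assoc]
      _ ≤ ε := by
          rw [div_le_iff₀ hε] at h5
          rw [← div_eq_mul_inv, div_le_iff₀ (by positivity)]
          nlinarith [mul_le_mul_of_nonneg_left h4 (by positivity : 0 ≤ |z.re|)]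
  · exact hu.integrable_pole1_mul_ft hρ (by linarith) (by rw [abs_lt]; constructor <;> linarith)
  · exact hu.integrable_pole1_mul_ft hρ (by linarith) (by rw [abs_lt]; constructor <;> linarith)

/-- Moving the pole `p` to `q` multiplies the test function by `e^{i(p-q)x}`. -/
theorem integral_pole1_shift {ρ : ℝ} (hρ : 0 < ρ) {p q : ℂ} (hp : 0 < p.im) (hp' : p.im < ρ)
    (hq : 0 < q.im) (hq' : q.im < ρ) {u : ℝ → ℂ} (hu : IsTest u) :
    ∫ x : ℝ, pole1 ρ p x * ft u x =
      ∫ x : ℝ, pole1 ρ q x * ft (fun x => u x * Complex.exp (Complex.I * (p - q) * x)) x := by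
  have h1 : ∫ x : ℝ, pole1 ρ p (x + (0 : ℝ) * Complex.I) * ft u (x + (0 : ℝ) * Complex.I) =
      ∫ x : ℝ, pole1 ρ p (x + (p - q).im * Complex.I) * ft u (x + (p - q).im * Complex.I) := by
    -- The line is moved from height `0` to height `Im (p - q)`, up or down. As `p` and `q` both lie
    -- in the open strip, this height stays between `Im p - ρ` and `Im p`.
    rcases le_total 0 (p - q).im with h | h
    · exact integral_pole1_shift_aux hρ hp hp' h (by linarith) (by simpa using hq) hu
    · exact (integral_pole1_shift_aux hρ hp hp' h (by simpa using hq') hp hu).symm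
  simp only [Complex.ofReal_zero, zero_mul, add_zero] at h1
  rw [h1, ← integral_add_right_eq_self (μ := volume) _ ((p - q).re)]
  congr 1 with x
  rw [← ft_add]
  have h2 : ((x + (p - q).re : ℝ) : ℂ) + (p - q).im * Complex.I = x + (p - q) := by
    push_cast
    rw [add_assoc, Complex.re_add_im]
  rw [h2]
  congr 1
  -- Translations act on the cylinder coordinate by scaling, so `pole1 ρ p` translated by `p - q` is
  -- exactly `pole1 ρ q`.
  have hqp : cyl ρ (x + (p - q)) - cyl ρ p = (cyl ρ p / cyl ρ q) * (cyl ρ x - cyl ρ q) := by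
    rw [cyl_add, cyl_sub]
    field_simp [cyl_ne_zero ρ q]
  rw [pole1, pole1, hqp, mul_comm (cyl ρ p / cyl ρ q), ← div_div, mul_div_assoc, mul_div_assoc]
  have := cyl_ne_zero ρ p
  have := cyl_ne_zero ρ q
  field_simp

/-! ### The Fourier transform of the elementary pole -/

theorem integrable_inv_two_cosh :
    Integrable fun x : ℝ => Real.exp x / (Real.exp x ^ 2 + 1) := by
  have hc : Continuous fun x : ℝ => Real.exp x / (Real.exp x ^ 2 + 1) :=
    (Real.continuous_exp).div (by fun_prop) fun x => by positivity
  refine (integrable_inv_one_add_sq.const_mul 2).mono' hc.aestronglyMeasurable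
    (Eventually.of_forall fun x => ?_)
  rw [Real.norm_of_nonneg (by positivity)]
  have key : 1 + x ^ 2 / 2 ≤ Real.exp x + Real.exp (-x) := by
    rcases le_total 0 x with h | h
    · have h1 := Real.quadratic_le_exp_of_nonneg h
      have h2 := Real.exp_pos (-x)
      linarith
    · have h1 := Real.quadratic_le_exp_of_nonneg (neg_nonneg.2 h)
      have h2 := Real.exp_pos x
      nlinarith
  rw [Real.exp_neg] at key
  have hp := Real.exp_pos x
  rw [← div_eq_mul_inv, div_le_div_iff₀ (by positivity) (by positivity)]
  have : Real.exp x * (1 + x ^ 2 / 2) ≤ Real.exp x ^ 2 + 1 := by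
    calc _ ≤ Real.exp x * (Real.exp x + (Real.exp x)⁻¹) := by gcongr
      _ = _ := by field_simp
  nlinarith

theorem integral_inv_two_cosh :
    ∫ x : ℝ, Real.exp x / (Real.exp x ^ 2 + 1) = Real.pi / 2 := by
  have h := integral_of_hasDerivAt_of_tendsto (f := fun x => Real.arctan (Real.exp x))
    (f' := fun x => Real.exp x / (Real.exp x ^ 2 + 1)) (m := 0) (n := Real.pi / 2)
    (fun x => by
      have := (Real.hasDerivAt_exp x).arctan
      rwa [one_div_mul_eq_div, add_comm] at this)
    integrable_inv_two_cosh
    (by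
      have := (Real.continuous_arctan.tendsto 0).comp Real.tendsto_exp_atBot
      rwa [Real.arctan_zero] at this)
    (by
      have := Real.tendsto_arctan_atTop.comp Real.tendsto_exp_atTop
      exact (tendsto_nhdsWithin_iff.1 this).1)
  simpa using h

/-- The square root `e^{πr/ρ}` of the cylinder coordinate. -/
noncomputable def halfCyl (ρ : ℝ) (r : ℂ) : ℂ := Complex.exp (Real.pi * r / ρ)

theorem halfCyl_sq (ρ : ℝ) (r : ℂ) : halfCyl ρ r ^ 2 = cyl ρ r := by
  rw [halfCyl, cyl, ← Complex.exp_nat_mul]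
  push_cast
  ring_nf

theorem differentiable_halfCyl (ρ : ℝ) : Differentiable ℂ (halfCyl ρ) := by
  unfold halfCyl
  fun_prop

theorem halfCyl_add_I_mul {ρ : ℝ} (hρ : 0 < ρ) (r : ℂ) :
    halfCyl ρ (r + Complex.I * ρ) = -halfCyl ρ r := by
  have h1 : (ρ : ℂ) ≠ 0 := by exact_mod_cast hρ.ne'
  have : (Real.pi * (r + Complex.I * ρ) / ρ : ℂ) = Real.pi * r / ρ + Real.pi * Complex.I := by
    field_simp
  rw [halfCyl, this, Complex.exp_add, Complex.exp_pi_mul_I, halfCyl]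
  ring

theorem halfCyl_half {ρ : ℝ} (hρ : 0 < ρ) : halfCyl ρ (Complex.I * ρ / 2) = Complex.I := by
  have h1 : (ρ : ℂ) ≠ 0 := by exact_mod_cast hρ.ne'
  have : (Real.pi * (Complex.I * ρ / 2) / ρ : ℂ) = Real.pi / 2 * Complex.I := by
    field_simp
  rw [halfCyl, this, Complex.exp_pi_div_two_mul_I]

theorem cyl_half {ρ : ℝ} (hρ : 0 < ρ) : cyl ρ (Complex.I * ρ / 2) = -1 := by
  rw [← halfCyl_sq, halfCyl_half hρ, Complex.I_sq]

theorem halfCyl_div_real (ρ : ℝ) (x : ℝ) : halfCyl ρ x / (cyl ρ x + 1) =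
    ((Real.exp (Real.pi / ρ * x) / (Real.exp (Real.pi / ρ * x) ^ 2 + 1) : ℝ) : ℂ) := by
  rw [← halfCyl_sq, halfCyl]
  push_cast
  ring_nf

theorem integrable_halfCyl_div {ρ : ℝ} (hρ : 0 < ρ) :
    Integrable fun x : ℝ => halfCyl ρ x / (cyl ρ x + 1) := by
  simp_rw [halfCyl_div_real]
  exact (integrable_inv_two_cosh.comp_mul_left' (by positivity)).ofReal

theorem integral_halfCyl_div {ρ : ℝ} (hρ : 0 < ρ) :
    ∫ x : ℝ, halfCyl ρ x / (cyl ρ x + 1) = ρ / 2 := by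
  simp_rw [halfCyl_div_real]
  rw [integral_complex_ofReal, Measure.integral_comp_mul_left
    (fun y : ℝ => Real.exp y / (Real.exp y ^ 2 + 1)), integral_inv_two_cosh,
    abs_of_pos (by positivity), smul_eq_mul]
  have := Real.pi_ne_zero
  push_cast
  field_simp

/-- The residue theorem on the strip for the pole `iρ/2`. -/
theorem IsTest.integral_pole1_half_sub {ρ : ℝ} (hρ : 0 < ρ) {v : ℝ → ℂ} (hv : IsTest v) :
    (∫ x : ℝ, pole1 ρ (Complex.I * ρ / 2) x * ft v x) -
      ∫ x : ℝ, pole1 ρ (Complex.I * ρ / 2) x * ft v (x + Complex.I * ρ) =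
      2 * Real.pi * Complex.I * ft v (Complex.I * ρ / 2) := by
  set q : ℂ := Complex.I * ρ / 2 with hq
  have hqim : q.im = ρ / 2 := by simp [hq]
  set c : ℂ := 2 * Real.pi / ρ with hc
  -- The pole at `q = iρ/2` is removed by subtracting a multiple of `halfCyl/(cyl + 1)`, which has
  -- the same pole, decays at both ends, changes sign under `iρ`, and has the known integral `ρ/2`.
  -- No residue theorem for a pole inside the contour is then needed. The multiple is chosen so that
  -- the numerator vanishes at `q`, where `halfCyl` equals `i`.
  let N : ℂ → ℂ := fun z => -c * ft v z - ft v q * (c * Complex.I) * halfCyl ρ z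
  let D : ℂ → ℂ := fun z => cyl ρ z + 1
  have hN : Differentiable ℂ N := by
    have h1 := hv.differentiable_ft
    have h2 := differentiable_halfCyl ρ
    fun_prop
  have hD : Differentiable ℂ D := (differentiable_cyl ρ).add_const 1
  have hNq : N q = 0 := by
    simp only [N, hq, halfCyl_half hρ]
    linear_combination (-ft v (Complex.I * ρ / 2) * c) * Complex.I_sq
  have hDq : D q = 0 := by simp [D, hq, cyl_half hρ]
  have hDne : ∀ z : ℂ, 0 ≤ z.im → z.im ≤ ρ → z ≠ q → D z ≠ 0 := by
    intro z h0 h1 hne h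
    refine hne (im_eq_of_cyl_eq hρ ?_ ?_)
    · rw [hq, cyl_half hρ]
      exact eq_neg_of_add_eq_zero_left h
    · rw [hqim, abs_lt]
      constructor <;> linarith
  have hDd : dslope D q q ≠ 0 := by
    rw [dslope_same, ((hasDerivAt_cyl ρ q).add_const 1).deriv]
    have h1 : (ρ : ℂ) ≠ 0 := by exact_mod_cast hρ.ne'
    have h2 : (Real.pi : ℂ) ≠ 0 := by exact_mod_cast Real.pi_ne_zero
    exact mul_ne_zero (div_ne_zero (mul_ne_zero two_ne_zero h2) h1) (cyl_ne_zero ρ q)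
  have hdiv : ∀ {f : ℂ → ℂ}, f q = 0 → ∀ z, z ≠ q → dslope f q z = f z / (z - q) := by
    intro f hf z hz
    rw [dslope_of_ne _ hz, slope_def_field, hf, sub_zero]
  -- The quotient of the two `dslope`s is `N/D` with the singularity at `q` filled in, since `N` and
  -- `D` both vanish there and the zero of `D` is simple.
  let H : ℂ → ℂ := fun z => dslope N q z / dslope D q z
  have hH : ∀ z, z ≠ q → H z = N z / D z := by
    intro z hz
    simp only [H]
    rw [hdiv hNq z hz, hdiv hDq z hz, div_div_div_cancel_right₀ (sub_ne_zero.2 hz)]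
  have hH' : ∀ z, z ≠ q → H z = pole1 ρ q z * ft v z -
      (ft v q * (c * Complex.I)) * (halfCyl ρ z / (cyl ρ z + 1)) := by
    intro z hz
    rw [hH z hz, pole1, hq, cyl_half hρ]
    simp only [N, D, ← hc]
    ring
  have hline : ∀ y : ℝ, y ≠ ρ / 2 → ∀ x : ℝ, (x + y * Complex.I : ℂ) ≠ q := by
    intro y hy x h
    apply hy
    rw [← hqim, ← h]
    simp
  have e0 : ∀ x : ℝ, H (x + (0 : ℝ) * Complex.I) = pole1 ρ q x * ft v x -
      (ft v q * (c * Complex.I)) * (halfCyl ρ x / (cyl ρ x + 1)) := by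
    intro x
    rw [hH' _ (hline 0 (by positivity) x)]
    simp
  have e1 : ∀ x : ℝ, H (x + ρ * Complex.I) = pole1 ρ q x * ft v (x + Complex.I * ρ) +
      (ft v q * (c * Complex.I)) * (halfCyl ρ x / (cyl ρ x + 1)) := by
    intro x
    rw [hH' _ (hline ρ (by linarith) x), mul_comm (ρ : ℂ), halfCyl_add_I_mul hρ,
      cyl_add_I_mul hρ, pole1, pole1, cyl_add_I_mul hρ]
    ring
  have i0 : Integrable fun x : ℝ => pole1 ρ q x * ft v x :=
    hv.integrable_pole1_mul_ft_real (by rw [hqim]; positivity) (by rw [hqim]; linarith)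
  have i1 : Integrable fun x : ℝ => pole1 ρ q x * ft v (x + Complex.I * ρ) := by
    have := hv.integrable_pole1_mul_ft hρ (p := q) (y := ρ) (by linarith)
      (by rw [hqim, abs_lt]; constructor <;> linarith)
    convert this using 2 with x
    rw [mul_comm (ρ : ℂ), pole1, pole1, cyl_add_I_mul hρ]
  have i2 := (integrable_halfCyl_div hρ).const_mul (ft v q * (c * Complex.I))
  have key := integral_horizontal_eq (H := H) hρ.le ?_ ?_ ?_ ?_
  -- By antiperiodicity the subtracted term enters with opposite signs on the two lines. The two
  -- halves `ρ/2` add up to the residue term `2πi ft v(q)`.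
  · simp_rw [e0, e1] at key
    rw [integral_sub i0 i2, integral_add i1 i2, integral_const_mul, integral_halfCyl_div hρ] at key
    have h1 : (ρ : ℂ) ≠ 0 := by exact_mod_cast hρ.ne'
    have h2 : c * ρ = 2 * Real.pi := by
      rw [hc]
      field_simp
    linear_combination key + (ft v q * Complex.I) * h2
  · intro z hz
    have h1 : DifferentiableAt ℂ (dslope N q) z :=
      ((Complex.differentiableOn_dslope univ_mem).2 hN.differentiableOn).differentiableAt univ_mem
    have h2 : DifferentiableAt ℂ (dslope D q) z :=
      ((Complex.differentiableOn_dslope univ_mem).2 hD.differentiableOn).differentiableAt univ_mem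
    refine (h1.div h2 ?_).differentiableWithinAt
    by_cases hzq : z = q
    · rwa [hzq]
    · rw [hdiv hDq z hzq]
      exact div_ne_zero (hDne z hz.1 hz.2 hzq) (sub_ne_zero.2 hzq)
  · intro ε hε
    obtain ⟨a, ha, X, hX⟩ := exists_le_norm_cyl_sub hρ (a := -1) (by norm_num)
    obtain ⟨C, hC, hft⟩ := hv.exists_norm_ft_le_sq ρ
    obtain ⟨B, hB0, hB⟩ : ∃ B, 0 ≤ B ∧ ‖ft v q * (c * Complex.I)‖ = B := ⟨_, norm_nonneg _, rfl⟩
    -- With `|halfCyl|² = |cyl|`, the bound `|cyl + 1| ≥ a` serves on the left, where `halfCyl` is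
    -- small, and `|cyl + 1| ≥ a |cyl|` on the right, where it is large.
    have hhalf : ∃ Y : ℝ, ∀ z : ℂ, Y ≤ |z.re| → ‖halfCyl ρ z / (cyl ρ z + 1)‖ ≤ ε / (2 * (B + 1)) := by
      have hη : 0 < a * (ε / (2 * (B + 1))) := by positivity
      obtain ⟨X₁, h₁⟩ := eventually_atTop.1 ((tendsto_norm_cyl_atTop hρ).eventually_ge_atTop
        (1 / (a * (ε / (2 * (B + 1)))) ^ 2))
      obtain ⟨X₂, h₂⟩ := eventually_atBot.1 ((tendsto_norm_cyl_atBot hρ).eventually_le_const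
        (show 0 < (a * (ε / (2 * (B + 1)))) ^ 2 by positivity))
      refine ⟨max (max X (-X₂)) (max X₁ 0), fun z hz => ?_⟩
      have hzX := hX z ((le_max_left _ _).trans ((le_max_left _ _).trans hz))
      rw [sub_neg_eq_add] at hzX
      have hpos : 0 < ‖cyl ρ z + 1‖ := ha.trans_le hzX.1
      have hn : ‖halfCyl ρ z‖ ^ 2 = ‖cyl ρ z‖ := by rw [← norm_pow, halfCyl_sq]
      have hn' : ‖cyl ρ z‖ = Real.exp (2 * Real.pi * z.re / ρ) := norm_cyl ρ z
      have hh0 := norm_nonneg (halfCyl ρ z)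
      rw [norm_div, div_le_iff₀ hpos]
      generalize ε / (2 * (B + 1)) = η at *
      have hη' : 0 < η := pos_of_mul_pos_right hη ha.le
      rcases le_abs'.1 hz with h | h
      · have h3 := h₂ z.re (by
          have := le_max_right X (-X₂)
          have := le_max_left (max X (-X₂)) (max X₁ 0)
          linarith)
        rw [← hn', ← hn] at h3
        have h4 : ‖halfCyl ρ z‖ ≤ a * η := (abs_le_of_sq_le_sq' h3 hη.le).2
        nlinarith [hzX.1]
      · have h3 := h₁ z.re (by
          have := le_max_left X₁ 0
          have := le_max_right (max X (-X₂)) (max X₁ 0)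
          linarith)
        rw [← hn', ← hn, div_le_iff₀ (by positivity), ← mul_pow] at h3
        have h4 : 1 ≤ ‖halfCyl ρ z‖ * (a * η) := by
          by_contra hcon
          push Not at hcon
          have : 0 ≤ ‖halfCyl ρ z‖ * (a * η) := by positivity
          nlinarith
        have h5 := hzX.2
        rw [← hn] at h5
        calc ‖halfCyl ρ z‖ = ‖halfCyl ρ z‖ * 1 := (mul_one _).symm
          _ ≤ ‖halfCyl ρ z‖ * (‖halfCyl ρ z‖ * (a * η)) := by gcongr
          _ = η * (a * ‖halfCyl ρ z‖ ^ 2) := by ring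
          _ ≤ η * ‖cyl ρ z + 1‖ := by gcongr
    obtain ⟨Y, hY⟩ := hhalf
    obtain ⟨P, X₃, hP, hX₃⟩ := exists_bound_pole1 hρ q
    refine ⟨max (max Y X₃) (max 1 (2 * (P * C) / ε)), fun z hz0 hz1 hz => ?_⟩
    have h3 : Y ≤ |z.re| := (le_max_left _ _).trans ((le_max_left _ _).trans hz)
    have h4 : X₃ ≤ |z.re| := (le_max_right _ _).trans ((le_max_left _ _).trans hz)
    have h5 : 1 ≤ |z.re| := (le_max_left _ _).trans ((le_max_right _ _).trans hz)
    have h6 : 2 * (P * C) / ε ≤ |z.re| := (le_max_right _ _).trans ((le_max_right _ _).trans hz)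
    have hzq : z ≠ q := by
      rintro rfl
      rw [hq] at h5
      norm_num at h5
    rw [hH' z hzq]
    have t1 : ‖pole1 ρ q z * ft v z‖ ≤ ε / 2 := by
      rw [norm_mul]
      calc ‖pole1 ρ q z‖ * ‖ft v z‖ ≤ P * (C * (1 + z.re ^ 2)⁻¹) := by
            gcongr
            · exact hX₃ z h4
            · exact hft z (by rw [abs_of_nonneg hz0]; exact hz1)
        _ = P * C * (1 + |z.re| ^ 2)⁻¹ := by rw [sq_abs, mul_assoc]
        _ ≤ ε / 2 := by
          rw [div_le_iff₀ hε] at h6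
          rw [← div_eq_mul_inv, div_le_iff₀ (by positivity)]
          nlinarith [mul_le_mul_of_nonneg_left h5 (by positivity : 0 ≤ |z.re|)]
    have t2 : ‖(ft v q * (c * Complex.I)) * (halfCyl ρ z / (cyl ρ z + 1))‖ ≤ ε / 2 := by
      rw [norm_mul, hB]
      calc B * _ ≤ B * (ε / (2 * (B + 1))) := by
            gcongr
            exact hY z h3
        _ ≤ ε / 2 := by
          rw [← mul_div_assoc, div_le_div_iff₀ (by positivity) two_pos]
          nlinarith
    linarith [norm_sub_le (pole1 ρ q z * ft v z)
      ((ft v q * (c * Complex.I)) * (halfCyl ρ z / (cyl ρ z + 1)))]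
  · simp_rw [e0]
    exact i0.sub i2
  · simp_rw [e1]
    exact i1.add i2

/-- The Fourier transform of `pole1`, on test functions vanishing at the origin. -/
theorem IsTest.integral_pole1_half {ρ : ℝ} (hρ : 0 < ρ) {u : ℝ → ℂ} (hu : IsTest u)
    (h0 : u 0 = 0) :
    ∫ x : ℝ, pole1 ρ (Complex.I * ρ / 2) x * ft u x =
      ∫ x : ℝ, u x * (2 * Real.pi * Complex.I *
        Complex.exp (Complex.I * (Complex.I * ρ / 2) * x) * bose ρ x) := by
  obtain ⟨v, hv, huv⟩ := hu.exists_eq_one_sub_exp_mul hρ h0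
  -- Multiplication of `v` by `e^{-ρx}` is a shift of its Fourier transform by `iρ`, so dividing `u`
  -- by `1 - e^{-ρx}` puts the integral in the form of the residue theorem.
  have h1 : ∀ x : ℝ, ft u x = ft v x - ft v (x + Complex.I * ρ) := by
    intro x
    rw [ft_add]
    unfold ft
    rw [← integral_sub]
    · congr 1 with y
      beta_reduce
      rw [huv, show Complex.I * (Complex.I * ρ) * y = -(ρ * y : ℂ) by
        linear_combination (ρ * y : ℂ) * Complex.I_sq]
      ring
    · exact hv.integrable_mul (continuous_exp_mul _)
    · exact (hv.mul_right (contDiff_exp_mul _)).integrable_mul (continuous_exp_mul _)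
  have hqim : (Complex.I * ρ / 2).im = ρ / 2 := by simp
  have i0 : Integrable fun x : ℝ => pole1 ρ (Complex.I * ρ / 2) x * ft v x :=
    hv.integrable_pole1_mul_ft_real (by rw [hqim]; positivity) (by rw [hqim]; linarith)
  have i1 : Integrable fun x : ℝ => pole1 ρ (Complex.I * ρ / 2) x * ft v (x + Complex.I * ρ) := by
    have := (hv.mul_right (contDiff_exp_mul (Complex.I * ρ))).integrable_pole1_mul_ft_real
      (ρ := ρ) (p := Complex.I * ρ / 2) (by rw [hqim]; positivity) (by rw [hqim]; linarith)
    simpa only [← ft_add] using this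
  simp_rw [h1, mul_sub]
  rw [integral_sub i0 i1, hv.integral_pole1_half_sub hρ, ft, ← integral_const_mul]
  refine integral_congr_ae ?_
  filter_upwards [compl_mem_ae_iff.2 (measure_singleton (0 : ℝ))] with x hx
  have := one_sub_exp_ne_zero hρ hx
  rw [huv, bose]
  field_simp

theorem measurable_bose (ρ : ℝ) : Measurable (bose ρ) := by
  unfold bose
  fun_prop

/-- The singularity of `bose` at `0` is a simple pole of residue `1/ρ`. With `t = ρx`, the bound is
`|t| ≤ |1 - e^{-t}| (1 + |t|)`, which follows from `1 + s ≤ e^s` at `s = t` or `s = -t`. -/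
theorem norm_bose_mul_abs_le {ρ : ℝ} (hρ : 0 < ρ) (x : ℝ) :
    ‖bose ρ x‖ * |x| ≤ 1 / ρ + |x| := by
  rcases eq_or_ne x 0 with rfl | hx
  · simp [hρ.le]
  have h1 : bose ρ x = ((1 / (1 - Real.exp (-(ρ * x))) : ℝ) : ℂ) := by
    rw [bose]
    push_cast
    rfl
  have key : |ρ * x| ≤ |1 - Real.exp (-(ρ * x))| * (1 + |ρ * x|) := by
    generalize ρ * x = t
    rcases le_total 0 t with h | h
    · have h2 : Real.exp (-t) ≤ 1 := by simpa using h
      rw [abs_of_nonneg h, abs_of_nonneg (by linarith)]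
      have h3 : Real.exp (-t) * (1 + t) ≤ 1 := by
        calc _ ≤ Real.exp (-t) * Real.exp t := by
              gcongr
              linarith [Real.add_one_le_exp t]
          _ = 1 := by rw [← Real.exp_add]; simp
      linarith
    · have h2 : -t + 1 ≤ Real.exp (-t) := Real.add_one_le_exp (-t)
      rw [abs_of_nonpos h, abs_of_nonpos (by linarith)]
      nlinarith
  have hpos : 0 < |1 - Real.exp (-(ρ * x))| := by
    rw [abs_pos, sub_ne_zero, ne_comm, Ne, Real.exp_eq_one_iff, neg_eq_zero]
    positivity
  rw [h1, Complex.norm_real, Real.norm_eq_abs, abs_div, abs_one, one_div_mul_eq_div,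
    div_le_iff₀ hpos]
  rw [abs_mul, abs_of_pos hρ] at key
  have : (1 / ρ + |x|) * |1 - Real.exp (-(ρ * x))| =
      (|1 - Real.exp (-(ρ * x))| * (1 + ρ * |x|)) / ρ := by
    field_simp
  rw [this, le_div_iff₀ hρ]
  linarith

/-! ### Densities along the lines `k - σk' = x` -/

/-- The shear `(x, y) ↦ (x + σy, y)` preserves Lebesgue measure. -/
theorem measurePreserving_shear (σ : ℝ) :
    MeasurePreserving fun q : ℝ × ℝ => (q.1 + σ * q.2, q.2) := by
  have h : MeasurePreserving (fun q : ℝ × ℝ => (q.1, σ * q.1 + q.2))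
      ((volume : Measure ℝ).prod volume) ((volume : Measure ℝ).prod volume) :=
    (MeasurePreserving.id volume).skew_product (g := fun y x => σ * y + x) (by fun_prop)
      (Eventually.of_forall fun y => (measurePreserving_add_left volume (σ * y)).map_eq)
  have := (Measure.measurePreserving_swap (μ := (volume : Measure ℝ)) (ν := (volume : Measure ℝ))).comp
    (h.comp (Measure.measurePreserving_swap (μ := (volume : Measure ℝ)) (ν := (volume : Measure ℝ))))
  simp only [Measure.volume_eq_prod]
  convert this using 2
  simp [add_comm]

theorem measurableEmbedding_shear (σ : ℝ) :
    MeasurableEmbedding fun q : ℝ × ℝ => (q.1 + σ * q.2, q.2) := by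
  let e : ℝ × ℝ ≃ᵐ ℝ × ℝ :=
    { toFun := fun q => (q.1 + σ * q.2, q.2)
      invFun := fun q => (q.1 - σ * q.2, q.2)
      left_inv := fun q => by simp
      right_inv := fun q => by simp
      measurable_toFun := by
        change Measurable fun q : ℝ × ℝ => (q.1 + σ * q.2, q.2)
        fun_prop
      measurable_invFun := by
        change Measurable fun q : ℝ × ℝ => (q.1 - σ * q.2, q.2)
        fun_prop }
  exact e.measurableEmbedding

theorem integral_shear (σ : ℝ) {F : ℝ × ℝ → ℂ} (hF : Integrable F) :
    ∫ q, F q = ∫ x : ℝ, ∫ y : ℝ, F (x + σ * y, y) := by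
  rw [← (measurePreserving_shear σ).integral_comp (measurableEmbedding_shear σ) F]
  exact integral_prod _ ((measurePreserving_shear σ).integrable_comp_emb
    (measurableEmbedding_shear σ) |>.2 hF)

/-- The density of the image of `V` under `(k, k') ↦ k - σk'`. -/
noncomputable def push (σ : ℝ) (V : ℝ × ℝ → ℂ) (x : ℝ) : ℂ := ∫ y : ℝ, V (x + σ * y, y)

theorem isTest_push (σ : ℝ) {V : ℝ × ℝ → ℂ} (hV : ContDiff ℝ ∞ V) (hc : HasCompactSupport V) :
    IsTest (push σ V) := by
  have hK := hc.isCompact.image continuous_snd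
  have hzero : ∀ x y : ℝ, (x, y) ∉ tsupport V → V (x, y) = 0 :=
    fun x y h => image_eq_zero_of_notMem_tsupport h
  constructor
  · have := contDiff_integral_mul (G := fun x y => V (x + σ * y, y))
      (hV.comp ((contDiff_fst.add (contDiff_const.mul contDiff_snd)).prodMk contDiff_snd)) hK
      (fun x y hy => hzero _ _ fun h => hy ⟨_, h, rfl⟩) (φ := fun _ => 1)
      (locallyIntegrable_const 1)
    simp only [mul_one] at this
    exact this
  · refine HasCompactSupport.intro (K := (fun q : ℝ × ℝ => q.1 - σ * q.2) '' tsupport V)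
      (hc.isCompact.image (by fun_prop)) fun x hx => ?_
    have : ∀ y : ℝ, V (x + σ * y, y) = 0 :=
      fun y => hzero _ _ fun h => hx ⟨_, h, by simp⟩
    simp [push, this]

theorem integral_push_mul (σ : ℝ) {V : ℝ × ℝ → ℂ} {g : ℝ → ℂ}
    (h : Integrable fun q : ℝ × ℝ => V q * g (q.1 - σ * q.2)) :
    ∫ x : ℝ, push σ V x * g x = ∫ q : ℝ × ℝ, V q * g (q.1 - σ * q.2) := by
  rw [integral_shear σ h]
  congr 1 with x
  rw [push, ← integral_mul_const]
  simp

theorem integrable_mul_continuous {X : Type*} [TopologicalSpace X] [MeasurableSpace X]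
    [OpensMeasurableSpace X] {μ : Measure X} [IsFiniteMeasureOnCompacts μ] {V g : X → ℂ}
    (hV : Continuous V) (hc : HasCompactSupport V) (hg : Continuous g) :
    Integrable (fun q => V q * g q) μ :=
  (hV.mul hg).integrable_of_hasCompactSupport hc.mul_right

theorem ft_push (σ : ℝ) {V : ℝ × ℝ → ℂ} (hV : Continuous V) (hc : HasCompactSupport V) (z : ℂ) :
    ft (push σ V) z =
      ∫ q : ℝ × ℝ, V q * Complex.exp (Complex.I * z * ((q.1 - σ * q.2 : ℝ) : ℂ)) :=
  integral_push_mul σ (g := fun x : ℝ => Complex.exp (Complex.I * z * x))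
    (integrable_mul_continuous hV hc (by fun_prop))

/-- A smooth function vanishing on the line `k = σk'` absorbs the singularity of `bose`. -/
theorem integrable_mul_bose {ρ : ℝ} (hρ : 0 < ρ) (σ : ℝ) {W : ℝ × ℝ → ℂ} (hW : ContDiff ℝ ∞ W)
    (hc : HasCompactSupport W) (h0 : ∀ y, W (σ * y, y) = 0) {g : ℝ → ℂ} (hg : Continuous g) :
    Integrable fun q : ℝ × ℝ => W q * (g (q.1 - σ * q.2) * bose ρ (q.1 - σ * q.2)) := by
  -- A compactly supported smooth function is Lipschitz. Comparison with the point of the line `k =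
  -- σk'` having the same second coordinate gives `|W| ≤ C |k - σk'|`, which cancels the simple
  -- pole.
  obtain ⟨C, hC⟩ := (hW.of_le (m := 1) (by simp)).lipschitzWith_of_hasCompactSupport hc one_ne_zero
  have hlip : ∀ q : ℝ × ℝ, ‖W q‖ ≤ C * |q.1 - σ * q.2| := by
    intro q
    have h1 := hC.norm_sub_le q (σ * q.2, q.2)
    rw [h0, sub_zero] at h1
    simpa [Prod.norm_def] using h1
  have hsupp : Function.support (fun q : ℝ × ℝ =>
      W q * (g (q.1 - σ * q.2) * bose ρ (q.1 - σ * q.2))) ⊆ tsupport W := by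
    refine subset_trans (fun q hq => ?_) (subset_tsupport W)
    exact fun h => hq (by simp [h])
  rw [← integrableOn_iff_integrable_of_support_subset hsupp]
  have hb : Continuous fun q : ℝ × ℝ =>
      C * (1 / ρ + |q.1 - σ * q.2|) * ‖g (q.1 - σ * q.2)‖ := by fun_prop
  refine (hb.continuousOn.integrableOn_compact hc.isCompact).mono' ?_
    (Eventually.of_forall fun q => ?_)
  · have hm : Measurable fun q : ℝ × ℝ => q.1 - σ * q.2 := by fun_prop
    exact (hW.continuous.measurable.mul ((hg.measurable.comp hm).mul
      ((measurable_bose ρ).comp hm))).aestronglyMeasurable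
  · rw [norm_mul, norm_mul]
    have h1 := norm_bose_mul_abs_le hρ (q.1 - σ * q.2)
    calc _ ≤ C * |q.1 - σ * q.2| * (‖g (q.1 - σ * q.2)‖ * ‖bose ρ (q.1 - σ * q.2)‖) := by
          gcongr
          exact hlip q
      _ = C * (‖bose ρ (q.1 - σ * q.2)‖ * |q.1 - σ * q.2|) * ‖g (q.1 - σ * q.2)‖ := by ring
      _ ≤ _ := by gcongr

/-- Integration over the line of a combination of `pole1` functions against oscillating
integrals whose residues cancel on the line `k = σk'`. -/
theorem integral_sum_pole1 {ρ : ℝ} (hρ : 0 < ρ) {ι : Type*} [Fintype ι] {p : ι → ℂ}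
    (hp : ∀ i, 0 < (p i).im ∧ (p i).im < ρ) {V : ι → ℝ × ℝ → ℂ} (hV : ∀ i, ContDiff ℝ ∞ (V i))
    (hc : ∀ i, HasCompactSupport (V i)) (σ : ℝ) (h0 : ∀ y : ℝ, ∑ i, V i (σ * y, y) = 0) :
    (Integrable fun q : ℝ × ℝ => ∑ i, V i q * (2 * Real.pi * Complex.I *
      Complex.exp (Complex.I * p i * ((q.1 - σ * q.2 : ℝ) : ℂ)) * bose ρ (q.1 - σ * q.2))) ∧
    ∑ i, ∫ r : ℝ, pole1 ρ (p i) r *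
        ∫ q : ℝ × ℝ, V i q * Complex.exp (Complex.I * r * ((q.1 - σ * q.2 : ℝ) : ℂ)) =
      ∫ q : ℝ × ℝ, ∑ i, V i q * (2 * Real.pi * Complex.I *
      Complex.exp (Complex.I * p i * ((q.1 - σ * q.2 : ℝ) : ℂ)) * bose ρ (q.1 - σ * q.2)) := by
  set q₀ : ℂ := Complex.I * ρ / 2 with hq₀
  have hq₀im : q₀.im = ρ / 2 := by simp [hq₀]
  have hsm : ∀ z : ℂ, ContDiff ℝ ∞ fun q : ℝ × ℝ =>
      Complex.exp (Complex.I * z * ((q.1 - σ * q.2 : ℝ) : ℂ)) := fun z =>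
    (contDiff_exp_mul z).comp (contDiff_fst.sub (contDiff_const.mul contDiff_snd))
  -- All poles are moved to the common point `q₀ = iρ/2`. The factors `e^{i(p_i - q₀)(k - σk')}`
  -- this produces equal `1` on the line `k = σk'`, so the sum `W` still vanishes there, and its
  -- density `push σ W` vanishes at `0`. Only the sum does: the single terms could not be integrated
  -- against `bose`.
  let Wi : ι → ℝ × ℝ → ℂ := fun i q =>
    V i q * Complex.exp (Complex.I * (p i - q₀) * ((q.1 - σ * q.2 : ℝ) : ℂ))
  have hWi : ∀ i, ContDiff ℝ ∞ (Wi i) := fun i => (hV i).mul (hsm _)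
  have hWic : ∀ i, HasCompactSupport (Wi i) := fun i => (hc i).mul_right
  let W : ℝ × ℝ → ℂ := fun q => ∑ i, Wi i q
  have hW : ContDiff ℝ ∞ W := ContDiff.sum fun i _ => hWi i
  have hWc : HasCompactSupport W := by
    refine HasCompactSupport.intro (K := ⋃ i, tsupport (Wi i))
      (isCompact_iUnion fun i => (hWic i).isCompact) fun q hq => ?_
    simp only [Set.mem_iUnion, not_exists] at hq
    exact Finset.sum_eq_zero fun i _ => image_eq_zero_of_notMem_tsupport (hq i)
  have hW0 : ∀ y : ℝ, W (σ * y, y) = 0 := by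
    intro y
    simp only [W, Wi]
    simpa using h0 y
  have hfun : ∀ q : ℝ × ℝ, ∑ i, V i q * (2 * Real.pi * Complex.I *
      Complex.exp (Complex.I * p i * ((q.1 - σ * q.2 : ℝ) : ℂ)) * bose ρ (q.1 - σ * q.2)) =
      W q * ((2 * Real.pi * Complex.I *
        Complex.exp (Complex.I * q₀ * ((q.1 - σ * q.2 : ℝ) : ℂ))) * bose ρ (q.1 - σ * q.2)) := by
    intro q
    simp only [W, Wi]
    rw [Finset.sum_mul]
    refine Finset.sum_congr rfl fun i _ => ?_
    rw [show Complex.I * p i * ((q.1 - σ * q.2 : ℝ) : ℂ) =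
      Complex.I * (p i - q₀) * ((q.1 - σ * q.2 : ℝ) : ℂ) +
      Complex.I * q₀ * ((q.1 - σ * q.2 : ℝ) : ℂ) by ring, Complex.exp_add]
    ring
  have hint := integrable_mul_bose hρ σ hW hWc hW0
    (g := fun x : ℝ => 2 * Real.pi * Complex.I * Complex.exp (Complex.I * q₀ * x)) (by fun_prop)
  simp_rw [hfun]
  refine ⟨hint, ?_⟩
  have hpush : ∀ i (x : ℝ), push σ (V i) x * Complex.exp (Complex.I * (p i - q₀) * x) =
      push σ (Wi i) x := by
    intro i x
    simp only [push, Wi, ← integral_mul_const]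
    simp
  have hpi : ∀ i, ∫ r : ℝ, pole1 ρ (p i) r *
        ∫ q : ℝ × ℝ, V i q * Complex.exp (Complex.I * r * ((q.1 - σ * q.2 : ℝ) : ℂ)) =
      ∫ r : ℝ, pole1 ρ q₀ r * ft (push σ (Wi i)) r := by
    intro i
    simp_rw [← ft_push σ (hV i).continuous (hc i)]
    rw [integral_pole1_shift hρ (hp i).1 (hp i).2 (q := q₀) (by rw [hq₀im]; positivity)
      (by rw [hq₀im]; linarith) (isTest_push σ (hV i) (hc i))]
    simp_rw [hpush]
  simp_rw [hpi]
  rw [← integral_finsetSum]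
  · have hft : ∀ r : ℝ, ∑ i, pole1 ρ q₀ r * ft (push σ (Wi i)) r =
        pole1 ρ q₀ r * ft (push σ W) r := by
      intro r
      rw [← Finset.mul_sum, ft_push σ hW.continuous hWc]
      simp_rw [ft_push σ (hWi _).continuous (hWic _), W, Finset.sum_mul]
      rw [integral_finsetSum]
      intro i _
      exact integrable_mul_continuous (hWi i).continuous (hWic i) (by fun_prop)
    simp_rw [hft]
    rw [(isTest_push σ hW hWc).integral_pole1_half hρ]
    · exact integral_push_mul σ (g := fun x : ℝ => 2 * Real.pi * Complex.I *
        Complex.exp (Complex.I * q₀ * x) * bose ρ x) hint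
    · simp [push, hW0]
  · intro i _
    exact (isTest_push σ (hWi i) (hWic i)).integrable_pole1_mul_ft_real
      (by rw [hq₀im]; positivity) (by rw [hq₀im]; linarith)

/-! ### Liouville's theorem and partial fractions on the cylinder -/

theorem norm_prod_sub_le {ι : Type*} (s : Finset ι) (z : ι → ℂ) (q : ℂ) :
    ‖∏ i ∈ s, (q - z i)‖ ≤ (∏ i ∈ s, (1 + ‖z i‖)) * (1 + ‖q‖) ^ s.card := by
  rw [norm_prod, ← Finset.prod_const, ← Finset.prod_mul_distrib]
  refine Finset.prod_le_prod (fun i _ => norm_nonneg _) fun i _ => ?_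
  have := norm_sub_le q (z i)
  nlinarith [norm_nonneg q, norm_nonneg (z i), mul_nonneg (norm_nonneg q) (norm_nonneg (z i))]

/-- An entire function of growth order `n` with more than `n` zeros vanishes. -/
theorem eq_zero_of_growth_of_card (n : ℕ) : ∀ {P : ℂ → ℂ}, Differentiable ℂ P →
    (∃ C, ∀ q, ‖P q‖ ≤ C * (1 + ‖q‖) ^ n) → ∀ S : Finset ℂ, n < S.card →
    (∀ x ∈ S, P x = 0) → ∀ q, P q = 0 := by
  induction n with
  | zero =>
    rintro P hP ⟨C, hC⟩ S hS h0 q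
    obtain ⟨x, hx⟩ := Finset.card_pos.1 hS
    rw [← h0 x hx]
    refine hP.apply_eq_apply_of_bounded (isBounded_iff_forall_norm_le.2 ⟨C, ?_⟩) q x
    rintro _ ⟨y, rfl⟩
    simpa using hC y
  | succ n ih =>
    rintro P hP ⟨C, hC⟩ S hS h0 q
    obtain ⟨x, hx⟩ := Finset.card_pos.1 (n.succ_pos.trans hS)
    have hPx := h0 x hx
    -- Dividing out one zero lowers both the growth order and the number of remaining zeros by one.
    have hQ : Differentiable ℂ (dslope P x) := fun z =>
      ((Complex.differentiableOn_dslope univ_mem).2 hP.differentiableOn).differentiableAt univ_mem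
    have hPQ : ∀ z, P z = (z - x) * dslope P x z := by
      intro z
      have := sub_smul_dslope P x z
      rw [smul_eq_mul, hPx, sub_zero] at this
      exact this.symm
    have hC0 : 0 ≤ C := by
      have := (norm_nonneg _).trans (hC 0)
      simpa using this
    obtain ⟨B, hB⟩ := (isCompact_closedBall x 1).exists_bound_of_continuousOn
      hQ.continuous.continuousOn
    have hzero := ih hQ ⟨max B (C * (2 + ‖x‖)), fun z => ?_⟩ (S.erase x)
      (by rw [Finset.card_erase_of_mem hx]; omega)
      (fun y hy => by
        have h1 := h0 y (Finset.mem_of_mem_erase hy)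
        rw [hPQ, mul_eq_zero] at h1
        exact h1.resolve_left (sub_ne_zero.2 (Finset.ne_of_mem_erase hy)))
    · rw [hPQ, hzero, mul_zero]
    · have hone : (1 : ℝ) ≤ (1 + ‖z‖) ^ n := one_le_pow₀ (by linarith [norm_nonneg z])
      -- Near `x` the quotient is bounded by compactness. At distance at least `1`, the inequality
      -- `1 + |z| ≤ (2 + |x|) |z - x|` trades one power of `1 + |z|` for the divisor.
      rcases le_total ‖z - x‖ 1 with h | h
      · have h1 := hB z (by simpa [dist_eq_norm] using h)
        have h2 : 0 ≤ max B (C * (2 + ‖x‖)) := le_max_of_le_right (by positivity)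
        calc _ ≤ max B (C * (2 + ‖x‖)) * 1 := by
              rw [mul_one]
              exact h1.trans (le_max_left _ _)
          _ ≤ _ := by gcongr
      · have h1 : ‖z - x‖ * ‖dslope P x z‖ ≤ C * (1 + ‖z‖) ^ (n + 1) := by
          rw [← norm_mul, ← hPQ]
          exact hC z
        have h2 : 1 + ‖z‖ ≤ (2 + ‖x‖) * ‖z - x‖ := by
          have h3 : ‖z‖ ≤ ‖x‖ + ‖z - x‖ := norm_le_norm_add_norm_sub' z x
          nlinarith [norm_nonneg x]
        have h4 : ‖z - x‖ * ‖dslope P x z‖ ≤ ‖z - x‖ * (C * (2 + ‖x‖) * (1 + ‖z‖) ^ n) := by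
          calc _ ≤ C * (1 + ‖z‖) ^ (n + 1) := h1
            _ = C * (1 + ‖z‖) ^ n * (1 + ‖z‖) := by ring
            _ ≤ C * (1 + ‖z‖) ^ n * ((2 + ‖x‖) * ‖z - x‖) := by gcongr
            _ = _ := by ring
        calc ‖dslope P x z‖ ≤ C * (2 + ‖x‖) * (1 + ‖z‖) ^ n :=
              le_of_mul_le_mul_left h4 (by linarith)
          _ ≤ _ := by
              gcongr
              exact le_max_right _ _

theorem eventually_cyl_ne {ρ : ℝ} (hρ : 0 < ρ) {ι : Type*} [Fintype ι] (p : ι → ℂ) (z : ℂ) :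
    ∀ᶠ r in 𝓝[≠] z, ∀ i, cyl ρ r ≠ cyl ρ (p i) := by
  rw [eventually_all]
  intro i
  by_cases hz : cyl ρ z = cyl ρ (p i)
  · have : ∀ᶠ r : ℂ in 𝓝 z, |r.im - z.im| < ρ := by
      have hc : Continuous fun r : ℂ => |r.im - z.im| := by fun_prop
      exact hc.continuousAt.eventually_lt continuousAt_const (by simpa using hρ)
    filter_upwards [mem_nhdsWithin_of_mem_nhds this, self_mem_nhdsWithin] with r hr hrz hc
    exact hrz (im_eq_of_cyl_eq hρ (hc.trans hz.symm) hr)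
  · exact ((differentiable_cyl ρ).continuous.continuousAt.eventually_ne hz).filter_mono
      nhdsWithin_le_nhds

/-- A meromorphic `iρ`-periodic function `w` with simple poles, of residues `c i`, exactly at
the points `p i` of the open period strip. -/
structure PoleData (ρ : ℝ) (w : ℂ → ℂ) {ι : Type*} (p c : ι → ℂ) : Prop where
  rho_pos : 0 < ρ
  im : ∀ i, 0 < (p i).im ∧ (p i).im < ρ
  inj : Function.Injective p
  mero : Meromorphic w
  periodic : Function.Periodic w (Complex.I * ρ)
  analytic : ∀ r, (∀ i, cyl ρ r ≠ cyl ρ (p i)) → AnalyticAt ℂ w r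
  residue : ∀ i, Tendsto (fun r => (r - p i) * w r) (𝓝[≠] p i) (𝓝 (c i))

namespace PoleData

variable {ρ : ℝ} {w : ℂ → ℂ} {ι : Type*} {p c : ι → ℂ}

theorem cyl_injective (h : PoleData ρ w p c) : Function.Injective fun i => cyl ρ (p i) := by
  intro i j hij
  refine h.inj (im_eq_of_cyl_eq h.rho_pos hij ?_)
  have := h.im i
  have := h.im j
  rw [abs_lt]
  constructor <;> linarith

theorem real_ne (h : PoleData ρ w p c) (x : ℝ) (i : ι) : cyl ρ x ≠ cyl ρ (p i) := by
  have := h.im i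
  have := cyl_line_ne h.rho_pos (p := p i) (y := 0) this.1.ne
    (by rw [abs_lt]; constructor <;> linarith) x
  simpa using this

theorem eventually_ne [Fintype ι] (h : PoleData ρ w p c) (z : ℂ) :
    ∀ᶠ r in 𝓝[≠] z, ∀ i, cyl ρ r ≠ cyl ρ (p i) :=
  eventually_cyl_ne h.rho_pos p z

theorem dense_ne [Fintype ι] (h : PoleData ρ w p c) : Dense {r | ∀ i, cyl ρ r ≠ cyl ρ (p i)} := by
  rw [dense_iff_closure_eq, Set.eq_univ_iff_forall]
  intro z
  rw [mem_closure_iff_frequently]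
  exact (h.eventually_ne z).frequently.filter_mono nhdsWithin_le_nhds

/-- The product clearing the poles. -/
noncomputable def clear [Fintype ι] (ρ : ℝ) (p : ι → ℂ) (r : ℂ) : ℂ := ∏ i, (cyl ρ r - cyl ρ (p i))

theorem tendsto_cleared [Fintype ι] [DecidableEq ι] (h : PoleData ρ w p c) (i : ι) (n : ℤ) :
    Tendsto (fun r => w r * clear ρ p r) (𝓝[≠] (p i + n * (Complex.I * ρ)))
      (𝓝 (c i * (2 * Real.pi / ρ * cyl ρ (p i) *
        ∏ j ∈ Finset.univ.erase i, (cyl ρ (p i) - cyl ρ (p j))))) := by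
  have h1 : Tendsto (fun r => w r * clear ρ p r) (𝓝[≠] p i)
      (𝓝 (c i * (2 * Real.pi / ρ * cyl ρ (p i) *
        ∏ j ∈ Finset.univ.erase i, (cyl ρ (p i) - cyl ρ (p j))))) := by
    have hs := (hasDerivAt_cyl ρ (p i)).tendsto_slope
    have hp : Continuous fun r => ∏ j ∈ Finset.univ.erase i, (cyl ρ r - cyl ρ (p j)) := by
      have := (differentiable_cyl ρ).continuous
      fun_prop
    refine ((h.residue i).mul (hs.mul
      (hp.continuousAt.tendsto.mono_left nhdsWithin_le_nhds))).congr' ?_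
    filter_upwards [self_mem_nhdsWithin] with r hr
    have hne : r - p i ≠ 0 := sub_ne_zero.2 hr
    rw [clear, ← Finset.mul_prod_erase _ _ (Finset.mem_univ i), slope_def_field]
    field_simp
  have hper : ∀ r, w (r - n * (Complex.I * ρ)) * clear ρ p (r - n * (Complex.I * ρ)) =
      w r * clear ρ p r := by
    intro r
    have e1 : w (r - n * (Complex.I * ρ)) = w r := h.periodic.sub_int_mul_eq n
    have e2 : cyl ρ (r - n * (Complex.I * ρ)) = cyl ρ r :=
      (cyl_eq_iff h.rho_pos).2 ⟨-n, by push_cast; ring⟩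
    rw [clear, clear, e1, e2]
  have hmap : Tendsto (fun r : ℂ => r - n * (Complex.I * ρ))
      (𝓝[≠] (p i + n * (Complex.I * ρ))) (𝓝[≠] p i) := by
    refine tendsto_nhdsWithin_iff.2 ⟨?_, ?_⟩
    · have : Continuous fun r : ℂ => r - n * (Complex.I * ρ) := by fun_prop
      have := this.tendsto (p i + n * (Complex.I * ρ))
      rw [add_sub_cancel_right] at this
      exact this.mono_left nhdsWithin_le_nhds
    · filter_upwards [self_mem_nhdsWithin] with r hr hc
      apply hr
      rw [Set.mem_singleton_iff] at hc ⊢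
      rw [← hc]
      ring
  have := h1.comp hmap
  simpa only [Function.comp_def, hper] using this

/-- The entire function `w · clear`. -/
theorem exists_entire [Fintype ι] [DecidableEq ι] (h : PoleData ρ w p c) :
    ∃ W : ℂ → ℂ, Differentiable ℂ W ∧ Function.Periodic W (Complex.I * ρ) ∧
      (∀ r, (∀ i, cyl ρ r ≠ cyl ρ (p i)) → W r = w r * clear ρ p r) ∧
      ∀ i, W (p i) = c i * (2 * Real.pi / ρ * cyl ρ (p i) *
        ∏ j ∈ Finset.univ.erase i, (cyl ρ (p i) - cyl ρ (p j))) := by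
  set G : ℂ → ℂ := fun r => w r * clear ρ p r with hG
  have hcl : Differentiable ℂ (clear ρ p) := by
    unfold clear
    have := differentiable_cyl ρ
    fun_prop
  have hGm : MeromorphicOn G Set.univ := fun r _ =>
    (h.mero r).mul (hcl.analyticAt r).meromorphicAt
  have hlim : ∀ z, (¬∀ i, cyl ρ z ≠ cyl ρ (p i)) → ∃ a, Tendsto G (𝓝[≠] z) (𝓝 a) := by
    intro z hz
    push Not at hz
    obtain ⟨i, hi⟩ := hz
    obtain ⟨n, rfl⟩ := (cyl_eq_iff h.rho_pos).1 hi
    exact ⟨_, h.tendsto_cleared i n⟩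
  -- The values of `w` at its poles are arbitrary, so the product itself need not be continuous
  -- there. Its meromorphic normal form is entire, because limits exist at all candidate poles.
  set W := toMeromorphicNFOn G Set.univ with hW
  have hNF : ∀ z, MeromorphicNFAt W z := fun z =>
    meromorphicNFOn_toMeromorphicNFOn G Set.univ (Set.mem_univ z)
  have hWG : ∀ z, W =ᶠ[𝓝[≠] z] G := fun z =>
    hGm.toMeromorphicNFOn_eq_self_on_nhdsNE (Set.mem_univ z)
  have hGan : ∀ r, (∀ i, cyl ρ r ≠ cyl ρ (p i)) → AnalyticAt ℂ G r := fun r hr =>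
    (h.analytic r hr).mul (hcl.analyticAt r)
  have hWan : ∀ z, AnalyticAt ℂ W z := by
    intro z
    rw [← (hNF z).meromorphicOrderAt_nonneg_iff_analyticAt, meromorphicOrderAt_congr (hWG z)]
    by_cases hz : ∀ i, cyl ρ z ≠ cyl ρ (p i)
    · exact (hGan z hz).meromorphicOrderAt_nonneg
    · exact (tendsto_nhds_iff_meromorphicOrderAt_nonneg (hGm z (Set.mem_univ z))).1 (hlim z hz)
  have hWd : Differentiable ℂ W := fun z => (hWan z).differentiableAt
  have hWeq : ∀ r, (∀ i, cyl ρ r ≠ cyl ρ (p i)) → W r = G r := by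
    intro r hr
    exact tendsto_nhds_unique ((hWd r).continuousAt.tendsto.mono_left nhdsWithin_le_nhds)
      (((hGan r hr).continuousAt.tendsto.mono_left nhdsWithin_le_nhds).congr' (hWG r).symm)
  refine ⟨W, hWd, ?_, hWeq, fun i => ?_⟩
  · have hc := hWd.continuous
    have : (fun r => W (r + Complex.I * ρ)) = W := by
      refine Continuous.ext_on h.dense_ne (hc.comp (by fun_prop)) hc fun r hr => ?_
      have hr' : ∀ i, cyl ρ (r + Complex.I * ρ) ≠ cyl ρ (p i) := by
        intro i
        rw [cyl_add_I_mul h.rho_pos]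
        exact hr i
      rw [hWeq _ hr', hWeq _ hr]
      simp only [hG, clear]
      rw [h.periodic r, cyl_add_I_mul h.rho_pos]
    exact fun r => congrFun this r
  · refine tendsto_nhds_unique ((hWd (p i)).continuousAt.tendsto.mono_left nhdsWithin_le_nhds)
      (Tendsto.congr' (hWG _).symm ?_)
    simpa using h.tendsto_cleared i 0

theorem norm_clear_le [Fintype ι] (r : ℂ) : ‖clear ρ p r‖ ≤
    (∏ i, (1 + ‖cyl ρ (p i)‖)) * (1 + ‖cyl ρ r‖) ^ Fintype.card ι :=
  norm_prod_sub_le Finset.univ (fun i => cyl ρ (p i)) (cyl ρ r)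

/-- In the coordinate `q = e^{2πr/ρ}`, the function `w E`, cleared of its poles, is entire and of
polynomial growth. -/
theorem exists_polynomial_growth [Fintype ι] [DecidableEq ι] (h : PoleData ρ w p c) {E : ℂ → ℂ}
    (hE : Differentiable ℂ E) (hper : Function.Periodic E (Complex.I * ρ))
    (hb : ∃ C X : ℝ, ∀ r : ℂ, X ≤ |r.re| → ‖w r * E r‖ ≤ C) :
    ∃ P : ℂ → ℂ, Differentiable ℂ P ∧ (∃ C, ∀ q, ‖P q‖ ≤ C * (1 + ‖q‖) ^ Fintype.card ι) ∧
      (∀ r, (∀ i, cyl ρ r ≠ cyl ρ (p i)) → P (cyl ρ r) = w r * clear ρ p r * E r) ∧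
      ∀ i, P (cyl ρ (p i)) = c i * (2 * Real.pi / ρ * cyl ρ (p i) *
        ∏ j ∈ Finset.univ.erase i, (cyl ρ (p i) - cyl ρ (p j))) * E (p i) := by
  obtain ⟨W, hWd, hWper, hW, hWp⟩ := h.exists_entire
  obtain ⟨C, X, hCX⟩ := hb
  set K : ℝ := ∏ i, (1 + ‖cyl ρ (p i)‖) with hK
  have hK0 : 0 ≤ K := Finset.prod_nonneg fun i _ => by positivity
  -- Beyond `Y` in modulus, `Re r` exceeds the real parts of all poles.
  set Y : ℝ := max X (∑ i, |(p i).re| + 1) with hY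
  have hne : ∀ r : ℂ, Y ≤ |r.re| → ∀ i, cyl ρ r ≠ cyl ρ (p i) := by
    intro r hr i hc
    obtain ⟨n, hn⟩ := (cyl_eq_iff h.rho_pos).1 hc
    have h1 : r.re = (p i).re := by simp [hn]
    have h2 : |(p i).re| ≤ ∑ i, |(p i).re| :=
      Finset.single_le_sum (f := fun i => |(p i).re|) (fun _ _ => abs_nonneg _) (Finset.mem_univ i)
    rw [h1] at hr
    have := le_max_right X (∑ i, |(p i).re| + 1)
    linarith
  have hC0 : 0 ≤ C := (norm_nonneg _).trans (hCX (|X| : ℝ) (by simp [le_abs_self]))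
  have hgrow : ∀ r : ℂ, Y ≤ |r.re| →
      ‖W r * E r‖ ≤ C * K * (1 + ‖cyl ρ r‖) ^ Fintype.card ι := by
    intro r hr
    rw [hW r (hne r hr), mul_right_comm, norm_mul, mul_assoc]
    gcongr
    · exact hCX r ((le_max_left _ _).trans hr)
    · exact norm_clear_le r
  -- The rotation `r = iz` makes the period real, so that `e^{2πr/ρ}` is the usual `q`-parameter and
  -- `Re r → -∞` is the cusp. Boundedness there removes the singularity at `q = 0`. Boundedness at
  -- `Re r → +∞` gives the polynomial growth.
  let F : ℂ → ℂ := fun z => W (Complex.I * z) * E (Complex.I * z)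
  have hFd : Differentiable ℂ F := by fun_prop
  have hFper : Function.Periodic F ρ := by
    intro z
    simp only [F]
    rw [mul_add, hWper, hper]
  have hFb : BoundedAtFilter (comap Complex.im atTop) F := by
    refine Asymptotics.IsBigO.of_bound (C * K * 2 ^ Fintype.card ι) ?_
    have : ∀ᶠ z : ℂ in comap Complex.im atTop, max Y 0 ≤ z.im :=
      tendsto_comap.eventually (eventually_ge_atTop _)
    filter_upwards [this] with z hz
    have hre : (Complex.I * z).re = -z.im := by simp
    have h0 : 0 ≤ z.im := (le_max_right _ _).trans hz
    have h1 := hgrow (Complex.I * z) (by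
      rw [hre, abs_neg, abs_of_nonneg h0]
      exact (le_max_left _ _).trans hz)
    have h2 : ‖cyl ρ (Complex.I * z)‖ ≤ 1 := by
      rw [norm_cyl, hre]
      refine Real.exp_le_one_iff.2 ?_
      have := h.rho_pos
      have : 0 ≤ 2 * Real.pi * z.im / ρ := by positivity
      rw [mul_neg, neg_div]
      linarith
    simp only [Pi.one_apply, norm_one, mul_one]
    calc ‖F z‖ ≤ _ := h1
      _ ≤ C * K * (1 + 1) ^ Fintype.card ι := by gcongr
      _ = _ := by norm_num
  have hq : ∀ r, Function.Periodic.qParam ρ (-(Complex.I * r)) = cyl ρ r := by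
    intro r
    rw [Function.Periodic.qParam, cyl]
    congr 1
    linear_combination (-(2 * Real.pi * r / ρ : ℂ)) * Complex.I_sq
  set P := Function.Periodic.cuspFunction ρ F with hP
  have hPcyl : ∀ r, P (cyl ρ r) = W r * E r := by
    intro r
    rw [← hq, hP, Function.Periodic.eq_cuspFunction h.rho_pos.ne' hFper]
    simp only [F]
    have : Complex.I * -(Complex.I * r) = r := by linear_combination (-r) * Complex.I_sq
    rw [this]
  have hPd : Differentiable ℂ P := by
    intro q
    rcases eq_or_ne q 0 with rfl | hq0
    · exact Function.Periodic.differentiableAt_cuspFunction_zero h.rho_pos hFper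
        (Eventually.of_forall fun z => hFd z) hFb
    · rw [← Function.Periodic.qParam_right_inv h.rho_pos.ne' hq0]
      exact Function.Periodic.differentiableAt_cuspFunction h.rho_pos.ne' hFper (hFd _)
  have hcylsurj : ∀ q : ℂ, q ≠ 0 → ∃ r, cyl ρ r = q := by
    intro q hq0
    refine ⟨Complex.I * Function.Periodic.invQParam ρ q, ?_⟩
    rw [← hq, ← Function.Periodic.qParam_right_inv h.rho_pos.ne' hq0]
    congr 1
    rw [Function.Periodic.qParam_right_inv h.rho_pos.ne' hq0]
    linear_combination (-Function.Periodic.invQParam ρ q) * Complex.I_sq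
  refine ⟨P, hPd, ?_, fun r hr => by rw [hPcyl, hW r hr], fun i => by rw [hPcyl, hWp]⟩
  obtain ⟨B, hB⟩ := (isCompact_closedBall (0 : ℂ)
    (Real.exp (2 * Real.pi * Y / ρ))).exists_bound_of_continuousOn hPd.continuous.continuousOn
  refine ⟨max B (C * K), fun q => ?_⟩
  have hone : (1 : ℝ) ≤ (1 + ‖q‖) ^ Fintype.card ι := one_le_pow₀ (by linarith [norm_nonneg q])
  have hm : 0 ≤ max B (C * K) := le_max_of_le_right (by positivity)
  by_cases hqb : ‖q‖ ≤ Real.exp (2 * Real.pi * Y / ρ)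
  · calc ‖P q‖ ≤ max B (C * K) * 1 := by
          rw [mul_one]
          exact (hB q (by simpa using hqb)).trans (le_max_left _ _)
      _ ≤ _ := by gcongr
  · push Not at hqb
    obtain ⟨r, rfl⟩ := hcylsurj q (norm_pos_iff.1 ((Real.exp_pos _).trans hqb))
    rw [norm_cyl, Real.exp_lt_exp] at hqb
    have hr : Y ≤ r.re := by
      by_contra hcon
      push Not at hcon
      have := h.rho_pos
      have : 2 * Real.pi * r.re / ρ ≤ 2 * Real.pi * Y / ρ := by
        have := Real.pi_pos
        gcongr
      linarith
    rw [hPcyl]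
    calc _ ≤ _ := hgrow r (hr.trans (le_abs_self _))
      _ ≤ _ := by
        gcongr
        exact le_max_right _ _

/-- An entire periodic `E` with `w E` bounded near `Re r = ±∞` and more real zeros than `w` has
poles vanishes on the real line, if `w` has no real zeros. -/
theorem eq_zero_of_real_zeros [Fintype ι] [DecidableEq ι] (h : PoleData ρ w p c) {E : ℂ → ℂ}
    (hE : Differentiable ℂ E) (hper : Function.Periodic E (Complex.I * ρ))
    (hb : ∃ C X : ℝ, ∀ r : ℂ, X ≤ |r.re| → ‖w r * E r‖ ≤ C)
    (hw : ∀ x : ℝ, w x ≠ 0) {κ : Type*} [Fintype κ] (hcard : Fintype.card ι < Fintype.card κ)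
    {x : κ → ℝ} (hx : Function.Injective x) (h0 : ∀ k, E (x k) = 0) (y : ℝ) : E y = 0 := by
  obtain ⟨P, hPd, hPg, hP, -⟩ := h.exists_polynomial_growth hE hper hb
  have hinj : Function.Injective fun k => cyl ρ (x k) := by
    intro k l hkl
    have := im_eq_of_cyl_eq h.rho_pos hkl (by simpa using h.rho_pos)
    exact hx (by exact_mod_cast this)
  have hz := eq_zero_of_growth_of_card _ hPd hPg (Finset.univ.map ⟨_, hinj⟩) (by simpa using hcard)
    (by
      intro q hq
      simp only [Finset.mem_map, Finset.mem_univ, true_and, Function.Embedding.coeFn_mk] at hq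
      obtain ⟨k, rfl⟩ := hq
      rw [hP _ (h.real_ne _), h0, mul_zero]) (cyl ρ y)
  rw [hP _ (h.real_ne y)] at hz
  have hcl : clear ρ p y ≠ 0 := Finset.prod_ne_zero_iff.2 fun i _ => sub_ne_zero.2 (h.real_ne y i)
  exact (mul_eq_zero.1 hz).resolve_left (mul_ne_zero (hw y) hcl)

/-- Partial fractions: a bounded `w E` is a constant plus the sum of its principal parts. -/
theorem exists_partial_fractions [Fintype ι] [DecidableEq ι] (h : PoleData ρ w p c) {E : ℂ → ℂ}
    (hE : Differentiable ℂ E) (hper : Function.Periodic E (Complex.I * ρ))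
    (hb : ∃ C X : ℝ, ∀ r : ℂ, X ≤ |r.re| → ‖w r * E r‖ ≤ C) :
    ∃ A : ℂ, ∀ r, (∀ i, cyl ρ r ≠ cyl ρ (p i)) →
      w r * E r = A + ∑ i, c i * E (p i) * pole1 ρ (p i) r := by
  obtain ⟨P, hPd, ⟨C, hC⟩, hP, hPp⟩ := h.exists_polynomial_growth hE hper hb
  set Z : ι → ℂ := fun i => cyl ρ (p i) with hZ
  have hZinj : Function.Injective Z := h.cyl_injective
  have hZ0 : ∀ i, Z i ≠ 0 := fun i => cyl_ne_zero _ _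
  set a : ι → ℂ := fun i => c i * E (p i) * (2 * Real.pi / ρ * Z i) with ha
  set s : ℂ → ℂ := fun q => ∑ i, a i * ∏ j ∈ Finset.univ.erase i, (q - Z j) with hs
  -- The difference `D` of the two sides, cleared of poles, vanishes at the `n` points `Z i` because
  -- the principal parts agree. The constant is chosen to give one more zero at `q = 0`, which no `Z
  -- i` equals. With growth order `n` and `n + 1` zeros, `D` vanishes identically.
  set A : ℂ := (P 0 - s 0) / ∏ i, (0 - Z i) with hA
  let D : ℂ → ℂ := fun q => P q - A * ∏ i, (q - Z i) - s q
  have hsd : Differentiable ℂ s := by fun_prop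
  have hDd : Differentiable ℂ D := by fun_prop
  have hDg : ∃ C, ∀ q, ‖D q‖ ≤ C * (1 + ‖q‖) ^ Fintype.card ι := by
    refine ⟨C + ‖A‖ * (∏ i, (1 + ‖Z i‖)) +
      ∑ i, ‖a i‖ * ∏ j ∈ Finset.univ.erase i, (1 + ‖Z j‖), fun q => ?_⟩
    have h1 : ‖A * ∏ i, (q - Z i)‖ ≤
        ‖A‖ * (∏ i, (1 + ‖Z i‖)) * (1 + ‖q‖) ^ Fintype.card ι := by
      rw [norm_mul, mul_assoc]
      gcongr
      exact norm_prod_sub_le Finset.univ Z q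
    have h2 : ‖s q‖ ≤ (∑ i, ‖a i‖ * ∏ j ∈ Finset.univ.erase i, (1 + ‖Z j‖)) *
        (1 + ‖q‖) ^ Fintype.card ι := by
      rw [Finset.sum_mul]
      refine norm_sum_le_of_le _ fun i _ => ?_
      rw [norm_mul, mul_assoc]
      refine mul_le_mul_of_nonneg_left ?_ (norm_nonneg _)
      refine (norm_prod_sub_le _ Z q).trans ?_
      have h3 : 0 ≤ ∏ j ∈ Finset.univ.erase i, (1 + ‖Z j‖) :=
        Finset.prod_nonneg fun _ _ => by positivity
      refine mul_le_mul_of_nonneg_left ?_ h3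
      exact pow_le_pow_right₀ (by linarith [norm_nonneg q]) (Finset.card_le_univ _)
    have h3 := hC q
    calc ‖D q‖ ≤ ‖P q‖ + ‖A * ∏ i, (q - Z i)‖ + ‖s q‖ :=
          (norm_sub_le _ _).trans (by gcongr; exact norm_sub_le _ _)
      _ ≤ _ := by linarith
  have hprod0 : ∀ i, ∏ j, (Z i - Z j) = 0 := fun i =>
    Finset.prod_eq_zero (Finset.mem_univ i) (sub_self _)
  have hsZ : ∀ i, s (Z i) = a i * ∏ j ∈ Finset.univ.erase i, (Z i - Z j) := by
    intro i
    refine Finset.sum_eq_single i (fun k _ hk => ?_) (by simp)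
    rw [Finset.prod_eq_zero (Finset.mem_erase.2 ⟨hk.symm, Finset.mem_univ i⟩) (sub_self _),
      mul_zero]
  have hDzero := eq_zero_of_growth_of_card _ hDd hDg
    (insert 0 (Finset.univ.map ⟨Z, hZinj⟩))
    (by
      rw [Finset.card_insert_of_notMem]
      · simp
      · simpa using hZ0)
    (by
      intro q hq
      simp only [Finset.mem_insert, Finset.mem_map, Finset.mem_univ, true_and,
        Function.Embedding.coeFn_mk] at hq
      rcases hq with rfl | ⟨i, rfl⟩
      · have hne : ∏ i, (0 - Z i) ≠ 0 := Finset.prod_ne_zero_iff.2 fun i _ => by simpa using hZ0 i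
        simp only [D]
        rw [hA, div_mul_cancel₀ _ hne]
        ring
      · simp only [D]
        rw [hprod0, hsZ, hPp, ha]
        ring)
  refine ⟨A, fun r hr => ?_⟩
  have h1 := hDzero (cyl ρ r)
  simp only [D] at h1
  rw [hP r hr] at h1
  have hcl : clear ρ p r ≠ 0 := Finset.prod_ne_zero_iff.2 fun i _ => sub_ne_zero.2 (hr i)
  have hclear : clear ρ p r = ∏ i, (cyl ρ r - Z i) := rfl
  have hsr : s (cyl ρ r) = (∑ i, c i * E (p i) * pole1 ρ (p i) r) * clear ρ p r := by
    rw [Finset.sum_mul]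
    refine Finset.sum_congr rfl fun i _ => ?_
    rw [hclear, ← Finset.mul_prod_erase _ _ (Finset.mem_univ i), pole1]
    have : cyl ρ r - cyl ρ (p i) ≠ 0 := sub_ne_zero.2 (hr i)
    simp only [ha, hZ]
    field_simp
  rw [hsr, ← hclear] at h1
  refine mul_right_cancel₀ hcl ?_
  linear_combination h1

end PoleData

/-! ### The weight function: symmetry, poles and residues -/

theorem frequently_nhdsNE_of_real {P : ℂ → Prop} (hP : ∀ x : ℝ, P x) : ∃ᶠ z in 𝓝[≠] (0 : ℂ), P z := by
  have ht : Tendsto (fun x : ℝ => (x : ℂ)) (𝓝[≠] 0) (𝓝[≠] 0) := by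
    refine tendsto_nhdsWithin_iff.2 ⟨?_, ?_⟩
    · have := (Complex.continuous_ofReal.tendsto 0).mono_left
        (nhdsWithin_le_nhds (s := ({0}ᶜ : Set ℝ)))
      simpa using this
    · filter_upwards [self_mem_nhdsWithin] with x hx
      simpa using hx
  exact ht.frequently (Eventually.of_forall hP).frequently

theorem eq_of_eq_real {f g : ℂ → ℂ} (hf : Differentiable ℂ f) (hg : Differentiable ℂ g)
    (h : ∀ x : ℝ, f x = g x) (z : ℂ) : f z = g z := by
  have h1 : AnalyticOnNhd ℂ f Set.univ := fun z _ => hf.analyticAt z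
  have h2 : AnalyticOnNhd ℂ g Set.univ := fun z _ => hg.analyticAt z
  exact congrFun (h1.eq_of_frequently_eq h2 (frequently_nhdsNE_of_real h)) z

/-- All poles in the period strip. -/
noncomputable def allPoles (ρ : ℝ) {L : ℕ} (pole : Fin L → ℂ) : Fin L ⊕ Fin L → ℂ :=
  Sum.elim pole fun j => Complex.I * ρ - pole j

/-- The residues at all poles in the period strip. -/
noncomputable def allResidues (w : ℂ → ℂ) {L : ℕ} (pole : Fin L → ℂ) : Fin L ⊕ Fin L → ℂ :=
  Sum.elim (fun j => simpleResidue w (pole j)) fun j => -simpleResidue w (pole j)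

theorem cyl_reflect {ρ : ℝ} (hρ : 0 < ρ) (z : ℂ) :
    cyl ρ (Complex.I * ρ - z) = (cyl ρ z)⁻¹ := by
  rw [cyl_sub, cyl_I_mul hρ, one_div]

theorem exists_int_shift {ρ : ℝ} (hρ : 0 < ρ) (r : ℂ) :
    ∃ n : ℤ, 0 ≤ (r - n * (Complex.I * ρ)).im ∧ (r - n * (Complex.I * ρ)).im < ρ := by
  refine ⟨⌊r.im / ρ⌋, ?_⟩
  have him : (r - ⌊r.im / ρ⌋ * (Complex.I * ρ)).im = r.im - ⌊r.im / ρ⌋ * ρ := by simp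
  have h1 := Int.floor_le (r.im / ρ)
  have h2 := Int.lt_floor_add_one (r.im / ρ)
  rw [le_div_iff₀ hρ] at h1
  rw [div_lt_iff₀ hρ] at h2
  rw [him]
  constructor <;> linarith

namespace Assumptions

variable {ρ γ : ℝ} {w : ℂ → ℂ} {m : ℤˣ → ℂ → ℝ → ℂ} {T R : ℝ → ℂ} {L : ℕ} {pole : Fin L → ℂ}

theorem w_periodic' (h : Assumptions ρ γ w m T R L pole) :
    Function.Periodic w (Complex.I * ρ) := h.w_periodic

theorem analyticAt_of_ne (h : Assumptions ρ γ w m T R L pole) {r : ℂ}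
    (hr : ∀ i, cyl ρ r ≠ cyl ρ (allPoles ρ pole i)) : AnalyticAt ℂ w r := by
  obtain ⟨n, h0, h1⟩ := exists_int_shift h.rho_pos r
  have hcyl : cyl ρ (r - n * (Complex.I * ρ)) = cyl ρ r :=
    (cyl_eq_iff h.rho_pos).2 ⟨-n, by push_cast; ring⟩
  have hw := h.w_analytic _ h0 h1 fun j => by
    constructor
    · intro hc
      exact hr (Sum.inl j) (by rw [← hcyl, hc]; rfl)
    · intro hc
      exact hr (Sum.inr j) (by rw [← hcyl, hc]; rfl)
  have hcomp : AnalyticAt ℂ (fun z => w (z - n * (Complex.I * ρ))) r :=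
    hw.comp_of_eq (analyticAt_id.sub analyticAt_const) rfl
  refine hcomp.congr (Eventually.of_forall fun z => ?_)
  exact h.w_periodic'.sub_int_mul_eq n

theorem ne_neg (h : Assumptions ρ γ w m T R L pole) {r : ℂ}
    (hr : ∀ i, cyl ρ r ≠ cyl ρ (allPoles ρ pole i)) (i : Fin L ⊕ Fin L) :
    cyl ρ (-r) ≠ cyl ρ (allPoles ρ pole i) := by
  intro hc
  rw [cyl_neg] at hc
  rcases i with j | j
  · apply hr (Sum.inr j)
    change cyl ρ r = cyl ρ (Complex.I * ρ - pole j)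
    rw [cyl_reflect h.rho_pos, ← inv_inv (cyl ρ r), hc]
    rfl
  · apply hr (Sum.inl j)
    change cyl ρ r = cyl ρ (pole j)
    have h2 : cyl ρ (allPoles ρ pole (Sum.inr j)) = (cyl ρ (pole j))⁻¹ := cyl_reflect h.rho_pos _
    rw [h2] at hc
    exact inv_injective hc

theorem allPoles_im (h : Assumptions ρ γ w m T R L pole) (i : Fin L ⊕ Fin L) :
    0 < (allPoles ρ pole i).im ∧ (allPoles ρ pole i).im < ρ := by
  rcases i with j | j
  · exact h.pole_im j
  · have := h.pole_im j
    have h2 : (allPoles ρ pole (Sum.inr j)).im = ρ - (pole j).im := by simp [allPoles]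
    rw [h2]
    constructor <;> linarith

theorem real_ne (h : Assumptions ρ γ w m T R L pole) (x : ℝ) (i : Fin L ⊕ Fin L) :
    cyl ρ x ≠ cyl ρ (allPoles ρ pole i) := by
  have := h.allPoles_im i
  have := cyl_line_ne h.rho_pos (p := allPoles ρ pole i) (y := 0) this.1.ne
    (by rw [abs_lt]; constructor <;> linarith) x
  simpa using this

theorem w_neg (h : Assumptions ρ γ w m T R L pole) {r : ℂ}
    (hr : ∀ i, cyl ρ r ≠ cyl ρ (allPoles ρ pole i)) : w (-r) = w r := by
  set U : Set ℂ := {r | ∀ i, cyl ρ r ≠ cyl ρ (allPoles ρ pole i)} with hU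
  have hcount : Uᶜ.Countable := by
    have : Uᶜ ⊆ ⋃ i, Set.range fun n : ℤ => allPoles ρ pole i + n * (Complex.I * ρ) := by
      intro z hz
      simp only [hU, Set.mem_compl_iff, Set.mem_ofPred_eq, not_forall, not_not] at hz
      obtain ⟨i, hi⟩ := hz
      obtain ⟨n, hn⟩ := (cyl_eq_iff h.rho_pos).1 hi
      exact Set.mem_iUnion.2 ⟨i, n, hn.symm⟩
    exact (Set.countable_iUnion fun i => Set.countable_range _).mono this
  have hconn : IsPreconnected U := by
    have := hcount.isConnected_compl_of_one_lt_rank (E := ℂ) (by simp)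
    rw [compl_compl] at this
    exact this.isPreconnected
  have h1 : AnalyticOnNhd ℂ w U := fun z hz => h.analyticAt_of_ne hz
  have h2 : AnalyticOnNhd ℂ (fun z => w (-z)) U := fun z hz =>
    (h.analyticAt_of_ne (h.ne_neg hz)).comp_of_eq analyticAt_id.neg rfl
  have h0 : (0 : ℂ) ∈ U := fun i => by
    have := h.real_ne 0 i
    rwa [Complex.ofReal_zero] at this
  exact h2.eqOn_of_preconnected_of_frequently_eq h1 hconn h0
    (frequently_nhdsNE_of_real h.w_even) hr

theorem tendsto_residue (h : Assumptions ρ γ w m T R L pole) (j : Fin L) :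
    Tendsto (fun r => (r - pole j) * w r) (𝓝[≠] pole j) (𝓝 (simpleResidue w (pole j))) := by
  obtain ⟨g, hg, -, hwg⟩ := (meromorphicOrderAt_eq_int_iff (h.w_meromorphic _)).1 (h.pole_simple j)
  have ht : Tendsto (fun r => (r - pole j) * w r) (𝓝[≠] pole j) (𝓝 (g (pole j))) := by
    refine (hg.continuousAt.tendsto.mono_left nhdsWithin_le_nhds).congr' ?_
    filter_upwards [hwg, self_mem_nhdsWithin] with r hr hne
    have : r - pole j ≠ 0 := sub_ne_zero.2 hne
    rw [hr, zpow_neg_one, smul_eq_mul]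
    field_simp
  rwa [simpleResidue, ht.limUnder_eq]

/-- The residue at `iρ - r_j` is `-w_j`, because periodicity and evenness give `w(iρ - r) = w(r)`.
-/
theorem poleData (h : Assumptions ρ γ w m T R L pole) :
    PoleData ρ w (allPoles ρ pole) (allResidues w pole) where
  rho_pos := h.rho_pos
  im := h.allPoles_im
  inj := by
    rintro (i | i) (j | j) hij
    · exact congrArg _ (h.pole_injective hij)
    · exact absurd hij (h.pole_ne_reflected i j)
    · exact absurd hij.symm (h.pole_ne_reflected j i)
    · have : pole i = pole j := sub_right_injective hij
      exact congrArg _ (h.pole_injective this)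
  mero := h.w_meromorphic
  periodic := h.w_periodic'
  analytic := fun _ hr => h.analyticAt_of_ne hr
  residue := by
    rintro (j | j)
    · exact h.tendsto_residue j
    · change Tendsto (fun r => (r - (Complex.I * ρ - pole j)) * w r)
        (𝓝[≠] (Complex.I * ρ - pole j)) (𝓝 (-simpleResidue w (pole j)))
      have hmap : Tendsto (fun r : ℂ => Complex.I * ρ - r) (𝓝[≠] (Complex.I * ρ - pole j))
          (𝓝[≠] pole j) := by
        refine tendsto_nhdsWithin_iff.2 ⟨?_, ?_⟩
        · have : Continuous fun r : ℂ => Complex.I * ρ - r := by fun_prop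
          have := this.tendsto (Complex.I * ρ - pole j)
          rw [sub_sub_cancel] at this
          exact this.mono_left nhdsWithin_le_nhds
        · filter_upwards [self_mem_nhdsWithin] with r hr hc
          apply hr
          rw [Set.mem_singleton_iff] at hc ⊢
          rw [← hc]
          ring
      refine ((h.tendsto_residue j).comp hmap).neg.congr' ?_
      filter_upwards [eventually_cyl_ne h.rho_pos (allPoles ρ pole) (Complex.I * ρ - pole j)]
        with r hr
      have : w (Complex.I * ρ - r) = w r := by
        rw [sub_eq_add_neg, add_comm, h.w_periodic, h.w_neg hr]
      simp only [Function.comp_def, this]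
      ring

theorem w_real_ne_zero (h : Assumptions ρ γ w m T R L pole) (x : ℝ) : w x ≠ 0 := by
  obtain ⟨y, hy, hw⟩ := h.w_pos x
  rw [hw]
  exact_mod_cast hy.ne'

end Assumptions

/-! ### The finite-dimensional space of the coefficients -/

/-- Entire functions `f` with `f(r + iρ) = ε f(r)` and `|w| |f|²` bounded near `Re r = ±∞`. -/
def growthSpace (ρ : ℝ) (w : ℂ → ℂ) (ε : ℂ) : Submodule ℂ (ℂ → ℂ) where
  carrier := {f | Differentiable ℂ f ∧ (∀ r, f (r + Complex.I * ρ) = ε * f r) ∧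
    ∃ C X : ℝ, ∀ r : ℂ, X ≤ |r.re| → ‖w r‖ * ‖f r‖ ^ 2 ≤ C}
  add_mem' := by
    rintro f g ⟨hf, hfp, C, X, hC⟩ ⟨hg, hgp, D, Y, hD⟩
    refine ⟨hf.add hg, fun r => by simp only [Pi.add_apply, hfp, hgp]; ring, 2 * C + 2 * D,
      max X Y, fun r hr => ?_⟩
    have h1 := hC r ((le_max_left _ _).trans hr)
    have h2 := hD r ((le_max_right _ _).trans hr)
    have h3 := norm_add_le (f r) (g r)
    have h4 : ‖f r + g r‖ ^ 2 ≤ 2 * ‖f r‖ ^ 2 + 2 * ‖g r‖ ^ 2 := by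
      nlinarith [norm_nonneg (f r + g r), sq_nonneg (‖f r‖ - ‖g r‖)]
    calc ‖w r‖ * ‖f r + g r‖ ^ 2 ≤ ‖w r‖ * (2 * ‖f r‖ ^ 2 + 2 * ‖g r‖ ^ 2) := by gcongr
      _ ≤ _ := by linarith
  zero_mem' := ⟨differentiable_const 0, by simp, 0, 0, by simp⟩
  smul_mem' := by
    rintro c f ⟨hf, hfp, C, X, hC⟩
    refine ⟨hf.const_smul c, fun r => by simp only [Pi.smul_apply, smul_eq_mul, hfp]; ring,
      ‖c‖ ^ 2 * C, X, fun r hr => ?_⟩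
    simp only [Pi.smul_apply, norm_smul, mul_pow]
    calc ‖w r‖ * (‖c‖ ^ 2 * ‖f r‖ ^ 2) = ‖c‖ ^ 2 * (‖w r‖ * ‖f r‖ ^ 2) := by ring
      _ ≤ _ := by
        gcongr
        exact hC r hr

namespace growthSpace

variable {ρ : ℝ} {w : ℂ → ℂ} {ε : ℂ}

theorem periodic_mul (hε : ε ^ 2 = 1) {f g : ℂ → ℂ} (hf : f ∈ growthSpace ρ w ε)
    (hg : g ∈ growthSpace ρ w ε) : Function.Periodic (fun r => f r * g r) (Complex.I * ρ) := by
  intro r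
  simp only
  rw [hf.2.1, hg.2.1]
  linear_combination (f r * g r) * hε

theorem exists_bound_mul {f g : ℂ → ℂ} (hf : f ∈ growthSpace ρ w ε)
    (hg : g ∈ growthSpace ρ w ε) :
    ∃ C X : ℝ, ∀ r : ℂ, X ≤ |r.re| → ‖w r * (f r * g r)‖ ≤ C := by
  obtain ⟨-, -, C, X, hC⟩ := hf
  obtain ⟨-, -, D, Y, hD⟩ := hg
  refine ⟨C + D, max X Y, fun r hr => ?_⟩
  have h1 := hC r ((le_max_left _ _).trans hr)
  have h2 := hD r ((le_max_right _ _).trans hr)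
  rw [norm_mul, norm_mul]
  have h3 : ‖f r‖ * ‖g r‖ ≤ ‖f r‖ ^ 2 + ‖g r‖ ^ 2 := by
    nlinarith [sq_nonneg (‖f r‖ - ‖g r‖), sq_nonneg ‖f r‖, sq_nonneg ‖g r‖]
  calc _ ≤ ‖w r‖ * (‖f r‖ ^ 2 + ‖g r‖ ^ 2) := by gcongr
    _ ≤ _ := by linarith

end growthSpace

namespace Assumptions

variable {ρ γ : ℝ} {w : ℂ → ℂ} {m : ℤˣ → ℂ → ℝ → ℂ} {T R : ℝ → ℂ} {L : ℕ} {pole : Fin L → ℂ}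

theorem exists_sign (h : Assumptions ρ γ w m T R L pole) :
    ∃ ε : ℂ, ε ^ 2 = 1 ∧ ∀ τ (r : ℂ) (k : ℝ), m τ (r + Complex.I * ρ) k = ε * m τ r k := by
  rcases h.m_periodic with hp | hp
  · exact ⟨1, by simp, by simpa using hp⟩
  · exact ⟨-1, by simp, by simpa using hp⟩

/-- The asymptotics bound `w^{1/2} m^τ` for `Im r` in the compact set `[0,ρ]`. The quantity `|w|
|m^τ|²` is `iρ`-periodic since `|ε| = 1`, so the bound holds at all heights. -/
theorem mem_growthSpace (h : Assumptions ρ γ w m T R L pole) {ε : ℂ} (hε : ε ^ 2 = 1)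
    (hm : ∀ τ (r : ℂ) (k : ℝ), m τ (r + Complex.I * ρ) k = ε * m τ r k) (τ : ℤˣ) (k : ℝ) :
    (fun r => m τ r k) ∈ growthSpace ρ w ε := by
  refine ⟨h.m_entire τ k, fun r => hm τ r k, ?_⟩
  obtain ⟨R₀, s, hs, has⟩ := h.asymptotics
  obtain ⟨C, R₁, hR, hR1, hC⟩ := has {k} (Set.Icc 0 ρ) isCompact_singleton isCompact_Icc
  have hexp : ∀ x : ℝ, 0 ≤ x → C * Real.exp (-(γ * x)) ≤ |C| := by
    intro x hx
    calc C * Real.exp (-(γ * x)) ≤ |C| * Real.exp (-(γ * x)) := by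
          gcongr
          exact le_abs_self C
      _ ≤ |C| * 1 := by
          gcongr
          rw [Real.exp_le_one_iff]
          have := h.gamma_pos
          have : 0 ≤ γ * x := by positivity
          linarith
      _ = |C| := mul_one _
  have hstrip : ∀ r : ℂ, r.im ∈ Set.Icc 0 ρ → R₁ ≤ |r.re| →
      ‖s r * m τ r k‖ ≤ |C| + ‖T k‖ + ‖R k‖ + 1 := by
    intro r him hre
    obtain ⟨h1, h2, -⟩ := hC k rfl r him
    have n1 := norm_nonneg (T k)
    have n2 := norm_nonneg (R k)
    have hC0 := abs_nonneg C
    rcases le_abs'.1 hre with hr | hr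
    · have h3 := h2 hr
      have h4 := hexp (-r.re) (by linarith)
      rw [mul_neg, neg_neg] at h4
      rcases Int.units_eq_one_or τ with rfl | rfl
      · have := norm_le_norm_add_norm_sub' (s r * m 1 r k) 1
        rw [norm_one] at this
        linarith [h3.1]
      · have := norm_le_norm_add_norm_sub' (s r * m (-1) r k) (-R k)
        rw [norm_neg] at this
        linarith [h3.2]
    · have h3 := h1 hr
      have h4 := hexp r.re (by linarith)
      rcases Int.units_eq_one_or τ with rfl | rfl
      · have := norm_le_norm_add_norm_sub' (s r * m 1 r k) (T k)
        linarith [h3.1]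
      · linarith [h3.2]
  refine ⟨(|C| + ‖T k‖ + ‖R k‖ + 1) ^ 2, R₁, fun r hr => ?_⟩
  have hinv : Function.Periodic (fun r => ‖w r‖ * ‖m τ r k‖ ^ 2) (Complex.I * ρ) := by
    intro z
    have hn : ‖ε‖ ^ 2 = 1 := by rw [← norm_pow, hε, norm_one]
    simp only
    rw [h.w_periodic, hm, norm_mul, mul_pow, hn, one_mul]
  obtain ⟨n, h0, h1⟩ := exists_int_shift h.rho_pos r
  have e1 : ‖w (r - n * (Complex.I * ρ))‖ * ‖m τ (r - n * (Complex.I * ρ)) k‖ ^ 2 =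
      ‖w r‖ * ‖m τ r k‖ ^ 2 := hinv.sub_int_mul_eq n
  have hre : (r - n * (Complex.I * ρ)).re = r.re := by simp
  rw [← e1, ← hs.sq_eq _ (by rw [hre]; linarith), norm_pow, ← mul_pow, ← norm_mul]
  gcongr
  exact hstrip _ ⟨h0, h1.le⟩ (by rw [hre]; exact hr)

theorem neg_mem_growthSpace (h : Assumptions ρ γ w m T R L pole) {ε : ℂ} (hε : ε ^ 2 = 1)
    {f : ℂ → ℂ} (hf : f ∈ growthSpace ρ w ε) : (fun r => f (-r)) ∈ growthSpace ρ w ε := by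
  obtain ⟨hd, hp, C, X, hC⟩ := hf
  -- The radius is taken past all poles because the evenness of `w` is available only away from
  -- them.
  refine ⟨hd.comp differentiable_neg, fun r => ?_, C, max X (∑ i, |(allPoles ρ pole i).re| + 1),
    fun r hr => ?_⟩
  · have h1 := hp (-(r + Complex.I * ρ))
    rw [neg_add, neg_add_cancel_right] at h1
    beta_reduce
    rw [neg_add, h1]
    linear_combination (-f (-r + -(Complex.I * ρ))) * hε
  · have hne : ∀ i, cyl ρ r ≠ cyl ρ (allPoles ρ pole i) := by
      intro i hc
      obtain ⟨n, hn⟩ := (cyl_eq_iff h.rho_pos).1 hc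
      have h1 : r.re = (allPoles ρ pole i).re := by simp [hn]
      have h2 := Finset.single_le_sum (f := fun i => |(allPoles ρ pole i).re|)
        (fun _ _ => abs_nonneg _) (Finset.mem_univ i)
      have h3 := (le_max_right X (∑ i, |(allPoles ρ pole i).re| + 1)).trans hr
      rw [h1] at h3
      linarith
    rw [← h.w_neg hne]
    exact hC (-r) (by
      rw [Complex.neg_re, abs_neg]
      exact (le_max_left _ _).trans hr)

/-- The coefficients `m^τ(·, k)` lie in a finite-dimensional space, and are determined by their
values at finitely many real points. -/
theorem exists_expansion (h : Assumptions ρ γ w m T R L pole) {ε : ℂ} (hε : ε ^ 2 = 1)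
    (hm : ∀ τ (r : ℂ) (k : ℝ), m τ (r + Complex.I * ρ) k = ε * m τ r k) :
    ∃ e : Fin (2 * L + 1) → ℂ → ℂ, (∀ i, e i ∈ growthSpace ρ w ε) ∧
      ∀ τ (r : ℂ) (k : ℝ), m τ r k = ∑ i : Fin (2 * L + 1), m τ (((i : ℕ) : ℝ) : ℂ) k * e i r := by
  let x : Fin (2 * L + 1) → ℝ := fun i => (i : ℕ)
  have hx : Function.Injective x := fun i j hij => Fin.ext (Nat.cast_injective (R := ℝ) hij)
  let ev : growthSpace ρ w ε →ₗ[ℂ] (Fin (2 * L + 1) → ℂ) :=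
    LinearMap.pi fun i => (LinearMap.proj (R := ℂ) (φ := fun _ : ℂ => ℂ) (x i : ℂ)).comp
      (growthSpace ρ w ε).subtype
  have hev : LinearMap.ker ev = ⊥ := by
    rw [LinearMap.ker_eq_bot']
    intro f hf
    have h0 : ∀ i, (f : ℂ → ℂ) (x i) = 0 := fun i => congrFun hf i
    -- The square `f²` is periodic also in the antiperiodic case, and `w f²` is bounded far out. As
    -- `w` has `2L` poles in the strip, `2L + 1` real zeros force `f² = 0`. Evaluation at these
    -- points is thus injective, and a left inverse of it supplies the functions `e i`.
    have hreal : ∀ y : ℝ, (f : ℂ → ℂ) y = 0 := by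
      intro y
      have := h.poleData.eq_zero_of_real_zeros (E := fun r => (f : ℂ → ℂ) r * (f : ℂ → ℂ) r)
        (f.2.1.mul f.2.1) (growthSpace.periodic_mul hε f.2 f.2)
        (growthSpace.exists_bound_mul f.2 f.2) h.w_real_ne_zero (κ := Fin (2 * L + 1))
        (by simp; omega) hx (fun k => by simp only [h0, mul_zero]) y
      exact mul_self_eq_zero.1 this
    ext z
    exact eq_of_eq_real f.2.1 (differentiable_const 0) hreal z
  obtain ⟨g, hg⟩ := LinearMap.exists_leftInverse_of_injective ev hev
  refine ⟨fun i => g (Pi.single i 1), fun i => (g (Pi.single i 1)).2, fun τ r k => ?_⟩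
  let f : growthSpace ρ w ε := ⟨fun r => m τ r k, h.mem_growthSpace hε hm τ k⟩
  have h1 : g (ev f) = f := LinearMap.congr_fun hg f
  have h2 : ev f = ∑ i, m τ (x i) k • (Pi.single i 1 : Fin (2 * L + 1) → ℂ) := by
    rw [pi_eq_sum_univ' (ev f)]
    rfl
  have h3 : (f : ℂ → ℂ) r = ((∑ i, m τ (x i) k • g (Pi.single i 1) : growthSpace ρ w ε) : ℂ → ℂ) r := by
    rw [← h1, h2, map_sum]
    simp only [map_smul]
  have h4 : (f : ℂ → ℂ) r = m τ r k := rfl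
  rw [← h4, h3]
  simp [x]

/-- Joint smoothness is assumed for real `r` only. The expansion expresses `m^τ(z,k)` at complex `z`
through values at real points, where smoothness in `k` is known. -/
theorem contDiff_coeff (h : Assumptions ρ γ w m T R L pole) (τ : ℤˣ) (z : ℂ) :
    ContDiff ℝ ∞ fun k => m τ z k := by
  obtain ⟨ε, hε, hm⟩ := h.exists_sign
  obtain ⟨e, -, he⟩ := h.exists_expansion hε hm
  rw [funext fun k => he τ z k]
  exact ContDiff.sum fun i _ => ((h.m_smooth τ).comp (contDiff_const.prodMk contDiff_id)).mul
    contDiff_const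

theorem contDiff_coeffM (h : Assumptions ρ γ w m T R L pole) (α τ : ℤˣ) (z : ℂ) :
    ContDiff ℝ ∞ fun q : ℝ × ℝ => coeffM m α τ z q.1 q.2 := by
  unfold coeffM
  have h1 : ∀ τ z, ContDiff ℝ ∞ fun q : ℝ × ℝ => m τ z (-q.1) := fun τ z =>
    (h.contDiff_coeff τ z).comp contDiff_fst.neg
  have h2 : ∀ τ z, ContDiff ℝ ∞ fun q : ℝ × ℝ => m τ z q.2 := fun τ z =>
    (h.contDiff_coeff τ z).comp contDiff_snd
  exact ((h1 _ _).mul (h2 _ _)).add ((h1 _ _).mul (h2 _ _))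

theorem coeffM_differentiable (h : Assumptions ρ γ w m T R L pole) (α τ : ℤˣ) (k k' : ℝ) :
    Differentiable ℂ fun r => coeffM m α τ r k k' := by
  unfold coeffM
  have := fun τ k => h.m_entire τ k
  fun_prop

/-- The identity theorem extends the evenness assumption from real `r` to complex `r`; it is needed
at `r_j`. -/
theorem coeffM_neg_diag (h : Assumptions ρ γ w m T R L pole) (α : ℤˣ) (z : ℂ) (k : ℝ) :
    coeffM m α α z k k = coeffM m α α (-z) k k :=
  eq_of_eq_real (h.coeffM_differentiable α α k k)
    ((h.coeffM_differentiable α α k k).comp differentiable_neg)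
    (fun x => h.M_even α x k) z

theorem sgn_mul_mem (h : Assumptions ρ γ w m T R L pole) {ε : ℂ} (hε : ε ^ 2 = 1)
    (hm : ∀ τ (r : ℂ) (k : ℝ), m τ (r + Complex.I * ρ) k = ε * m τ r k) (α τ : ℤˣ) (k : ℝ) :
    (fun r => m τ (sgn α * r) k) ∈ growthSpace ρ w ε := by
  rcases Int.units_eq_one_or α with rfl | rfl
  · simpa [sgn] using h.mem_growthSpace hε hm τ k
  · simpa [sgn] using h.neg_mem_growthSpace hε (h.mem_growthSpace hε hm τ k)

theorem coeffM_periodic_bounded (h : Assumptions ρ γ w m T R L pole) (α τ : ℤˣ) (k k' : ℝ) :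
    Function.Periodic (fun r => coeffM m α τ r k k') (Complex.I * ρ) ∧
    ∃ C X : ℝ, ∀ r : ℂ, X ≤ |r.re| → ‖w r * coeffM m α τ r k k'‖ ≤ C := by
  obtain ⟨ε, hε, hm⟩ := h.exists_sign
  have m1 := h.neg_mem_growthSpace hε (h.mem_growthSpace hε hm 1 (-k))
  have m2 := h.neg_mem_growthSpace hε (h.sgn_mul_mem hε hm α τ k')
  have m3 := h.mem_growthSpace hε hm (-1) (-k)
  have m4 := h.sgn_mul_mem hε hm α (-τ) k'
  simp only [mul_neg] at m2
  refine ⟨(growthSpace.periodic_mul hε m1 m2).add (growthSpace.periodic_mul hε m3 m4), ?_⟩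
  obtain ⟨C, X, hC⟩ := growthSpace.exists_bound_mul m1 m2
  obtain ⟨D, Y, hD⟩ := growthSpace.exists_bound_mul m3 m4
  refine ⟨C + D, max X Y, fun r hr => ?_⟩
  rw [coeffM, mul_add]
  exact norm_add_le_of_le (hC r ((le_max_left _ _).trans hr)) (hD r ((le_max_right _ _).trans hr))

end Assumptions

/-! ### Partial fractions of `w M` on the real line -/

theorem tendsto_pole1_atTop {ρ : ℝ} (hρ : 0 < ρ) (p : ℂ) :
    Tendsto (fun x : ℝ => pole1 ρ p x) atTop (𝓝 0) := by
  obtain ⟨a, ha, X, hX⟩ := exists_le_norm_cyl_sub hρ (cyl_ne_zero ρ p)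
  rw [tendsto_zero_iff_norm_tendsto_zero]
  have h1 : Tendsto (fun x : ℝ => ‖(2 * Real.pi / ρ * cyl ρ p : ℂ)‖ / a *
      (Real.exp (2 * Real.pi * x / ρ))⁻¹) atTop (𝓝 0) := by
    simpa using (tendsto_norm_cyl_atTop hρ).inv_tendsto_atTop.const_mul
      (‖(2 * Real.pi / ρ * cyl ρ p : ℂ)‖ / a)
  refine squeeze_zero' (Eventually.of_forall fun x => norm_nonneg _) ?_ h1
  filter_upwards [eventually_ge_atTop X] with x hx
  have h2 := (hX x (by simpa using hx.trans (le_abs_self x))).2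
  rw [norm_cyl, Complex.ofReal_re] at h2
  rw [pole1, norm_div, ← div_eq_mul_inv, div_div]
  gcongr

namespace Assumptions

variable {ρ γ : ℝ} {w : ℂ → ℂ} {m : ℤˣ → ℂ → ℝ → ℂ} {T R : ℝ → ℂ} {L : ℕ} {pole : Fin L → ℂ}

/-- The positive square root of `w` on the real line. -/
noncomputable def rootW (w : ℂ → ℂ) (x : ℝ) : ℂ := (Real.sqrt (w x).re : ℂ)

theorem rootW_sq (h : Assumptions ρ γ w m T R L pole) (x : ℝ) :
    rootW w x * rootW w x = w x := by
  obtain ⟨y, hy, hw⟩ := h.w_pos x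
  rw [rootW, hw, ← Complex.ofReal_mul, Complex.ofReal_re, Real.mul_self_sqrt hy.le]

theorem rootW_neg (h : Assumptions ρ γ w m T R L pole) (x : ℝ) :
    rootW w (-x) = rootW w x := by
  rw [rootW, rootW, Complex.ofReal_neg, h.w_even]

theorem continuous_w (h : Assumptions ρ γ w m T R L pole) : Continuous fun x : ℝ => w x :=
  continuous_iff_continuousAt.2 fun x =>
    (h.analyticAt_of_ne (h.real_ne x)).continuousAt.comp Complex.continuous_ofReal.continuousAt

theorem continuous_rootW (h : Assumptions ρ γ w m T R L pole) : Continuous (rootW w) := by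
  unfold rootW
  exact Complex.continuous_ofReal.comp
    (Real.continuous_sqrt.comp (Complex.continuous_re.comp h.continuous_w))

/-- The asymptotics of the coefficients on the real line. -/
theorem tendsto_coeff (h : Assumptions ρ γ w m T R L pole) (k : ℝ) :
    Tendsto (fun x : ℝ => rootW w x * m 1 (-(x : ℂ)) k) atTop (𝓝 1) ∧
    Tendsto (fun x : ℝ => rootW w x * m (-1) x k) atTop (𝓝 0) := by
  obtain ⟨R₀, s, hs, has⟩ := h.asymptotics
  obtain ⟨C, R₁, hR, hR1, hC⟩ := has {k} {0} isCompact_singleton isCompact_singleton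
  have hexp : Tendsto (fun x : ℝ => C * Real.exp (-(γ * x))) atTop (𝓝 0) := by
    have : Tendsto (fun x : ℝ => -(γ * x)) atTop atBot :=
      tendsto_neg_atTop_atBot.comp (tendsto_id.const_mul_atTop h.gamma_pos)
    simpa using (Real.tendsto_exp_atBot.comp this).const_mul C
  have hroot : ∀ x : ℝ, R₁ ≤ |x| → s x = rootW w x := fun x hx =>
    hs.eq_sqrt x (by linarith)
  constructor
  · rw [tendsto_iff_norm_sub_tendsto_zero]
    refine squeeze_zero' (Eventually.of_forall fun x => norm_nonneg _) ?_ hexp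
    filter_upwards [eventually_ge_atTop R₁] with x hx
    have h1 := ((hC k rfl (-x : ℝ) (by simp)).2.1 (by simpa using hx)).1
    rw [hroot _ (by rw [abs_neg]; exact hx.trans (le_abs_self x)), h.rootW_neg] at h1
    simpa using h1
  · rw [tendsto_zero_iff_norm_tendsto_zero]
    refine squeeze_zero' (Eventually.of_forall fun x => norm_nonneg _) ?_ hexp
    filter_upwards [eventually_ge_atTop R₁] with x hx
    have h1 := ((hC k rfl (x : ℝ) (by simp)).1 (by simpa using hx)).2
    rw [hroot _ (hx.trans (le_abs_self x))] at h1
    simpa using h1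

theorem tendsto_coeffM (h : Assumptions ρ γ w m T R L pole) (α : ℤˣ) (k k' : ℝ) :
    Tendsto (fun x : ℝ => w x * coeffM m α α x k k') atTop (𝓝 (if α = 1 then 1 else 0)) := by
  have a1 := (h.tendsto_coeff (-k)).1
  have a2 := (h.tendsto_coeff (-k)).2
  have b1 := (h.tendsto_coeff k').1
  have b2 := (h.tendsto_coeff k').2
  rcases Int.units_eq_one_or α with rfl | rfl
  · have := (a1.mul b1).add (a2.mul b2)
    simp only [mul_one, mul_zero, add_zero] at this
    simp only [if_true]
    refine this.congr fun x => ?_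
    rw [← h.rootW_sq, coeffM]
    simp [sgn]
    ring
  · have := (a1.mul b2).add (a2.mul b1)
    simp only [mul_zero, zero_mul, add_zero] at this
    rw [if_neg (by decide)]
    refine this.congr fun x => ?_
    rw [← h.rootW_sq, coeffM]
    simp [sgn]
    ring

/-- Partial fraction expansion of `w M` on the real line, with smooth constant term. -/
theorem partial_fractions (h : Assumptions ρ γ w m T R L pole) (α τ : ℤˣ) :
    ∃ A : ℝ × ℝ → ℂ, ContDiff ℝ ∞ A ∧
      (∀ k k' x : ℝ, w x * coeffM m α τ x k k' = A (k, k') + ∑ j, simpleResidue w (pole j) *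
        (coeffM m α τ (pole j) k k' * pole1 ρ (pole j) x -
          coeffM m α τ (-pole j) k k' * pole1 ρ (Complex.I * ρ - pole j) x)) ∧
      (τ = α → ∀ k k', A (k, k') = if α = 1 then 1 else 0) := by
  let S : ℝ → ℝ → ℝ → ℂ := fun k k' x => ∑ j, simpleResidue w (pole j) *
        (coeffM m α τ (pole j) k k' * pole1 ρ (pole j) x -
          coeffM m α τ (-pole j) k k' * pole1 ρ (Complex.I * ρ - pole j) x)
  have key : ∀ k k', ∃ a : ℂ, ∀ x : ℝ, w x * coeffM m α τ x k k' = a + S k k' x := by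
    intro k k'
    obtain ⟨hper, hb⟩ := h.coeffM_periodic_bounded α τ k k'
    obtain ⟨a, ha⟩ := h.poleData.exists_partial_fractions (h.coeffM_differentiable α τ k k') hper hb
    refine ⟨a, fun x => ?_⟩
    rw [ha x (h.real_ne x), Fintype.sum_sum_type, ← Finset.sum_add_distrib]
    congr 1
    refine Finset.sum_congr rfl fun j _ => ?_
    have e : coeffM m α τ (Complex.I * ρ - pole j) k k' = coeffM m α τ (-pole j) k k' := by
      have := hper (-pole j)
      beta_reduce at this
      rw [← this]
      ring_nf
    simp only [allPoles, allResidues, Sum.elim_inl, Sum.elim_inr, e]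
    ring
  -- The constant term is read off at `r = 0`, a regular point, which makes its smoothness in
  -- `(k,k')` evident.
  refine ⟨fun q => w (0 : ℝ) * coeffM m α τ (0 : ℝ) q.1 q.2 - S q.1 q.2 0, ?_, ?_, ?_⟩
  · have := fun z => h.contDiff_coeffM α τ z
    refine (contDiff_const.mul (this _)).sub (ContDiff.sum fun j _ => contDiff_const.mul ?_)
    exact ((this _).mul contDiff_const).sub ((this _).mul contDiff_const)
  · intro k k' x
    obtain ⟨a, ha⟩ := key k k'
    beta_reduce
    rw [ha, ha 0]
    simp [S]
  · rintro rfl k k'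
    obtain ⟨a, ha⟩ := key k k'
    beta_reduce
    rw [ha 0, add_sub_cancel_right]
    -- For `τ = α` the constant is also the limit of `w M` at `+∞`, since every `pole1` vanishes
    -- there.
    have hS : Tendsto (fun x : ℝ => a + S k k' x) atTop (𝓝 a) := by
      have h0 : Tendsto (S k k') atTop (𝓝 (∑ j : Fin L, simpleResidue w (pole j) *
          (coeffM m τ τ (pole j) k k' * 0 - coeffM m τ τ (-pole j) k k' * 0))) :=
        tendsto_finsetSum _ fun j _ => (((tendsto_pole1_atTop h.rho_pos _).const_mul _).sub
          ((tendsto_pole1_atTop h.rho_pos _).const_mul _)).const_mul _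
      simpa using h0.const_add a
    exact tendsto_nhds_unique (hS.congr fun x => (ha x).symm) (h.tendsto_coeffM τ k k')

/-- The functions `w^{1/2} f`, `f` in the growth space, are bounded on the real line. -/
theorem exists_bound_rootW_mul (h : Assumptions ρ γ w m T R L pole) {ε : ℂ} {f : ℂ → ℂ}
    (hf : f ∈ growthSpace ρ w ε) : ∃ B, ∀ x : ℝ, ‖rootW w x * f x‖ ≤ B := by
  obtain ⟨hd, -, C, X, hC⟩ := hf
  refine exists_bound_of_continuous (X := X) (C := C + 1) ?_ fun x hx => ?_
  · have := h.continuous_rootW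
    have := hd.continuous
    fun_prop
  · have h1 := hC x (by simpa using hx)
    rw [← h.rootW_sq, norm_mul, ← pow_two, ← mul_pow, ← norm_mul] at h1
    nlinarith [sq_nonneg (‖rootW w x * f x‖ - 1)]

end Assumptions

/-! ### The residue kernel as the outcome of the oscillatory integrals -/

theorem one_div_one_sub_exp (ρ x : ℝ) :
    1 / (1 - Complex.exp (ρ * x)) = -(Complex.exp (-(ρ * x)) * bose ρ x) := by
  rcases eq_or_ne (1 - Complex.exp (-(ρ * x))) 0 with h0 | h0
  · have h1 : Complex.exp (-(ρ * x)) = 1 := (sub_eq_zero.1 h0).symm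
    have h2 : Complex.exp (ρ * x) = 1 := by
      rw [← neg_neg (ρ * x : ℂ), Complex.exp_neg, h1, inv_one]
    simp [bose, h1, h2]
  · have h1 : Complex.exp (ρ * x : ℂ) = (Complex.exp (-(ρ * x)))⁻¹ := by
      rw [← Complex.exp_neg, neg_neg]
    have h2 := Complex.exp_ne_zero (-(ρ * x : ℂ))
    rw [bose, h1]
    have h3 : 1 - (Complex.exp (-(ρ * x : ℂ)))⁻¹ = -(1 - Complex.exp (-(ρ * x))) /
        Complex.exp (-(ρ * x)) := by
      field_simp
      ring
    rw [h3]
    field_simp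

/-- The part `ν' = σν` of the residue kernel. -/
noncomputable def partialKernel (ρ : ℝ) (m : ℤˣ → ℂ → ℝ → ℂ) (p : ℂ) (α σ : ℤˣ)
    (q : ℝ × ℝ) : ℂ :=
  ∑ ν : ℤˣ, Complex.exp (Complex.I * p * (sgn ν * q.1 - sgn (σ * ν) * q.2)) /
    (1 - Complex.exp (ρ * (sgn (σ * ν) * q.2 - sgn ν * q.1))) *
      coeffM m α (σ * α) (sgn ν * p) q.1 q.2

theorem sum_units (f : ℤˣ → ℂ) : ∑ τ : ℤˣ, f τ = f 1 + f (-1) := by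
  rw [UnitsInt.univ, Finset.sum_pair (by decide)]

theorem sum_partialKernel (ρ : ℝ) (m : ℤˣ → ℂ → ℝ → ℂ) (p : ℂ) (δ δ' : ℤˣ) (k k' : ℝ) :
    ∑ σ : ℤˣ, partialKernel ρ m p (δ * δ') σ (k, k') = residueKernel ρ m p δ δ' k k' := by
  unfold partialKernel residueKernel
  rw [Finset.sum_comm]
  refine Finset.sum_congr rfl fun ν _ => ?_
  refine Fintype.sum_equiv (Equiv.mulRight ν) _ _ fun σ => ?_
  have h1 : δ * δ' * ν * (σ * ν) = σ * (δ * δ') := by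
    have := Int.units_mul_self ν
    calc _ = σ * (δ * δ') * (ν * ν) := by
          simp only [mul_comm, mul_left_comm]
      _ = _ := by rw [this, mul_one]
  simp only [Equiv.coe_mulRight, h1]

/-- The sign `σ` as a real number. -/
def rsgn (σ : ℤˣ) : ℝ := ((σ : ℤ) : ℝ)

/-- The term `ν = +` belongs to the pole `p`, the term `ν = -` to the reflected pole `iρ - p`. With
`x = k - σk'`, one has `1/(1 - e^{ρx}) = -e^{-ρx}/(1 - e^{-ρx})`, and the factor `e^{-ρx}` turns
`e^{-ipx}` into `e^{i(iρ-p)x}`. -/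
theorem partialKernel_eq (ρ : ℝ) (m : ℤˣ → ℂ → ℝ → ℂ) (p : ℂ) (α σ : ℤˣ) (q : ℝ × ℝ) :
    partialKernel ρ m p α σ q =
      coeffM m α (σ * α) p q.1 q.2 * (Complex.exp (Complex.I * p *
        ((q.1 - rsgn σ * q.2 : ℝ) : ℂ)) * bose ρ (q.1 - rsgn σ * q.2)) -
      coeffM m α (σ * α) (-p) q.1 q.2 * (Complex.exp (Complex.I * (Complex.I * ρ - p) *
        ((q.1 - rsgn σ * q.2 : ℝ) : ℂ)) * bose ρ (q.1 - rsgn σ * q.2)) := by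
  have hs : sgn (σ * 1) = ((rsgn σ : ℝ) : ℂ) := by simp [sgn, rsgn]
  have hs' : sgn (σ * -1) = -((rsgn σ : ℝ) : ℂ) := by simp [sgn, rsgn]
  have h1 : sgn 1 = 1 := by simp [sgn]
  have h2 : sgn (-1) = -1 := by simp [sgn]
  rw [partialKernel, sum_units, hs, hs', h1, h2]
  set x : ℝ := q.1 - rsgn σ * q.2 with hx
  have e1 : (1 * (q.1 : ℂ) - (rsgn σ : ℂ) * q.2) = x := by rw [hx]; push_cast; ring
  have e2 : ((rsgn σ : ℂ) * q.2 - 1 * q.1) = -x := by rw [hx]; push_cast; ring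
  have e3 : (-1 * (q.1 : ℂ) - -(rsgn σ : ℂ) * q.2) = -x := by rw [hx]; push_cast; ring
  have e4 : (-(rsgn σ : ℂ) * q.2 - -1 * q.1) = x := by rw [hx]; push_cast; ring
  rw [e1, e2, e3, e4, one_mul, neg_one_mul, div_eq_mul_one_div _ (1 - Complex.exp (ρ * (x : ℂ))),
    one_div_one_sub_exp, mul_neg (ρ : ℂ)]
  have e5 : Complex.exp (Complex.I * (Complex.I * ρ - p) * x) =
      Complex.exp (Complex.I * p * -x) * Complex.exp (-(ρ * x)) := by
    rw [← Complex.exp_add]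
    congr 1
    linear_combination (ρ * x : ℂ) * Complex.I_sq
  rw [e5, bose]
  ring

namespace Assumptions

variable {ρ γ : ℝ} {w : ℂ → ℂ} {m : ℤˣ → ℂ → ℝ → ℂ} {T R : ℝ → ℂ} {L : ℕ} {pole : Fin L → ℂ}

theorem reflect_im (h : Assumptions ρ γ w m T R L pole) (j : Fin L) :
    0 < (Complex.I * ρ - pole j).im ∧ (Complex.I * ρ - pole j).im < ρ :=
  h.allPoles_im (Sum.inr j)

/-- The two reflected poles must be treated together: separately their kernels are singular on `k =
k'`. -/
theorem integral_pole_pair (h : Assumptions ρ γ w m T R L pole) {V : ℝ × ℝ → ℂ}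
    (hV : ContDiff ℝ ∞ V) (hc : HasCompactSupport V) (hpos : ∀ k k', V (k, k') ≠ 0 → 0 < k ∧ 0 < k')
    (α σ : ℤˣ) (j : Fin L) :
    Integrable (fun q => V q * partialKernel ρ m (pole j) α σ q) ∧
    ((∫ r : ℝ, pole1 ρ (pole j) r * ∫ q : ℝ × ℝ, V q * coeffM m α (σ * α) (pole j) q.1 q.2 *
        Complex.exp (Complex.I * r * ((q.1 - rsgn σ * q.2 : ℝ) : ℂ))) -
      ∫ r : ℝ, pole1 ρ (Complex.I * ρ - pole j) r *
        ∫ q : ℝ × ℝ, V q * coeffM m α (σ * α) (-pole j) q.1 q.2 *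
        Complex.exp (Complex.I * r * ((q.1 - rsgn σ * q.2 : ℝ) : ℂ))) =
      2 * Real.pi * Complex.I * ∫ q, V q * partialKernel ρ m (pole j) α σ q := by
  have hM := fun z => h.contDiff_coeffM α (σ * α) z
  let p : Bool → ℂ := fun b => if b then pole j else Complex.I * ρ - pole j
  let U : Bool → ℝ × ℝ → ℂ := fun b q => if b then V q * coeffM m α (σ * α) (pole j) q.1 q.2
    else V q * -coeffM m α (σ * α) (-pole j) q.1 q.2
  have hU : ∀ b, ContDiff ℝ ∞ (U b) := by
    rintro (_ | _)
    · exact hV.mul (hM _).neg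
    · exact hV.mul (hM _)
  have hUc : ∀ b, HasCompactSupport (U b) := by
    rintro (_ | _)
    · exact hc.mul_right
    · exact hc.mul_right
  have hp : ∀ b, 0 < (p b).im ∧ (p b).im < ρ := by
    rintro (_ | _)
    · exact h.reflect_im j
    · exact h.allPoles_im (Sum.inl j)
  -- The residues cancel on `k = σk'`: for `σ = 1` by the evenness of `M^α_α` on the diagonal, for
  -- `σ = -1` because `V` is supported where `k` and `k'` are positive.
  have h0 : ∀ y : ℝ, ∑ b, U b (rsgn σ * y, y) = 0 := by
    intro y
    rw [Fintype.sum_bool]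
    simp only [U, if_true, Bool.false_eq_true, if_false]
    rcases Int.units_eq_one_or σ with rfl | rfl
    · have : rsgn 1 * y = y := by simp [rsgn]
      rw [this, one_mul, h.coeffM_neg_diag]
      ring
    · have : V (rsgn (-1) * y, y) = 0 := by
        by_contra hne
        have := hpos _ _ hne
        simp only [rsgn] at this
        norm_num at this
        linarith
      rw [this]
      ring
  obtain ⟨hint, heq⟩ := integral_sum_pole1 h.rho_pos hp hU hUc (rsgn σ) h0
  have hfun : ∀ q : ℝ × ℝ, ∑ b, U b q * (2 * Real.pi * Complex.I *
      Complex.exp (Complex.I * p b * ((q.1 - rsgn σ * q.2 : ℝ) : ℂ)) * bose ρ (q.1 - rsgn σ * q.2)) =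
      2 * Real.pi * Complex.I * (V q * partialKernel ρ m (pole j) α σ q) := by
    intro q
    rw [Fintype.sum_bool, partialKernel_eq]
    simp only [U, p, if_true, Bool.false_eq_true, if_false]
    ring
  simp_rw [hfun] at hint heq
  have hc0 : (2 * Real.pi * Complex.I : ℂ) ≠ 0 := Complex.two_pi_I_ne_zero
  refine ⟨(integrable_const_mul_iff (Ne.isUnit hc0) _).1 hint, ?_⟩
  rw [integral_const_mul, Fintype.sum_bool] at heq
  rw [← heq]
  simp only [U, p, if_true, Bool.false_eq_true, if_false, neg_mul, integral_neg, mul_neg]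
  rw [sub_eq_add_neg]

/-- Inserting the partial fractions of `w M` splits the integral. The constant term gives `2π` times
the value at `0` of the density of `V A` along `k - σk'`, which is the delta function on `k = σk'`.
The poles give the residue kernel. -/
theorem integral_oscillatory (h : Assumptions ρ γ w m T R L pole) {V : ℝ × ℝ → ℂ}
    (hV : ContDiff ℝ ∞ V) (hc : HasCompactSupport V) (hpos : ∀ k k', V (k, k') ≠ 0 → 0 < k ∧ 0 < k')
    (α σ : ℤˣ) :
    ∫ r : ℝ, w r * ∫ q : ℝ × ℝ, V q * coeffM m α (σ * α) r q.1 q.2 *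
        Complex.exp (Complex.I * r * ((q.1 - rsgn σ * q.2 : ℝ) : ℂ)) =
      (if σ = 1 then if α = 1 then 2 * Real.pi * ∫ y : ℝ, V (y, y) else 0 else 0) +
      2 * Real.pi * Complex.I * ∑ j, simpleResidue w (pole j) *
        ∫ q, V q * partialKernel ρ m (pole j) α σ q := by
  obtain ⟨A, hA, hpf, hA1⟩ := h.partial_fractions α (σ * α)
  have hM := fun z => h.contDiff_coeffM α (σ * α) z
  have hVA : ContDiff ℝ ∞ fun q => V q * A q := hV.mul hA
  have hVAc : HasCompactSupport fun q => V q * A q := hc.mul_right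
  have hVM : ∀ z, ContDiff ℝ ∞ fun q : ℝ × ℝ => V q * coeffM m α (σ * α) z q.1 q.2 :=
    fun z => hV.mul (hM z)
  have hVMc : ∀ z, HasCompactSupport fun q : ℝ × ℝ => V q * coeffM m α (σ * α) z q.1 q.2 :=
    fun z => hc.mul_right
  have hosc : ∀ {U : ℝ × ℝ → ℂ}, ContDiff ℝ ∞ U → HasCompactSupport U → ∀ r : ℝ,
      Integrable fun q : ℝ × ℝ =>
        U q * Complex.exp (Complex.I * r * ((q.1 - rsgn σ * q.2 : ℝ) : ℂ)) :=
    fun hU hUc r => integrable_mul_continuous hU.continuous hUc (by fun_prop)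
  have hpoint : ∀ r : ℝ, w r * ∫ q : ℝ × ℝ, V q * coeffM m α (σ * α) r q.1 q.2 *
        Complex.exp (Complex.I * r * ((q.1 - rsgn σ * q.2 : ℝ) : ℂ)) =
      ft (push (rsgn σ) fun q => V q * A q) r + ∑ j, simpleResidue w (pole j) *
        (pole1 ρ (pole j) r * (∫ q : ℝ × ℝ, V q * coeffM m α (σ * α) (pole j) q.1 q.2 *
          Complex.exp (Complex.I * r * ((q.1 - rsgn σ * q.2 : ℝ) : ℂ))) -
        pole1 ρ (Complex.I * ρ - pole j) r *
          ∫ q : ℝ × ℝ, V q * coeffM m α (σ * α) (-pole j) q.1 q.2 *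
          Complex.exp (Complex.I * r * ((q.1 - rsgn σ * q.2 : ℝ) : ℂ))) := by
    intro r
    rw [ft_push _ hVA.continuous hVAc, ← integral_const_mul]
    simp_rw [← integral_const_mul]
    have hs : ∀ j ∈ (Finset.univ : Finset (Fin L)), Integrable fun q : ℝ × ℝ =>
        simpleResidue w (pole j) *
        (pole1 ρ (pole j) r * (V q * coeffM m α (σ * α) (pole j) q.1 q.2 *
          Complex.exp (Complex.I * r * ((q.1 - rsgn σ * q.2 : ℝ) : ℂ))) -
        pole1 ρ (Complex.I * ρ - pole j) r *
          (V q * coeffM m α (σ * α) (-pole j) q.1 q.2 *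
          Complex.exp (Complex.I * r * ((q.1 - rsgn σ * q.2 : ℝ) : ℂ)))) := fun j _ =>
      (((hosc (hVM _) (hVMc _) r).const_mul _).sub
        ((hosc (hVM _) (hVMc _) r).const_mul _)).const_mul _
    have hsum : ∀ j, simpleResidue w (pole j) *
        ((∫ q : ℝ × ℝ, pole1 ρ (pole j) r * (V q * coeffM m α (σ * α) (pole j) q.1 q.2 *
          Complex.exp (Complex.I * r * ((q.1 - rsgn σ * q.2 : ℝ) : ℂ)))) -
        ∫ q : ℝ × ℝ, pole1 ρ (Complex.I * ρ - pole j) r *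
          (V q * coeffM m α (σ * α) (-pole j) q.1 q.2 *
          Complex.exp (Complex.I * r * ((q.1 - rsgn σ * q.2 : ℝ) : ℂ)))) =
        ∫ q : ℝ × ℝ, simpleResidue w (pole j) *
        (pole1 ρ (pole j) r * (V q * coeffM m α (σ * α) (pole j) q.1 q.2 *
          Complex.exp (Complex.I * r * ((q.1 - rsgn σ * q.2 : ℝ) : ℂ))) -
        pole1 ρ (Complex.I * ρ - pole j) r *
          (V q * coeffM m α (σ * α) (-pole j) q.1 q.2 *
          Complex.exp (Complex.I * r * ((q.1 - rsgn σ * q.2 : ℝ) : ℂ)))) := by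
      intro j
      rw [integral_const_mul (simpleResidue w (pole j)), integral_sub ((hosc (hVM _) (hVMc _) r).const_mul _)
        ((hosc (hVM _) (hVMc _) r).const_mul _)]
    simp_rw [hsum]
    rw [← integral_finsetSum _ hs, ← integral_add (hosc hVA hVAc r) (integrable_finsetSum _ hs)]
    congr 1 with q
    have := hpf q.1 q.2 r
    calc _ = V q * Complex.exp (Complex.I * r * ((q.1 - rsgn σ * q.2 : ℝ) : ℂ)) *
          (w r * coeffM m α (σ * α) r q.1 q.2) := by ring
      _ = _ := by
        rw [this, mul_add, Finset.mul_sum]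
        congr 1
        · ring
        · exact Finset.sum_congr rfl fun j _ => by ring
  simp_rw [hpoint]
  have hI : ∀ {p : ℂ}, 0 < p.im → p.im < ρ → ∀ z, Integrable fun r : ℝ => pole1 ρ p r *
      ∫ q : ℝ × ℝ, V q * coeffM m α (σ * α) z q.1 q.2 *
        Complex.exp (Complex.I * r * ((q.1 - rsgn σ * q.2 : ℝ) : ℂ)) := by
    intro p hp hp' z
    simp_rw [← ft_push (rsgn σ) (hVM z).continuous (hVMc z)]
    exact (isTest_push _ (hVM z) (hVMc z)).integrable_pole1_mul_ft_real hp hp'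
  have hj : ∀ j, Integrable fun r : ℝ => simpleResidue w (pole j) *
        (pole1 ρ (pole j) r * (∫ q : ℝ × ℝ, V q * coeffM m α (σ * α) (pole j) q.1 q.2 *
          Complex.exp (Complex.I * r * ((q.1 - rsgn σ * q.2 : ℝ) : ℂ))) -
        pole1 ρ (Complex.I * ρ - pole j) r *
          ∫ q : ℝ × ℝ, V q * coeffM m α (σ * α) (-pole j) q.1 q.2 *
          Complex.exp (Complex.I * r * ((q.1 - rsgn σ * q.2 : ℝ) : ℂ))) := fun j =>
    ((hI (h.pole_im j).1 (h.pole_im j).2 _).sub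
      (hI (h.reflect_im j).1 (h.reflect_im j).2 _)).const_mul _
  have hT := isTest_push (rsgn σ) hVA hVAc
  rw [integral_add hT.integrable_ft (integrable_finsetSum _ fun j _ => hj j),
    integral_finsetSum _ fun j _ => hj j, hT.integral_ft]
  congr 1
  · rcases Int.units_eq_one_or σ with rfl | rfl
    · have h1 : ∀ y : ℝ, A (y, y) = if α = 1 then 1 else 0 := fun y => hA1 (one_mul α) y y
      simp only [push, rsgn, if_true]
      simp only [Units.val_one, Int.cast_one, one_mul, zero_add, h1]
      split_ifs <;> simp
    · have h1 : ∀ y : ℝ, V (0 + rsgn (-1) * y, y) = 0 := by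
        intro y
        by_contra hne
        have := hpos _ _ hne
        simp only [rsgn] at this
        norm_num at this
        linarith
      simp only [push, h1, zero_mul, integral_zero, mul_zero]
      rw [if_neg (by decide)]
  · rw [Finset.mul_sum]
    refine Finset.sum_congr rfl fun j _ => ?_
    rw [integral_const_mul, integral_sub (hI (h.pole_im j).1 (h.pole_im j).2 _)
      (hI (h.reflect_im j).1 (h.reflect_im j).2 _),
      (h.integral_pole_pair hV hc hpos α σ j).2]
    ring

end Assumptions

/-! ### Decay of plane wave integrals, and the transform in `L²` -/

theorem memLp_two_of_norm_le {f : ℝ → ℂ} (hf : Continuous f) {C : ℝ}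
    (h : ∀ x, ‖f x‖ ≤ C * (1 + x ^ 2)⁻¹) : MemLp f 2 := by
  rw [memLp_two_iff_integrable_sq_norm hf.aestronglyMeasurable]
  refine (integrable_inv_one_add_sq.const_mul (C ^ 2)).mono'
    (hf.norm.pow 2).aestronglyMeasurable (Eventually.of_forall fun x => ?_)
  rw [Real.norm_of_nonneg (by positivity)]
  have h1 : (1 + x ^ 2)⁻¹ ≤ 1 := inv_le_one_of_one_le₀ (by nlinarith [sq_nonneg x])
  have h2 : 0 ≤ (1 + x ^ 2)⁻¹ := by positivity
  calc ‖f x‖ ^ 2 ≤ (C * (1 + x ^ 2)⁻¹) ^ 2 := by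
        gcongr
        exact h x
    _ = C ^ 2 * ((1 + x ^ 2)⁻¹ * (1 + x ^ 2)⁻¹) := by ring
    _ ≤ C ^ 2 * (1 * (1 + x ^ 2)⁻¹) := by gcongr
    _ = _ := by rw [one_mul]

/-- Continuous functions of decay `O(r^{-2})`. -/
def RapidDecay (f : ℝ → ℂ) : Prop := Continuous f ∧ ∃ C, ∀ x, ‖f x‖ ≤ C * (1 + x ^ 2)⁻¹

theorem RapidDecay.memLp {f : ℝ → ℂ} (h : RapidDecay f) : MemLp f 2 := by
  obtain ⟨hc, C, hC⟩ := h
  exact memLp_two_of_norm_le hc hC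

theorem RapidDecay.sum {ι : Type*} {s : Finset ι} {f : ι → ℝ → ℂ} (h : ∀ i ∈ s, RapidDecay (f i)) :
    RapidDecay fun x => ∑ i ∈ s, f i x := by
  refine ⟨continuous_finsetSum _ fun i hi => (h i hi).1, ?_⟩
  choose! C hC using fun i hi => (h i hi).2
  refine ⟨∑ i ∈ s, C i, fun x => ?_⟩
  rw [Finset.sum_mul]
  exact norm_sum_le_of_le _ fun i hi => hC i hi x

theorem RapidDecay.bdd_mul {f g : ℝ → ℂ} (h : RapidDecay f) (hg : Continuous g) {B : ℝ}
    (hB : ∀ x, ‖g x‖ ≤ B) : RapidDecay fun x => g x * f x := by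
  obtain ⟨hc, C, hC⟩ := h
  refine ⟨hg.mul hc, B * C, fun x => ?_⟩
  rw [norm_mul, mul_assoc]
  have := (norm_nonneg _).trans (hB x)
  gcongr
  · exact hB x
  · exact hC x

theorem RapidDecay.integrable_mul {f g : ℝ → ℂ} (hf : RapidDecay f) (hg : RapidDecay g) :
    Integrable fun x => f x * g x :=
  hf.memLp.integrable_mul hg.memLp

theorem sgn_sq (σ : ℤˣ) : sgn σ * sgn σ = 1 := by
  rcases Int.units_eq_one_or σ with rfl | rfl <;> simp [sgn]

theorem sgn_mul (σ τ : ℤˣ) : sgn (σ * τ) = sgn σ * sgn τ := by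
  simp [sgn]

theorem sgn_eq_rsgn (σ : ℤˣ) : sgn σ = (rsgn σ : ℂ) := by
  simp [sgn, rsgn]

theorem sgn_neg (σ : ℤˣ) : sgn (-σ) = -sgn σ := by
  simp [sgn]

theorem rsgn_sq (σ : ℤˣ) : rsgn σ ^ 2 = 1 := by
  rcases Int.units_eq_one_or σ with rfl | rfl <;> simp [rsgn]

/-- A single plane wave integral `w^{1/2}(r) ∫ n(δr, k) u(k) e^{iκrk} dk`. -/
noncomputable def osc (w : ℂ → ℂ) (n : ℂ → ℝ → ℂ) (u : ℝ → ℂ) (δ κ : ℤˣ) (r : ℝ) : ℂ :=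
  Assumptions.rootW w r *
    ∫ k : ℝ, n (sgn δ * r) k * u k * Complex.exp (Complex.I * sgn κ * r * k)

theorem continuous_osc_integrand {n : ℂ → ℝ → ℂ} (hn : ∀ z, Continuous (n z)) {u : ℝ → ℂ}
    (hu : IsTest u) (z : ℂ) (z' : ℂ) :
    Integrable fun k : ℝ => n z k * u k * Complex.exp (Complex.I * z' * k) := by
  have hc : Continuous fun k : ℝ => n z k * u k := (hn z).mul hu.continuous
  exact integrable_mul_continuous hc hu.2.mul_left (by fun_prop)

theorem IsTest.rapidDecay_ft {u : ℝ → ℂ} (hu : IsTest u) (κ : ℤˣ) :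
    RapidDecay fun r : ℝ => ft u (sgn κ * r) := by
  obtain ⟨C, -, hC⟩ := hu.exists_norm_ft_le_sq 0
  refine ⟨hu.differentiable_ft.continuous.comp (by fun_prop), C, fun r => ?_⟩
  have := hC (sgn κ * r) (by rw [sgn_eq_rsgn]; simp)
  have h2 : (sgn κ * r).re ^ 2 = r ^ 2 := by
    rw [sgn_eq_rsgn, ← Complex.ofReal_mul, Complex.ofReal_re, mul_pow, rsgn_sq, one_mul]
  rwa [h2] at this

namespace Assumptions

variable {ρ γ : ℝ} {w : ℂ → ℂ} {m : ℤˣ → ℂ → ℝ → ℂ} {T R : ℝ → ℂ} {L : ℕ} {pole : Fin L → ℂ}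

/-- The finite expansion separates `r` from `k`: what remains is a finite sum of functions `w^{1/2}
e_i`, bounded on the real line, times Fourier transforms of test functions. -/
theorem rapidDecay_osc (h : Assumptions ρ γ w m T R L pole) {N : ℕ} {ε : ℂ} {e : Fin N → ℂ → ℂ}
    (he : ∀ i, e i ∈ growthSpace ρ w ε) {n : ℂ → ℝ → ℂ} {c : Fin N → ℝ → ℂ}
    (hc : ∀ i, ContDiff ℝ ∞ (c i)) (hn : ∀ z k, n z k = ∑ i, c i k * e i z) {u : ℝ → ℂ}
    (hu : IsTest u) (δ κ : ℤˣ) : RapidDecay (osc w n u δ κ) := by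
  have hcu : ∀ i, IsTest fun k => c i k * u k := fun i => hu.mul_left (hc i)
  have hrw : osc w n u δ κ = fun r : ℝ => ∑ i, (rootW w r * e i (sgn δ * r)) *
      ft (fun k => c i k * u k) (sgn κ * r) := by
    ext r
    have h1 : ∀ k : ℝ, n (sgn δ * r) k * u k * Complex.exp (Complex.I * sgn κ * r * k) =
        ∑ i, e i (sgn δ * r) * (c i k * u k * Complex.exp (Complex.I * (sgn κ * r) * k)) := by
      intro k
      rw [hn, Finset.sum_mul, Finset.sum_mul]
      refine Finset.sum_congr rfl fun i _ => ?_
      rw [← mul_assoc Complex.I]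
      ring
    rw [osc]
    simp_rw [h1]
    rw [integral_finsetSum, Finset.mul_sum]
    · refine Finset.sum_congr rfl fun i _ => ?_
      rw [integral_const_mul, ft]
      ring
    · intro i _
      exact ((hcu i).integrable_mul (continuous_exp_mul _)).const_mul _
  rw [hrw]
  refine RapidDecay.sum fun i _ => ?_
  obtain ⟨B, hB⟩ := h.exists_bound_rootW_mul (he i)
  refine ((hcu i).rapidDecay_ft κ).bdd_mul (B := B) ?_ fun x => ?_
  · have := h.continuous_rootW
    have := (he i).1.continuous
    fun_prop
  · have h2 := hB (rsgn δ * x)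
    have h3 : rootW w (rsgn δ * x) = rootW w x := by
      rcases Int.units_eq_one_or δ with rfl | rfl
      · simp [rsgn]
      · simpa [rsgn] using h.rootW_neg x
    rw [h3] at h2
    rw [sgn_eq_rsgn]
    simpa using h2

theorem rapidDecay_osc_coeff (h : Assumptions ρ γ w m T R L pole) (τ : ℤˣ) {u : ℝ → ℂ}
    (hu : IsTest u) (δ κ : ℤˣ) : RapidDecay (osc w (m τ) u δ κ) := by
  obtain ⟨ε, hε, hm⟩ := h.exists_sign
  obtain ⟨e, he, hexp⟩ := h.exists_expansion hε hm
  exact h.rapidDecay_osc he (fun i => h.contDiff_coeff τ _) (hexp τ) hu δ κ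

theorem rapidDecay_osc_coeff_neg (h : Assumptions ρ γ w m T R L pole) (τ : ℤˣ) {u : ℝ → ℂ}
    (hu : IsTest u) (δ κ : ℤˣ) : RapidDecay (osc w (fun z k => m τ z (-k)) u δ κ) := by
  obtain ⟨ε, hε, hm⟩ := h.exists_sign
  obtain ⟨e, he, hexp⟩ := h.exists_expansion hε hm
  exact h.rapidDecay_osc he (fun i => (h.contDiff_coeff τ _).comp contDiff_neg)
    (fun z k => hexp τ z (-k)) hu δ κ

theorem osc_rsgn_mul (h : Assumptions ρ γ w m T R L pole) (n : ℂ → ℝ → ℂ) (u : ℝ → ℂ)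
    (δ κ ν : ℤˣ) (r : ℝ) : osc w n u δ κ (rsgn ν * r) = osc w n u (ν * δ) (ν * κ) r := by
  have h3 : rootW w (rsgn ν * r) = rootW w r := by
    rcases Int.units_eq_one_or ν with rfl | rfl
    · simp [rsgn]
    · simpa [rsgn] using h.rootW_neg r
  rw [osc, osc, h3, sgn_mul, sgn_mul, sgn_eq_rsgn ν]
  congr 1
  congr 1 with k
  push_cast
  ring_nf

theorem kernel_eq (h : Assumptions ρ γ w m T R L pole) (δ : ℤˣ) (r k : ℝ) :
    kernel w m δ r k = sgn δ * (rootW w r * ∑ τ : ℤˣ, m τ (sgn δ * r) k *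
      Complex.exp (Complex.I * sgn (τ * δ) * r * k)) := by
  rcases Int.units_eq_one_or δ with rfl | rfl
  · simp [kernel, Psi, rootW, sgn]
  · have hr := h.rootW_neg r
    rw [rootW] at hr
    rw [kernel, if_neg (by decide), Psi, hr]
    simp [sgn]

theorem integral_Ioi_test {u : ℝ → ℂ} (hs : tsupport u ⊆ Set.Ioi 0) (g : ℝ → ℂ) :
    ∫ k in Set.Ioi (0 : ℝ), g k * u k = ∫ k : ℝ, g k * u k := by
  refine setIntegral_eq_integral_of_forall_compl_eq_zero fun x hx => ?_
  rw [image_eq_zero_of_notMem_tsupport fun hx' => hx (hs hx'), mul_zero]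

theorem transform_eq (h : Assumptions ρ γ w m T R L pole) {f : ℤˣ → ℝ → ℂ} (hf : IsTestPair f)
    (r : ℝ) : transform w m f r = (1 / Real.sqrt (2 * Real.pi) : ℝ) *
      ∑ δ : ℤˣ, ∑ τ : ℤˣ, sgn δ * osc w (m τ) (f δ) δ (τ * δ) r := by
  have htest : ∀ δ, IsTest (f δ) := fun δ => ⟨(hf δ).1, (hf δ).2.1⟩
  have hint := fun τ δ => continuous_osc_integrand (n := m τ)
    (fun z => (h.contDiff_coeff τ z).continuous) (htest δ) (sgn δ * r) (sgn (τ * δ) * r)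
  have hpt : ∀ (δ : ℤˣ) (k : ℝ), kernel w m δ r k * f δ k = ∑ τ : ℤˣ, sgn δ * rootW w r *
      (m τ (sgn δ * r) k * f δ k * Complex.exp (Complex.I * (sgn (τ * δ) * r) * k)) := by
    intro δ k
    rw [h.kernel_eq, Finset.mul_sum, Finset.mul_sum, Finset.sum_mul]
    refine Finset.sum_congr rfl fun τ _ => ?_
    rw [← mul_assoc Complex.I]
    ring
  have hi : ∀ δ, Integrable fun k => kernel w m δ r k * f δ k := by
    intro δ
    simp_rw [hpt]
    exact integrable_finsetSum _ fun τ _ => (hint τ δ).const_mul _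
  rw [transform, integral_finsetSum _ fun δ _ => (hi δ).integrableOn]
  congr 1
  refine Finset.sum_congr rfl fun δ _ => ?_
  rw [integral_Ioi_test (hf δ).2.2]
  simp_rw [hpt]
  rw [integral_finsetSum _ fun τ _ => (hint τ δ).const_mul _]
  refine Finset.sum_congr rfl fun τ _ => ?_
  rw [integral_const_mul, osc]
  simp_rw [← mul_assoc Complex.I]
  ring

theorem memLp_transform (h : Assumptions ρ γ w m T R L pole) {f : ℤˣ → ℝ → ℂ}
    (hf : IsTestPair f) : MemLp (transform w m f) 2 := by
  rw [funext (h.transform_eq hf)]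
  refine MemLp.const_mul (RapidDecay.memLp ?_) _
  refine RapidDecay.sum fun δ _ => RapidDecay.sum fun τ _ => ?_
  exact (h.rapidDecay_osc_coeff τ ⟨(hf δ).1, (hf δ).2.1⟩ δ (τ * δ)).bdd_mul continuous_const
    (B := ‖sgn δ‖) fun _ => le_rfl

theorem conj_osc (h : Assumptions ρ γ w m T R L pole) (τ δ κ : ℤˣ) (u : ℝ → ℂ) (r : ℝ) :
    conj (osc w (m τ) u δ κ r) =
      osc w (fun z k => m τ z (-k)) (fun k => conj (u k)) δ (-κ) r := by
  rw [osc, osc, map_mul, ← integral_conj]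
  have h1 : conj (rootW w r) = rootW w r := Complex.conj_ofReal _
  rw [h1]
  congr 1
  congr 1 with k
  have h2 : sgn δ * (r : ℂ) = ((rsgn δ * r : ℝ) : ℂ) := by
    rw [sgn_eq_rsgn]
    push_cast
    rfl
  rw [map_mul, map_mul, h2, h.m_conj, ← Complex.exp_conj, sgn_neg, sgn_eq_rsgn κ]
  simp only [map_mul, Complex.conj_I, Complex.conj_ofReal]
  ring_nf

end Assumptions

/-! ### The inner product of two transforms -/

theorem IsTestPair.isTest_conj {f : ℤˣ → ℝ → ℂ} (hf : IsTestPair f) (δ : ℤˣ) :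
    IsTest fun k => conj (f δ k) := by
  refine ⟨Complex.conjCLE.contDiff.comp (hf δ).1, ?_⟩
  exact (hf δ).2.1.comp_left (g := fun z : ℂ => conj z) (map_zero _)

theorem sgn_mul_conj (δ : ℤˣ) : conj (sgn δ) = sgn δ := by
  rw [sgn_eq_rsgn, Complex.conj_ofReal]

theorem integral_comp_rsgn_mul (ν : ℤˣ) (F : ℝ → ℂ) : ∫ r : ℝ, F (rsgn ν * r) = ∫ r, F r := by
  rcases Int.units_eq_one_or ν with rfl | rfl
  · simp [rsgn]
  · have := integral_neg_eq_self F volume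
    simpa [rsgn] using this

/-- The amplitude `conj f_δ(k) g_δ'(k')` of a pair of test functions. -/
def amp (f g : ℤˣ → ℝ → ℂ) (δ δ' : ℤˣ) (q : ℝ × ℝ) : ℂ := conj (f δ q.1) * g δ' q.2

section amp

variable {f g : ℤˣ → ℝ → ℂ}

theorem contDiff_amp (hf : IsTestPair f) (hg : IsTestPair g) (δ δ' : ℤˣ) :
    ContDiff ℝ ∞ (amp f g δ δ') :=
  ((hf.isTest_conj δ).1.comp contDiff_fst).mul ((hg δ').1.comp contDiff_snd)

theorem hasCompactSupport_amp (hf : IsTestPair f) (hg : IsTestPair g) (δ δ' : ℤˣ) :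
    HasCompactSupport (amp f g δ δ') := by
  refine HasCompactSupport.intro (K := tsupport (f δ) ×ˢ tsupport (g δ'))
    ((hf δ).2.1.isCompact.prod (hg δ').2.1.isCompact) fun q hq => ?_
  rw [Set.mem_prod, not_and_or] at hq
  rcases hq with hq | hq
  · simp [amp, image_eq_zero_of_notMem_tsupport hq]
  · simp [amp, image_eq_zero_of_notMem_tsupport hq]

theorem amp_pos (hf : IsTestPair f) (hg : IsTestPair g) (δ δ' : ℤˣ) (k k' : ℝ)
    (h : amp f g δ δ' (k, k') ≠ 0) : 0 < k ∧ 0 < k' := by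
  have h1 : f δ k ≠ 0 := fun hc => h (by simp [amp, hc])
  have h2 : g δ' k' ≠ 0 := fun hc => h (by simp [amp, hc])
  exact ⟨(hf δ).2.2 (subset_tsupport _ h1), (hg δ').2.2 (subset_tsupport _ h2)⟩

end amp

namespace Assumptions

variable {ρ γ : ℝ} {w : ℂ → ℂ} {m : ℤˣ → ℂ → ℝ → ℂ} {T R : ℝ → ℂ} {L : ℕ} {pole : Fin L → ℂ}
variable {f g : ℤˣ → ℝ → ℂ}

theorem osc_mul_osc (h : Assumptions ρ γ w m T R L pole) {n n' : ℂ → ℝ → ℂ} {u v : ℝ → ℂ}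
    (δ κ δ' κ' : ℤˣ) (r : ℝ) :
    osc w n u δ κ r * osc w n' v δ' κ' r = w r * ∫ q : ℝ × ℝ,
      (n (sgn δ * r) q.1 * u q.1 * Complex.exp (Complex.I * sgn κ * r * q.1)) *
      (n' (sgn δ' * r) q.2 * v q.2 * Complex.exp (Complex.I * sgn κ' * r * q.2)) := by
  rw [osc, osc, ← h.rootW_sq, Measure.volume_eq_prod, integral_prod_mul
    (fun k : ℝ => n (sgn δ * r) k * u k * Complex.exp (Complex.I * sgn κ * r * k))
    (fun k : ℝ => n' (sgn δ' * r) k * v k * Complex.exp (Complex.I * sgn κ' * r * k))]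
  ring

/-- The two terms of `coeffM` are the products with `τ = +` and `τ = -`, once the phase in `k` has
been normalized to `e^{irk}`. -/
theorem sum_osc_mul_osc (h : Assumptions ρ γ w m T R L pole) (hf : IsTestPair f)
    (hg : IsTestPair g) (δ δ' σ : ℤˣ) (r : ℝ) :
    ∑ τ : ℤˣ, osc w (fun z k => m τ z (-k)) (fun k => conj (f δ k)) (-τ) 1 r *
        osc w (m (σ * (δ * δ') * τ)) (g δ') (-(τ * (δ * δ'))) (-σ) r =
      w r * ∫ q : ℝ × ℝ, amp f g δ δ' q * coeffM m (δ * δ') (σ * (δ * δ')) r q.1 q.2 *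
        Complex.exp (Complex.I * r * ((q.1 - rsgn σ * q.2 : ℝ) : ℂ)) := by
  simp_rw [h.osc_mul_osc]
  rw [← Finset.mul_sum, ← integral_finsetSum]
  · congr 1
    congr 1 with q
    rw [sum_units]
    have e1 : Complex.exp (Complex.I * r * ((q.1 - rsgn σ * q.2 : ℝ) : ℂ)) =
        Complex.exp (Complex.I * sgn 1 * r * q.1) * Complex.exp (Complex.I * sgn (-σ) * r * q.2) := by
      rw [← Complex.exp_add, sgn_neg, sgn_eq_rsgn σ]
      congr 1
      simp only [sgn, Units.val_one, Int.cast_one]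
      push_cast
      ring
    have e2 : sgn (-1) = -1 := by simp [sgn]
    have e3 : sgn (- -1) = 1 := by simp [sgn]
    have e4 : sgn (-(1 * (δ * δ'))) = -sgn (δ * δ') := by rw [one_mul, sgn_neg]
    have e5 : sgn (-(-1 * (δ * δ'))) = sgn (δ * δ') := by rw [neg_one_mul, neg_neg]
    rw [e1, e2, e3, e4, e5, coeffM, amp, mul_one, mul_neg_one]
    simp only [neg_mul, one_mul]
    ring
  · intro τ _
    have i1 := continuous_osc_integrand (n := fun z k => m τ z (-k))
      (fun z => ((h.contDiff_coeff τ z).comp contDiff_neg).continuous) (hf.isTest_conj δ)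
      (sgn (-τ) * r) (sgn 1 * r)
    have i2 := continuous_osc_integrand (n := m (σ * (δ * δ') * τ))
      (fun z => (h.contDiff_coeff _ z).continuous) (u := g δ') ⟨(hg δ').1, (hg δ').2.1⟩
      (sgn (-(τ * (δ * δ'))) * r) (sgn (-σ) * r)
    simp_rw [← mul_assoc Complex.I] at i1 i2
    exact i1.mul_prod i2

/-- The inner product of two transforms as a sum of oscillatory integrals. -/
theorem inner₁_transform (h : Assumptions ρ γ w m T R L pole) (hf : IsTestPair f)
    (hg : IsTestPair g) :
    inner₁ (transform w m f) (transform w m g) = 1 / (2 * Real.pi) *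
      ∑ δ : ℤˣ, ∑ δ' : ℤˣ, sgn δ * sgn δ' * ∑ σ : ℤˣ, ∫ r : ℝ, w r * ∫ q : ℝ × ℝ,
        amp f g δ δ' q * coeffM m (δ * δ') (σ * (δ * δ')) r q.1 q.2 *
        Complex.exp (Complex.I * r * ((q.1 - rsgn σ * q.2 : ℝ) : ℂ)) := by
  let a : ℤˣ → ℤˣ → ℝ → ℂ := fun δ τ =>
    osc w (fun z k => m τ z (-k)) (fun k => conj (f δ k)) δ (-(τ * δ))
  let b : ℤˣ → ℤˣ → ℝ → ℂ := fun δ τ => osc w (m τ) (g δ) δ (τ * δ)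
  have ha : ∀ δ τ, RapidDecay (a δ τ) := fun δ τ =>
    h.rapidDecay_osc_coeff_neg τ (hf.isTest_conj δ) _ _
  have hb : ∀ δ τ, RapidDecay (b δ τ) := fun δ τ =>
    h.rapidDecay_osc_coeff τ ⟨(hg δ).1, (hg δ).2.1⟩ _ _
  have hsqrt : (((1 / Real.sqrt (2 * Real.pi) : ℝ)) : ℂ) * ((1 / Real.sqrt (2 * Real.pi) : ℝ) : ℂ) =
      1 / (2 * Real.pi) := by
    rw [← Complex.ofReal_mul, div_mul_div_comm, one_mul, Real.mul_self_sqrt (by positivity)]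
    push_cast
    rfl
  have hpt : ∀ r, conj (transform w m f r) * transform w m g r = 1 / (2 * Real.pi) *
      ∑ δ : ℤˣ, ∑ δ' : ℤˣ, sgn δ * sgn δ' * ∑ τ : ℤˣ, ∑ τ' : ℤˣ, a δ τ r * b δ' τ' r := by
    intro r
    rw [h.transform_eq hf, h.transform_eq hg, map_mul, Complex.conj_ofReal, ← hsqrt]
    simp_rw [map_sum, map_mul, sgn_mul_conj, h.conj_osc]
    rw [mul_mul_mul_comm, Finset.sum_mul_sum]
    congr 1
    refine Finset.sum_congr rfl fun δ _ => Finset.sum_congr rfl fun δ' _ => ?_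
    rw [Finset.sum_mul_sum, Finset.mul_sum]
    refine Finset.sum_congr rfl fun τ _ => ?_
    rw [Finset.mul_sum]
    refine Finset.sum_congr rfl fun τ' _ => ?_
    simp only [a, b]
    ring
  have hi : ∀ δ τ δ' τ', Integrable fun r => a δ τ r * b δ' τ' r := fun δ τ δ' τ' =>
    (ha δ τ).integrable_mul (hb δ' τ')
  rw [inner₁]
  simp_rw [hpt]
  rw [integral_const_mul, integral_finsetSum]
  swap
  · exact fun δ _ => integrable_finsetSum _ fun δ' _ => (integrable_finsetSum _ fun τ _ =>
      integrable_finsetSum _ fun τ' _ => hi δ τ δ' τ').const_mul _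
  congr 1
  refine Finset.sum_congr rfl fun δ _ => ?_
  rw [integral_finsetSum]
  swap
  · exact fun δ' _ => (integrable_finsetSum _ fun τ _ =>
      integrable_finsetSum _ fun τ' _ => hi δ τ δ' τ').const_mul _
  refine Finset.sum_congr rfl fun δ' _ => ?_
  rw [integral_const_mul]
  congr 1
  simp_rw [← h.sum_osc_mul_osc hf hg]
  -- The substitution `r → -τδ r` makes the phase in `k` equal to `e^{irk}`. It changes only signs,
  -- since `w^{1/2}` is even.
  have hterm : ∀ τ τ', ∫ r, a δ τ r * b δ' τ' r = ∫ r,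
      osc w (fun z k => m τ z (-k)) (fun k => conj (f δ k)) (-τ) 1 r *
        osc w (m τ') (g δ') (-(τ * (δ * δ'))) (-(τ * τ' * (δ * δ'))) r := by
    intro τ τ'
    rw [← integral_comp_rsgn_mul (-(τ * δ))]
    simp only [a, b, h.osc_rsgn_mul]
    have e1 : -(τ * δ) * δ = -τ := by
      rw [neg_mul, mul_assoc, Int.units_mul_self, mul_one]
    have e2 : -(τ * δ) * -(τ * δ) = 1 := Int.units_mul_self _
    have e3 : -(τ * δ) * δ' = -(τ * (δ * δ')) := by rw [neg_mul, mul_assoc]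
    have e4 : -(τ * δ) * (τ' * δ') = -(τ * τ' * (δ * δ')) := by
      rw [neg_mul, mul_mul_mul_comm]
    rw [e1, e2, e3, e4]
  -- The remaining sign `τ'` is replaced by the relative sign `σ = ττ'δδ'` of the two phases. Then
  -- both values of `τ` share the factor `e^{ir(k-σk')}`.
  have hre : ∀ τ, ∑ τ' : ℤˣ, (∫ r, a δ τ r * b δ' τ' r) = ∑ σ : ℤˣ, ∫ r,
      osc w (fun z k => m τ z (-k)) (fun k => conj (f δ k)) (-τ) 1 r *
        osc w (m (σ * (δ * δ') * τ)) (g δ') (-(τ * (δ * δ'))) (-σ) r := by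
    intro τ
    refine Fintype.sum_equiv (Equiv.mulRight (τ * (δ * δ'))) _ _ fun τ' => ?_
    rw [hterm]
    have e1 : τ' * (τ * (δ * δ')) * (δ * δ') * τ = τ' := by
      have h1 := Int.units_mul_self τ
      have h2 := Int.units_mul_self (δ * δ')
      calc _ = τ' * (τ * τ) * ((δ * δ') * (δ * δ')) := by
            simp only [mul_comm, mul_left_comm]
        _ = τ' := by rw [h1, h2, mul_one, mul_one]
    have e2 : τ' * (τ * (δ * δ')) = τ * τ' * (δ * δ') := by
      rw [← mul_assoc, mul_comm τ' τ]
    simp only [Equiv.coe_mulRight]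
    rw [e1, e2]
  rw [integral_finsetSum _ fun τ _ => integrable_finsetSum _ fun τ' _ => hi δ τ δ' τ']
  simp_rw [integral_finsetSum _ fun τ' _ => hi δ _ δ' τ', hre]
  rw [Finset.sum_comm]
  refine Finset.sum_congr rfl fun σ _ => ?_
  rw [integral_finsetSum]
  intro τ _
  exact (h.rapidDecay_osc_coeff_neg τ (hf.isTest_conj δ) _ _).integrable_mul
    (h.rapidDecay_osc_coeff _ ⟨(hg δ').1, (hg δ').2.1⟩ _ _)

end Assumptions

/-! ### The residue formula and sufficiency of `R̂ = 0` -/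

theorem residueSum_eq (ρ : ℝ) (w : ℂ → ℂ) (m : ℤˣ → ℂ → ℝ → ℂ) {L : ℕ}
    (pole : Fin L → ℂ) (δ δ' : ℤˣ) (k k' : ℝ) :
    residueSum ρ w m pole δ δ' k k' = Complex.I * sgn δ * sgn δ' *
      ∑ j, simpleResidue w (pole j) * residueKernel ρ m (pole j) δ δ' k k' := by
  have hexp : ∀ (p : ℂ) (ν ν' : ℤˣ), Complex.exp (Complex.I * p * (sgn ν * k - sgn ν' * k')) =
      Complex.exp (Complex.I * sgn ν * p * k) * Complex.exp (-(Complex.I * sgn ν' * p * k')) := by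
    intro p ν ν'
    rw [← Complex.exp_add]
    congr 1
    ring
  unfold residueSum residueKernel
  congr 1
  refine Finset.sum_congr rfl fun j _ => ?_
  congr 1
  refine Finset.sum_congr rfl fun ν _ => Finset.sum_congr rfl fun ν' _ => ?_
  rw [hexp]
  rcases Int.units_eq_one_or δ with rfl | rfl <;> rcases Int.units_eq_one_or δ' with rfl | rfl <;>
  rcases Int.units_eq_one_or ν with rfl | rfl <;> rcases Int.units_eq_one_or ν' with rfl | rfl <;>
  simp [mu, coeffM, sgn] <;> ring

theorem ae_fst_ne_snd : ∀ᵐ q : ℝ × ℝ, q.1 ≠ q.2 := by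
  have hm : MeasurableSet {q : ℝ × ℝ | q.1 = q.2} := measurableSet_eq_fun measurable_fst measurable_snd
  rw [ae_iff]
  simp only [ne_eq, not_not]
  rw [Measure.volume_eq_prod, Measure.measure_prod_null hm]
  refine Eventually.of_forall fun x => ?_
  have : Prod.mk x ⁻¹' {q : ℝ × ℝ | q.1 = q.2} = {x} := by
    ext y
    simp [eq_comm]
  simp [this]

namespace Assumptions

variable {ρ γ : ℝ} {w : ℂ → ℂ} {m : ℤˣ → ℂ → ℝ → ℂ} {T R : ℝ → ℂ} {L : ℕ} {pole : Fin L → ℂ}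
  {f g : ℤˣ → ℝ → ℂ}

theorem integrable_amp_residueKernel (h : Assumptions ρ γ w m T R L pole) (hf : IsTestPair f)
    (hg : IsTestPair g) (j : Fin L) (δ δ' : ℤˣ) :
    Integrable fun q : ℝ × ℝ => amp f g δ δ' q * residueKernel ρ m (pole j) δ δ' q.1 q.2 := by
  simp_rw [← sum_partialKernel, Finset.mul_sum]
  exact integrable_finsetSum _ fun σ _ => (h.integral_pole_pair (contDiff_amp hf hg δ δ')
    (hasCompactSupport_amp hf hg δ δ') (amp_pos hf hg δ δ') _ σ j).1

theorem integral_amp_residueKernel (h : Assumptions ρ γ w m T R L pole) (hf : IsTestPair f)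
    (hg : IsTestPair g) (j : Fin L) (δ δ' : ℤˣ) :
    ∫ q : ℝ × ℝ, amp f g δ δ' q * residueKernel ρ m (pole j) δ δ' q.1 q.2 =
      ∫ k in Set.Ioi (0 : ℝ), conj (f δ k) * ∫ k' in Set.Ioi (0 : ℝ),
        g δ' k' * residueKernel ρ m (pole j) δ δ' k k' := by
  rw [← setIntegral_eq_integral_of_forall_compl_eq_zero
    (s := Set.Ioi (0 : ℝ) ×ˢ Set.Ioi (0 : ℝ)), Measure.volume_eq_prod, setIntegral_prod]
  · simp_rw [amp, mul_assoc, integral_const_mul]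
  · exact (h.integrable_amp_residueKernel hf hg j δ δ').integrableOn
  · intro q hq
    rw [mul_eq_zero]
    left
    by_contra hne
    exact hq (Set.mk_mem_prod (amp_pos hf hg δ δ' q.1 q.2 hne).1 (amp_pos hf hg δ δ' q.1 q.2 hne).2)

theorem inner₂_eq (hg : IsTestPair g) (f : ℤˣ → ℝ → ℂ) :
    inner₂ f g = ∑ δ : ℤˣ, ∫ y : ℝ, amp f g δ δ (y, y) := by
  refine Finset.sum_congr rfl fun δ _ => ?_
  exact integral_Ioi_test (hg δ).2.2 _

/-- Summing over `σ` assembles the residue kernel. The delta term survives only for `σ = 1` and `δδ'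
= 1`, that is `δ = δ'`, where it is the diagonal integral forming `(f,g)_2`. -/
theorem inner₁_transform_eq (h : Assumptions ρ γ w m T R L pole) (hf : IsTestPair f)
    (hg : IsTestPair g) :
    inner₁ (transform w m f) (transform w m g) = inner₂ f g +
      ∑ δ : ℤˣ, ∑ δ' : ℤˣ, sgn δ * sgn δ' * (Complex.I * ∑ j, simpleResidue w (pole j) *
        ∫ q : ℝ × ℝ, amp f g δ δ' q * residueKernel ρ m (pole j) δ δ' q.1 q.2) := by
  have hK : ∀ δ δ' j, ∑ σ : ℤˣ, ∫ q, amp f g δ δ' q * partialKernel ρ m (pole j) (δ * δ') σ q =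
      ∫ q : ℝ × ℝ, amp f g δ δ' q * residueKernel ρ m (pole j) δ δ' q.1 q.2 := by
    intro δ δ' j
    rw [← integral_finsetSum]
    · simp_rw [← sum_partialKernel, Finset.mul_sum]
    · exact fun σ _ => (h.integral_pole_pair (contDiff_amp hf hg δ δ')
        (hasCompactSupport_amp hf hg δ δ') (amp_pos hf hg δ δ') _ σ j).1
  have hosc : ∀ δ δ', ∑ σ : ℤˣ, (∫ r : ℝ, w r * ∫ q : ℝ × ℝ,
        amp f g δ δ' q * coeffM m (δ * δ') (σ * (δ * δ')) r q.1 q.2 *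
        Complex.exp (Complex.I * r * ((q.1 - rsgn σ * q.2 : ℝ) : ℂ))) =
      2 * Real.pi * ((if δ = δ' then ∫ y : ℝ, amp f g δ δ' (y, y) else 0) +
        Complex.I * ∑ j, simpleResidue w (pole j) *
          ∫ q : ℝ × ℝ, amp f g δ δ' q * residueKernel ρ m (pole j) δ δ' q.1 q.2) := by
    intro δ δ'
    simp_rw [h.integral_oscillatory (contDiff_amp hf hg δ δ') (hasCompactSupport_amp hf hg δ δ')
      (amp_pos hf hg δ δ')]
    rw [Finset.sum_add_distrib, Finset.sum_ite_eq' Finset.univ (1 : ℤˣ), ← Finset.mul_sum,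
      Finset.sum_comm]
    simp_rw [← Finset.mul_sum, hK, Finset.mem_univ, if_true]
    have : δ * δ' = 1 ↔ δ = δ' := by
      rw [mul_eq_one_iff_eq_inv, Int.units_inv_eq_self]
    simp_rw [this, mul_add, mul_ite, mul_zero, mul_assoc]
  have hpi : (Real.pi : ℂ) ≠ 0 := Complex.ofReal_ne_zero.2 Real.pi_ne_zero
  rw [h.inner₁_transform hf hg, inner₂_eq hg f]
  simp_rw [hosc]
  rw [Finset.mul_sum, ← Finset.sum_add_distrib]
  refine Finset.sum_congr rfl fun δ _ => ?_
  have hd : ∑ δ' : ℤˣ, sgn δ * sgn δ' * (if δ = δ' then ∫ y : ℝ, amp f g δ δ' (y, y) else 0) =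
      ∫ y : ℝ, amp f g δ δ (y, y) := by
    simp_rw [mul_ite, mul_zero]
    rw [Finset.sum_ite_eq, if_pos (Finset.mem_univ _), sgn_sq, one_mul]
  rw [← hd, ← Finset.sum_add_distrib, Finset.mul_sum]
  refine Finset.sum_congr rfl fun δ' _ => ?_
  field_simp

theorem integrable_amp_residueSum (h : Assumptions ρ γ w m T R L pole) (hf : IsTestPair f)
    (hg : IsTestPair g) (δ δ' : ℤˣ) :
    Integrable fun q : ℝ × ℝ => amp f g δ δ' q * residueSum ρ w m pole δ δ' q.1 q.2 := by
  simp_rw [residueSum_eq, Finset.mul_sum]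
  refine integrable_finsetSum _ fun j _ => ?_
  refine ((h.integrable_amp_residueKernel hf hg j δ δ').const_mul
    (Complex.I * sgn δ * sgn δ' * simpleResidue w (pole j))).congr
    (Eventually.of_forall fun q => ?_)
  ring

theorem inner₁_transform_eq_residueSum (h : Assumptions ρ γ w m T R L pole) (hf : IsTestPair f)
    (hg : IsTestPair g) :
    inner₁ (transform w m f) (transform w m g) = inner₂ f g + ∑ δ : ℤˣ, ∑ δ' : ℤˣ,
      ∫ q : ℝ × ℝ, amp f g δ δ' q * residueSum ρ w m pole δ δ' q.1 q.2 := by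
  rw [h.inner₁_transform_eq hf hg]
  congr 1
  refine Finset.sum_congr rfl fun δ _ => Finset.sum_congr rfl fun δ' _ => ?_
  simp_rw [residueSum_eq, ← integral_const_mul]
  rw [← integral_finsetSum _ fun j _ => (h.integrable_amp_residueKernel hf hg j δ δ').const_mul _,
    ← integral_const_mul, ← integral_const_mul]
  congr 1 with q
  simp_rw [Finset.mul_sum]
  exact Finset.sum_congr rfl fun j _ => by ring

theorem isIsometric_of_residueSum_eq_zero (h : Assumptions ρ γ w m T R L pole)
    (h0 : ∀ (δ δ' : ℤˣ) (k k' : ℝ), 0 < k → 0 < k' → k ≠ k' →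
      residueSum ρ w m pole δ δ' k k' = 0) : IsIsometric w m := by
  intro f hf
  refine ⟨h.memLp_transform hf, ?_⟩
  rw [h.inner₁_transform_eq_residueSum hf hf]
  refine add_eq_left.2 (Finset.sum_eq_zero fun δ _ => Finset.sum_eq_zero fun δ' _ => ?_)
  refine integral_eq_zero_of_ae ?_
  filter_upwards [ae_fst_ne_snd] with q hq
  by_cases hV : amp f f δ δ' q = 0
  · simp [hV]
  · have := amp_pos hf hf δ δ' q.1 q.2 hV
    simp [h0 δ δ' q.1 q.2 this.1 this.2 hq]

end Assumptions

/-! ### Necessity of `R̂ = 0`: polarization and localization -/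

theorem IsTestPair.add {f g : ℤˣ → ℝ → ℂ} (hf : IsTestPair f) (hg : IsTestPair g) :
    IsTestPair (f + g) := fun δ =>
  ⟨(hf δ).1.add (hg δ).1, (hf δ).2.1.add (hg δ).2.1,
    (tsupport_add (f δ) (g δ)).trans (Set.union_subset (hf δ).2.2 (hg δ).2.2)⟩

theorem IsTestPair.const_smul {f : ℤˣ → ℝ → ℂ} (hf : IsTestPair f) (c : ℂ) :
    IsTestPair (c • f) := fun δ =>
  ⟨(hf δ).1.const_smul c, (hf δ).2.1.smul_left (f := fun _ => c),
    (tsupport_smul_subset_right (fun _ : ℝ => c) (f δ)).trans (hf δ).2.2⟩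

/-- The test pair with one bump function in component `δ`. -/
theorem isTestPair_single (δ : ℤˣ) {k : ℝ} (φ : ContDiffBump k)
    (hφ : Metric.closedBall k φ.rOut ⊆ Set.Ioi 0) :
    IsTestPair (Pi.single δ fun x => ((φ x : ℝ) : ℂ)) := by
  intro ε
  rcases eq_or_ne ε δ with rfl | hne
  · rw [Pi.single_eq_same]
    have hc : HasCompactSupport fun x => ((φ x : ℝ) : ℂ) :=
      φ.hasCompactSupport.comp_left (g := fun x : ℝ => (x : ℂ)) Complex.ofReal_zero
    refine ⟨Complex.ofRealCLM.contDiff.comp φ.contDiff, hc, ?_⟩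
    refine (closure_mono ?_).trans (φ.tsupport_eq.subset.trans hφ)
    intro x hx
    simpa using hx
  · rw [Pi.single_eq_of_ne hne]
    refine ⟨contDiff_const, HasCompactSupport.zero, ?_⟩
    exact (tsupport_eq_empty_iff.2 rfl).subset.trans (Set.empty_subset _)

namespace Assumptions

variable {ρ γ : ℝ} {w : ℂ → ℂ} {m : ℤˣ → ℂ → ℝ → ℂ} {T R : ℝ → ℂ} {L : ℕ} {pole : Fin L → ℂ}
  {f g : ℤˣ → ℝ → ℂ}

/-- The deviation from isometry, by polarization. -/
theorem sum_integral_residueSum_eq_zero (h : Assumptions ρ γ w m T R L pole)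
    (hiso : IsIsometric w m) (hf : IsTestPair f) (hg : IsTestPair g) :
    ∑ δ : ℤˣ, ∑ δ' : ℤˣ,
      ∫ q : ℝ × ℝ, amp f g δ δ' q * residueSum ρ w m pole δ δ' q.1 q.2 = 0 := by
  let D : (ℤˣ → ℝ → ℂ) → (ℤˣ → ℝ → ℂ) → ℂ := fun f g => ∑ δ : ℤˣ, ∑ δ' : ℤˣ,
      ∫ q : ℝ × ℝ, amp f g δ δ' q * residueSum ρ w m pole δ δ' q.1 q.2
  have h0 : ∀ {f}, IsTestPair f → D f f = 0 := by
    intro f hf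
    have := (hiso f hf).2
    rw [h.inner₁_transform_eq_residueSum hf hf] at this
    exact add_eq_left.1 this
  have hadd : ∀ {f g}, IsTestPair f → IsTestPair g →
      D (f + g) (f + g) = D f f + D f g + D g f + D g g := by
    intro f g hf hg
    simp only [D]
    simp_rw [← Finset.sum_add_distrib]
    refine Finset.sum_congr rfl fun δ _ => Finset.sum_congr rfl fun δ' _ => ?_
    have i := fun {f g : ℤˣ → ℝ → ℂ} (hf : IsTestPair f) (hg : IsTestPair g) =>
      h.integrable_amp_residueSum hf hg δ δ'
    rw [← integral_add' (i hf hf) (i hf hg), ← integral_add' ((i hf hf).add (i hf hg)) (i hg hf),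
      ← integral_add' (((i hf hf).add (i hf hg)).add (i hg hf)) (i hg hg)]
    congr 1 with q
    simp only [amp, Pi.add_apply, map_add]
    ring
  have hr : D f (Complex.I • g) = Complex.I * D f g := by
    simp only [D, Finset.mul_sum, ← integral_const_mul]
    refine Finset.sum_congr rfl fun δ _ => Finset.sum_congr rfl fun δ' _ => ?_
    congr 1 with q
    simp only [amp, Pi.smul_apply, smul_eq_mul]
    ring
  have hl : D (Complex.I • g) f = -Complex.I * D g f := by
    simp only [D, Finset.mul_sum, ← integral_const_mul]
    refine Finset.sum_congr rfl fun δ _ => Finset.sum_congr rfl fun δ' _ => ?_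
    congr 1 with q
    simp only [amp, Pi.smul_apply, smul_eq_mul, map_mul, Complex.conj_I]
    ring
  have hIg := hg.const_smul Complex.I
  have e1 := hadd hf hg
  have e2 := hadd hf hIg
  rw [h0 (hf.add hg), h0 hf, h0 hg] at e1
  rw [h0 (hf.add hIg), h0 hf, h0 hIg, hr, hl] at e2
  change D f g = 0
  -- Isometry at `f + g` gives `D f g + D g f = 0`, and at `f + ig` it gives `i (D f g - D g f) =
  -- 0`.
  linear_combination (-1 / 2 : ℂ) * e1 + Complex.I / 2 * e2 + (D f g - D g f) / 2 * Complex.I_sq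

theorem continuousAt_residueSum (h : Assumptions ρ γ w m T R L pole) (δ δ' : ℤˣ) {k k' : ℝ}
    (hk : 0 < k) (hk' : 0 < k') (hne : k ≠ k') :
    ContinuousAt (fun q : ℝ × ℝ => residueSum ρ w m pole δ δ' q.1 q.2) (k, k') := by
  simp_rw [residueSum_eq, residueKernel]
  refine continuousAt_const.mul (tendsto_finsetSum _ fun j _ => continuousAt_const.mul
    (tendsto_finsetSum _ fun ν _ => tendsto_finsetSum _ fun ν' _ => ?_))
  refine ContinuousAt.mul (ContinuousAt.div ?_ ?_ ?_)
    (h.contDiff_coeffM _ _ _).continuous.continuousAt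
  · exact Continuous.continuousAt (by fun_prop)
  · exact Continuous.continuousAt (by fun_prop)
  · have hx : rsgn ν * k - rsgn ν' * k' ≠ 0 := by
      rcases Int.units_eq_one_or ν with rfl | rfl <;> rcases Int.units_eq_one_or ν' with rfl | rfl <;>
      simp only [rsgn, Units.val_one, Units.val_neg, Int.cast_neg, Int.cast_one, one_mul, neg_mul] <;>
      intro h0
      · exact hne (by linarith)
      · linarith
      · linarith
      · exact hne (by linarith)
    have := one_sub_exp_ne_zero h.rho_pos hx
    have e : (ρ : ℂ) * (sgn ν' * k' - sgn ν * k) = -(ρ * (rsgn ν * k - rsgn ν' * k' : ℝ)) := by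
      rw [sgn_eq_rsgn, sgn_eq_rsgn]
      push_cast
      ring
    simpa only [e] using this

/-- If `R̂` had a nonzero value `c` at `(k,k')`, then by continuity off the diagonal `Re (conj c ·
R̂)` would be positive nearby. Integrated against a product of bumps placed in the components `δ`
and `δ'`, it would give a positive number, against polarization. -/
theorem residueSum_eq_zero_of_isIsometric (h : Assumptions ρ γ w m T R L pole)
    (hiso : IsIsometric w m) (δ δ' : ℤˣ) {k k' : ℝ} (hk : 0 < k) (hk' : 0 < k') (hne : k ≠ k') :
    residueSum ρ w m pole δ δ' k k' = 0 := by
  by_contra hR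
  set c := residueSum ρ w m pole δ δ' k k' with hc
  let F : ℝ × ℝ → ℝ := fun q => (conj c * residueSum ρ w m pole δ δ' q.1 q.2).re
  have hF : ContinuousAt F (k, k') := Complex.continuous_re.continuousAt.comp
    (continuousAt_const.mul (h.continuousAt_residueSum δ δ' hk hk' hne))
  have hF0 : 0 < F (k, k') := by
    simp only [F]
    rw [← hc, ← Complex.normSq_eq_conj_mul_self, Complex.ofReal_re]
    exact Complex.normSq_pos.2 hR
  have hev : ∀ᶠ q : ℝ × ℝ in 𝓝 (k, k'), 0 < F q ∧ 0 < q.1 ∧ 0 < q.2 :=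
    (hF.eventually (lt_mem_nhds hF0)).and
      ((continuous_fst.continuousAt.eventually (lt_mem_nhds hk)).and
        (continuous_snd.continuousAt.eventually (lt_mem_nhds hk')))
  obtain ⟨ε, hε, hball⟩ := Metric.eventually_nhds_iff_ball.1 hev
  let φ : ContDiffBump k := ⟨ε / 3, ε / 2, by positivity, by linarith⟩
  let ψ : ContDiffBump k' := ⟨ε / 3, ε / 2, by positivity, by linarith⟩
  have hmem : ∀ x y, x ∈ Metric.ball k ε → y ∈ Metric.ball k' ε → (x, y) ∈ Metric.ball (k, k') ε :=
    fun x y hx hy => by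
      rw [← ball_prod_same]
      exact ⟨hx, hy⟩
  have hsub : ∀ a : ℝ, Metric.closedBall a (ε / 2) ⊆ Metric.ball a ε := fun a =>
    Metric.closedBall_subset_ball (by linarith)
  have hφ := isTestPair_single δ φ fun x hx =>
    (hball _ (hmem x k' (hsub _ hx) (Metric.mem_ball_self hε))).2.1
  have hψ := isTestPair_single δ' ψ fun y hy =>
    (hball _ (hmem k y (Metric.mem_ball_self hε) (hsub _ hy))).2.2
  have hz := h.sum_integral_residueSum_eq_zero hiso hφ hψ
  -- Each bump occupies one component, so a single term of the double sum over signs remains.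
  rw [Fintype.sum_eq_single δ, Fintype.sum_eq_single δ'] at hz
  rotate_left
  · intro ε' he
    simp [amp, Pi.single_eq_of_ne he]
  · intro ε' he
    simp [amp, Pi.single_eq_of_ne he]
  have hint := (h.integrable_amp_residueSum hφ hψ δ δ').const_mul (conj c)
  simp only [amp, Pi.single_eq_same, Complex.conj_ofReal] at hz hint
  have hre : ∀ q : ℝ × ℝ, (conj c * ((φ q.1 : ℂ) * (ψ q.2 : ℂ) *
      residueSum ρ w m pole δ δ' q.1 q.2)).re = φ q.1 * ψ q.2 * F q := by
    intro q
    simp only [F]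
    rw [← Complex.re_ofReal_mul]
    congr 1
    push_cast
    ring
  have hint' : Integrable fun q : ℝ × ℝ => φ q.1 * ψ q.2 * F q := by
    simpa only [RCLike.re_to_complex, hre] using hint.re
  have hzero : ∫ q : ℝ × ℝ, φ q.1 * ψ q.2 * F q = 0 := by
    simp_rw [← hre]
    have := integral_re hint
    simp only [RCLike.re_to_complex] at this
    rw [this, integral_const_mul, hz, mul_zero, Complex.zero_re]
  have hsupp : ∀ q : ℝ × ℝ, φ q.1 * ψ q.2 ≠ 0 → 0 < F q := by
    intro q hq
    have h1 : q.1 ∈ Metric.ball k (ε / 2) := by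
      rw [← φ.support_eq]
      exact left_ne_zero_of_mul hq
    have h2 : q.2 ∈ Metric.ball k' (ε / 2) := by
      rw [← ψ.support_eq]
      exact right_ne_zero_of_mul hq
    exact (hball _ (hmem q.1 q.2 (Metric.ball_subset_ball (by linarith) h1)
      (Metric.ball_subset_ball (by linarith) h2))).1
  have hnn : ∀ q : ℝ × ℝ, 0 ≤ φ q.1 * ψ q.2 := fun q => mul_nonneg φ.nonneg ψ.nonneg
  have hpos : 0 < ∫ q : ℝ × ℝ, φ q.1 * ψ q.2 * F q := by
    rw [integral_pos_iff_support_of_nonneg _ hint']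
    · refine (Metric.measure_ball_pos volume (k, k') (half_pos hε)).trans_le (measure_mono ?_)
      intro q hq
      rw [← ball_prod_same] at hq
      have h1 : φ q.1 ≠ 0 := by
        have : q.1 ∈ Function.support φ := by rw [φ.support_eq]; exact hq.1
        exact this
      have h2 : ψ q.2 ≠ 0 := by
        have : q.2 ∈ Function.support ψ := by rw [ψ.support_eq]; exact hq.2
        exact this
      exact mul_ne_zero (mul_ne_zero h1 h2) (hsupp q (mul_ne_zero h1 h2)).ne'
    · intro q
      rcases (hnn q).eq_or_lt with h0 | h0
      · simp [← h0]
      · exact mul_nonneg h0.le (hsupp q h0.ne').le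
  exact hpos.ne' hzero

end Assumptions

end PlaneWave

theorem theoremA1 (ρ γ : ℝ) (w : ℂ → ℂ) (m : ℤˣ → ℂ → ℝ → ℂ) (T R : ℝ → ℂ)
    (L : ℕ) (pole : Fin L → ℂ) (h : PlaneWave.Assumptions ρ γ w m T R L pole) :
    (∀ f g : ℤˣ → ℝ → ℂ, PlaneWave.IsTestPair f → PlaneWave.IsTestPair g →
      MemLp (PlaneWave.transform w m f) 2 volume ∧
      MemLp (PlaneWave.transform w m g) 2 volume ∧
      (∀ (j : Fin L) (δ δ' : ℤˣ),
        IntegrableOn (fun p : ℝ × ℝ => conj (f δ p.1) *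
            (g δ' p.2 * PlaneWave.residueKernel ρ m (pole j) δ δ' p.1 p.2))
          (Set.Ioi (0 : ℝ) ×ˢ Set.Ioi (0 : ℝ)) volume) ∧
      PlaneWave.inner₁ (PlaneWave.transform w m f) (PlaneWave.transform w m g) =
        PlaneWave.inner₂ f g +
          Complex.I * ∑ j, PlaneWave.simpleResidue w (pole j) *
            ∑ δ : ℤˣ, ∑ δ' : ℤˣ, PlaneWave.sgn δ * PlaneWave.sgn δ' *
              ∫ k in Set.Ioi (0 : ℝ), conj (f δ k) *
                ∫ k' in Set.Ioi (0 : ℝ),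
                  g δ' k' * PlaneWave.residueKernel ρ m (pole j) δ δ' k k') ∧
    (PlaneWave.IsIsometric w m ↔
      ∀ (δ δ' : ℤˣ) (k k' : ℝ), 0 < k → 0 < k' → k ≠ k' →
        PlaneWave.residueSum ρ w m pole δ δ' k k' = 0) := by
  refine ⟨fun f g hf hg => ⟨h.memLp_transform hf, h.memLp_transform hg, fun j δ δ' => ?_, ?_⟩,
    fun hiso δ δ' k k' hk hk' hne => h.residueSum_eq_zero_of_isIsometric hiso δ δ' hk hk' hne,
    h.isIsometric_of_residueSum_eq_zero⟩
  · simp_rw [← mul_assoc]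
    exact (h.integrable_amp_residueKernel hf hg j δ δ').integrableOn
  · rw [h.inner₁_transform_eq hf hg]
    congr 1
    simp_rw [← h.integral_amp_residueKernel hf hg, Finset.mul_sum]
    rw [Finset.sum_comm]
    refine (Finset.sum_congr rfl fun δ' _ => Finset.sum_comm).trans ?_
    rw [Finset.sum_comm]
    refine Finset.sum_congr rfl fun j _ => ?_
    rw [Finset.sum_comm]
    refine Finset.sum_congr rfl fun δ _ => Finset.sum_congr rfl fun δ' _ => ?_
    ring
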